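/- Let $n\in\mathbb{N}_0$ and $k\in\mathbb{N}_0$ (so $k$ is finite), and let $E$ be a real Hausdorff locally convex topological vector space (not necessarily complete or metrizable). A subset $U\subseteq\mathbb{R}^n$ is called locally convex if every $x\in U$ has a convex neighbourhood in $U$ (with respect to the induced topology on $U$), and it is said to have dense interior if its interior $U^\circ$ in $\mathbb{R}^n$ is dense in $U$. For a locally convex set $U\subseteq\mathbb{R}^n$ with dense interior, let $C^k(U,E)$ be the real vector space of all continuous functions $f\colon U\to E$ such that, for each integer $l$ with $1\le l\le k$, the iterated directional derivatives $d^{(l)}f(x,y_1,\dots,y_l):=(D_{y_l}\cdots D_{y_1}f)(x)$ exist for all $x\in U^\circ$ and $y_1,\dots,y_l\in\mathbb{R}^n$, and the function $d^{(l)}f\colon U^\circ\times(\mathbb{R}^n)^l\to E$ is continuous and has a (necessarily unique) continuous extension $d^{(l)}f\colon U\times(\mathbb{R}^n)^l\to E$. By means of these extensions the partial derivatives $\partial^\alpha f\colon U\to E$ are defined on all of $U$ for every multi-index $\alpha\in\mathbb{N}_0^n$ with $|\alpha|\le k$ (with $\partial^0 f=f$). Endow $C^k(U,E)$ with the compact-open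 $C^k$-topology, i.e. the locally convex vector space topology generated by the seminorms $$\|f\|_{C^l,q,K}:=\max_{|\alpha|\le l}\ \sup_{x\in K} q(\partial^\alpha f(x)),$$ where $l\in\mathbb{N}_0$ with $l\le k$, $q$ is a continuous seminorm on $E$ and $K\subseteq U$ is compact. Let $U\subseteq\mathbb{R}^n$ be a locally convex set with dense interior, and let $A\subseteq U$ be a subset which is closed in $U$, locally compact, locally convex and has dense interior. Then the restriction map $$C^k(U,E)\to C^k(A,E),\qquad f\mapsto f|_A,$$ has a continuous linear right inverse: there is a continuous linear map $\Phi\colon C^k(A,E)\to C^k(U,E)$ with $\Phi(f)|_A=f$ for all $f\in C^k(A,E)$. -/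

import Mathlib

open Set Filter Topology

set_option linter.unusedSectionVars false

noncomputable section

namespace CkExt

section Calculus

variable {F : Type*} [AddCommGroup F] [Module ℝ F] [TopologicalSpace F]
variable {E : Type*} [AddCommGroup E] [Module ℝ E] [TopologicalSpace E]

/-- `U` is locally convex (every point of `U` has a convex neighbourhood in `U`) and its interior
is dense in `U`. -/
class IsLocallyConvexDenseInterior (U : Set F) : Prop where
  exists_convex_nhds : ∀ x ∈ U, ∃ V ⊆ U, V ∈ 𝓝[U] x ∧ Convex ℝ V
  subset_closure_interior : U ⊆ closure (interior U)

/-- The directional derivative of `g : U → E` at the interior point `x` of `U` in direction `y`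
exists and equals `v`. The function is extended by `0` outside `U`; as `x` is an interior point,
this does not affect the limit. -/
def HasDirDerivAt {U : Set F} (g : U → E) (v : E) (x : U) (y : F) : Prop :=
  Tendsto (fun t : ℝ => t⁻¹ • (Function.extend Subtype.val g 0 ((x : F) + t • y) - g x))
    (𝓝[≠] 0) (𝓝 v)

/-- `d` is the family of differentials `d^{(l)} f : U × F^l → E`, `l ≤ k`, of `f : U → E`:
`d^{(0)} f = f`, on the interior of `U` one has
`d^{(l+1)} f (x, y₁, …, y_{l+1}) = D_{y_{l+1}} (d^{(l)} f (·, y₁, …, y_l)) (x)`,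
and every `d^{(l)} f` with `l ≤ k` is continuous on `U × F^l`. Thus, on the interior,
`d^{(l)} f (x, y₁, …, y_l) = (D_{y_l} ⋯ D_{y_1} f) (x)`, and `d^{(l)} f` on `U × F^l` is the
continuous extension of this function. The values `d l` for `l > k` are irrelevant. -/
structure IsDifferentialFamily (k : ℕ) {U : Set F} (f : U → E)
    (d : ∀ l : ℕ, U → (Fin l → F) → E) : Prop where
  zero : ∀ (x : U) (y : Fin 0 → F), d 0 x y = f x
  succ : ∀ l : ℕ, l < k → ∀ x : U, (x : F) ∈ interior U → ∀ y : Fin (l + 1) → F,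
    HasDirDerivAt (fun z => d l z (Fin.init y)) (d (l + 1) x y) x (y (Fin.last l))
  continuous : ∀ l : ℕ, l ≤ k → Continuous fun p : U × (Fin l → F) => d l p.1 p.2

/-- `f : U → E` is a `C^k`-function. -/
def IsCk (k : ℕ) {U : Set F} (f : U → E) : Prop :=
  ∃ d : ∀ l : ℕ, U → (Fin l → F) → E, IsDifferentialFamily k f d

theorem extend_add {U : Set F} (g h : U → E) (z : F) :
    Function.extend Subtype.val (fun x => g x + h x) 0 z =
      Function.extend Subtype.val g 0 z + Function.extend Subtype.val h 0 z := by
  by_cases hz : ∃ a : U, (a : F) = z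
  · obtain ⟨a, rfl⟩ := hz
    simp
  · simp [Function.extend_apply' _ _ _ hz]

theorem extend_smul {U : Set F} (c : ℝ) (g : U → E) (z : F) :
    Function.extend Subtype.val (fun x => c • g x) 0 z =
      c • Function.extend Subtype.val g 0 z := by
  by_cases hz : ∃ a : U, (a : F) = z
  · obtain ⟨a, rfl⟩ := hz
    simp
  · simp [Function.extend_apply' _ _ _ hz]

theorem HasDirDerivAt.add [IsTopologicalAddGroup E] {U : Set F} {g h : U → E} {v w : E} {x : U}
    {y : F} (hg : HasDirDerivAt g v x y) (hh : HasDirDerivAt h w x y) :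
    HasDirDerivAt (fun z => g z + h z) (v + w) x y := by
  refine (Tendsto.add hg hh).congr fun t => ?_
  rw [extend_add, ← smul_add]
  rw [add_sub_add_comm]

theorem HasDirDerivAt.const_smul [ContinuousSMul ℝ E] {U : Set F} {g : U → E} {v : E} {x : U}
    {y : F} (c : ℝ) (hg : HasDirDerivAt g v x y) :
    HasDirDerivAt (fun z => c • g z) (c • v) x y := by
  refine (Tendsto.const_smul hg c).congr fun t => ?_
  rw [extend_smul, ← smul_sub, smul_comm]

theorem IsDifferentialFamily.add [IsTopologicalAddGroup E] {k : ℕ} {U : Set F} {f f' : U → E}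
    {d d' : ∀ l : ℕ, U → (Fin l → F) → E} (h : IsDifferentialFamily k f d)
    (h' : IsDifferentialFamily k f' d') :
    IsDifferentialFamily k (f + f') (fun l x y => d l x y + d' l x y) where
  zero x y := by simp [h.zero, h'.zero]
  succ l hl x hx y := (h.succ l hl x hx y).add (h'.succ l hl x hx y)
  continuous l hl := (h.continuous l hl).add (h'.continuous l hl)

theorem IsDifferentialFamily.const_smul [ContinuousSMul ℝ E] {k : ℕ} {U : Set F} {f : U → E}
    {d : ∀ l : ℕ, U → (Fin l → F) → E} (c : ℝ) (h : IsDifferentialFamily k f d) :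
    IsDifferentialFamily k (c • f) (fun l x y => c • d l x y) where
  zero x y := by simp [h.zero]
  succ l hl x hx y := (h.succ l hl x hx y).const_smul c
  continuous l hl := (h.continuous l hl).const_smul c

theorem IsDifferentialFamily.zero_family (k : ℕ) (U : Set F) :
    IsDifferentialFamily k (0 : U → E) (fun _ _ _ => 0) where
  zero x y := rfl
  succ l hl x hx y := by
    have h0 : (Function.extend Subtype.val (fun _ : U => (0 : E)) 0 : F → E) = 0 := by
      funext z
      by_cases hz : ∃ a : U, (a : F) = z
      · obtain ⟨a, rfl⟩ := hz
        simp
      · simp [Function.extend_apply' _ _ _ hz]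
    simp only [HasDirDerivAt, h0]
    simpa using tendsto_const_nhds
  continuous l hl := continuous_const

/-- The differentials of order at most `k` are uniquely determined. -/
theorem IsDifferentialFamily.unique [T2Space E] {k : ℕ} {U : Set F}
    [hU : IsLocallyConvexDenseInterior U] {f : U → E} {d d' : ∀ l : ℕ, U → (Fin l → F) → E}
    (h : IsDifferentialFamily k f d) (h' : IsDifferentialFamily k f d') :
    ∀ l ≤ k, ∀ (x : U) (y : Fin l → F), d l x y = d' l x y := by
  intro l
  induction l with
  | zero => intro _ x y; rw [h.zero, h'.zero]
  | succ l ih =>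
    intro hl x y
    have hdense : Dense {x : U | (x : F) ∈ interior U} := by
      rw [Subtype.dense_iff]
      intro z hz
      refine closure_mono ?_ (hU.subset_closure_interior hz)
      intro w hw
      exact ⟨⟨w, interior_subset hw⟩, hw, rfl⟩
    have hc : Continuous fun x : U => d (l + 1) x y :=
      (h.continuous (l + 1) hl).comp (continuous_id.prodMk continuous_const)
    have hc' : Continuous fun x : U => d' (l + 1) x y :=
      (h'.continuous (l + 1) hl).comp (continuous_id.prodMk continuous_const)
    refine congrFun (Continuous.ext_on hdense hc hc' ?_) x
    intro z hz
    have h1 := h.succ l hl z hz y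
    have h2 := h'.succ l hl z hz y
    have hfun : (fun w => d l w (Fin.init y)) = fun w => d' l w (Fin.init y) :=
      funext fun w => ih (Nat.le_of_succ_le hl) w _
    rw [hfun] at h1
    exact tendsto_nhds_unique h1 h2

theorem IsDifferentialFamily.restrict {k : ℕ} {U A : Set F} (hAU : A ⊆ U) {f : U → E}
    {d : ∀ l : ℕ, U → (Fin l → F) → E} (h : IsDifferentialFamily k f d)
    [ContinuousAdd F] [ContinuousSMul ℝ F] :
    IsDifferentialFamily k (f ∘ inclusion hAU) (fun l x y => d l (inclusion hAU x) y) where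
  zero x y := h.zero _ y
  succ l hl x hx y := by
    have h1 := h.succ l hl (inclusion hAU x) (interior_mono hAU hx) y
    refine Tendsto.congr' ?_ h1
    have hlim : Tendsto (fun t : ℝ => (x : F) + t • y (Fin.last l)) (𝓝[≠] 0) (𝓝 (x : F)) := by
      have hcont : Continuous fun t : ℝ => (x : F) + t • y (Fin.last l) := by fun_prop
      simpa using (hcont.tendsto 0).mono_left nhdsWithin_le_nhds
    filter_upwards [hlim (mem_interior_iff_mem_nhds.1 hx)] with t ht
    have e1 := Subtype.val_injective.extend_apply
      (fun z : U => d l z (Fin.init y)) 0 ⟨_, hAU ht⟩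
    have e2 := Subtype.val_injective.extend_apply
      (fun z : A => d l (inclusion hAU z) (Fin.init y)) 0 ⟨_, ht⟩
    simp only at e1 e2 ⊢
    rw [e1, e2]
  continuous l hl :=
    (h.continuous l hl).comp
      (((continuous_inclusion hAU).comp continuous_fst).prodMk continuous_snd)

variable [IsTopologicalAddGroup E] [ContinuousSMul ℝ E]

/-- The `C^k`-functions `U → E`, as a linear subspace of all functions `U → E`. -/
def ckSubmodule (k : ℕ) (U : Set F) (E : Type*) [AddCommGroup E] [Module ℝ E]
    [TopologicalSpace E] [IsTopologicalAddGroup E] [ContinuousSMul ℝ E] :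
    Submodule ℝ (U → E) where
  carrier := {f | IsCk k f}
  zero_mem' := ⟨_, IsDifferentialFamily.zero_family k U⟩
  add_mem' := by
    rintro f g ⟨d, hd⟩ ⟨d', hd'⟩
    exact ⟨_, hd.add hd'⟩
  smul_mem' := by
    rintro c f ⟨d, hd⟩
    exact ⟨_, hd.const_smul c⟩

/-- The real vector space `C^k(U, E)`. It is a type of its own, so that it does not carry the
topology of pointwise convergence. -/
def Ck (k : ℕ) (U : Set F) (E : Type*) [AddCommGroup E] [Module ℝ E]
    [TopologicalSpace E] [IsTopologicalAddGroup E] [ContinuousSMul ℝ E] : Type _ :=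
  ↥(ckSubmodule k U E)

namespace Ck

variable {k : ℕ} {U : Set F}

instance : AddCommGroup (Ck k U E) := inferInstanceAs (AddCommGroup ↥(ckSubmodule k U E))

instance : Module ℝ (Ck k U E) := inferInstanceAs (Module ℝ ↥(ckSubmodule k U E))

instance : CoeFun (Ck k U E) (fun _ => U → E) := ⟨fun f => f.1⟩

/-- The `l`-th differential `d^{(l)} f : U × F^l → E` of a `C^k`-function, for `l ≤ k`. -/
def differential (f : Ck k U E) : ∀ l : ℕ, U → (Fin l → F) → E :=
  Classical.choose f.2

theorem isDifferentialFamily (f : Ck k U E) : IsDifferentialFamily k (f : U → E) f.differential :=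
  Classical.choose_spec f.2

/-- The restriction map `C^k(U, E) → C^k(A, E)`, `f ↦ f|_A`. -/
def restrict [ContinuousAdd F] [ContinuousSMul ℝ F] {A : Set F} (hAU : A ⊆ U) :
    Ck k U E →ₗ[ℝ] Ck k A E where
  toFun f := ⟨(f : U → E) ∘ inclusion hAU, _, f.isDifferentialFamily.restrict hAU⟩
  map_add' _ _ := rfl
  map_smul' _ _ := rfl

theorem restrict_apply [ContinuousAdd F] [ContinuousSMul ℝ F] {A : Set F} (hAU : A ⊆ U)
    (f : Ck k U E) (a : A) : restrict hAU f a = f ⟨a, hAU a.2⟩ := rfl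

end Ck

end Calculus

section Topology

variable {n : ℕ} {E : Type*} [AddCommGroup E] [Module ℝ E] [TopologicalSpace E]
  [IsTopologicalAddGroup E] [ContinuousSMul ℝ E] {k : ℕ} {U : Set (EuclideanSpace ℝ (Fin n))}

/-- The word `n … n ⋯ 1 … 1` in which the letter `i` occurs `α i` times; it lists the coordinate
directions of `∂^α = ∂₁^{α₁} ⋯ ∂ₙ^{αₙ}` in the order in which the derivatives are taken. -/
def multiIndexWord (α : Fin n → ℕ) : List (Fin n) :=
  (List.finRange n).reverse.flatMap fun i => List.replicate (α i) i

theorem length_multiIndexWord (α : Fin n → ℕ) : (multiIndexWord α).length = ∑ i, α i := by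
  rw [multiIndexWord, List.length_flatMap, Fin.sum_univ_def, List.map_reverse, List.sum_reverse]
  simp

namespace Ck

/-- The partial derivative `∂^α f : U → E` of a `C^k`-function, for `|α| ≤ k`. -/
def partialDeriv (f : Ck k U E) (α : Fin n → ℕ) (x : U) : E :=
  f.differential (multiIndexWord α).length x
    fun i => EuclideanSpace.single ((multiIndexWord α).get i) (1 : ℝ)

theorem continuous_partialDeriv (f : Ck k U E) {α : Fin n → ℕ} (hα : ∑ i, α i ≤ k) :
    Continuous (f.partialDeriv α) :=
  (f.isDifferentialFamily.continuous _ ((length_multiIndexWord α).trans_le hα)).comp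
    (continuous_id.prodMk continuous_const)

theorem bddAbove_partialDeriv (f : Ck k U E) {l : ℕ} (hl : l ≤ k) {q : Seminorm ℝ E}
    (hq : Continuous q) (K : TopologicalSpace.Compacts U) :
    BddAbove (range fun p : {α : Fin n → ℕ // ∑ i, α i ≤ l} × K => q (f.partialDeriv p.1 p.2)) := by
  have hfin : Finite {α : Fin n → ℕ // ∑ i, α i ≤ l} := by
    refine Set.Finite.subset (Set.finite_Iic (fun _ : Fin n => l)) ?_
    intro α hα i
    exact (Finset.single_le_sum (fun j _ => Nat.zero_le (α j)) (Finset.mem_univ i)).trans hα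
  have hb : ∀ α : {α : Fin n → ℕ // ∑ i, α i ≤ l}, ∃ C, ∀ x : K, q (f.partialDeriv α x) ≤ C := by
    intro α
    obtain ⟨C, hC⟩ := (K.isCompact.image
      (hq.comp (f.continuous_partialDeriv (α.2.trans hl)))).bddAbove
    exact ⟨C, fun x => hC ⟨x, x.2, rfl⟩⟩
  choose C hC using hb
  obtain ⟨M, hM⟩ := (Set.finite_range C).bddAbove
  refine ⟨M, ?_⟩
  rintro _ ⟨⟨α, x⟩, rfl⟩
  exact (hC α x).trans (hM ⟨α, rfl⟩)

variable [T2Space E] [IsLocallyConvexDenseInterior U]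

theorem partialDeriv_add (f g : Ck k U E) {α : Fin n → ℕ} (hα : ∑ i, α i ≤ k) (x : U) :
    (f + g).partialDeriv α x = f.partialDeriv α x + g.partialDeriv α x :=
  (f + g).isDifferentialFamily.unique (f.isDifferentialFamily.add g.isDifferentialFamily) _
    ((length_multiIndexWord α).trans_le hα) _ _

theorem partialDeriv_smul (c : ℝ) (f : Ck k U E) {α : Fin n → ℕ} (hα : ∑ i, α i ≤ k) (x : U) :
    (c • f).partialDeriv α x = c • f.partialDeriv α x :=
  (c • f).isDifferentialFamily.unique (f.isDifferentialFamily.const_smul c) _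
    ((length_multiIndexWord α).trans_le hα) _ _

/-- The seminorm `‖f‖_{C^l, q, K} = max_{|α| ≤ l} sup_{x ∈ K} q (∂^α f (x))` on `C^k(U, E)`, for
`l ≤ k`, a continuous seminorm `q` on `E` and a compact set `K ⊆ U`. -/
def seminorm {l : ℕ} (hl : l ≤ k) (q : Seminorm ℝ E) (hq : Continuous q)
    (K : TopologicalSpace.Compacts U) : Seminorm ℝ (Ck k U E) :=
  Seminorm.of
    (fun f => ⨆ p : {α : Fin n → ℕ // ∑ i, α i ≤ l} × K, q (f.partialDeriv p.1 p.2))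
    (by
      intro f g
      refine Real.iSup_le (fun p => ?_) (add_nonneg
        (Real.iSup_nonneg fun _ => apply_nonneg q _) (Real.iSup_nonneg fun _ => apply_nonneg q _))
      rw [partialDeriv_add f g (p.1.2.trans hl)]
      exact (map_add_le_add q _ _).trans (add_le_add
        (le_ciSup (f.bddAbove_partialDeriv hl hq K) p)
        (le_ciSup (g.bddAbove_partialDeriv hl hq K) p)))
    (by
      intro c f
      rw [Real.mul_iSup_of_nonneg (norm_nonneg c)]
      refine iSup_congr fun p => ?_
      rw [partialDeriv_smul c f (p.1.2.trans hl), map_smul_eq_mul])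

/-- The family of all seminorms `‖·‖_{C^l, q, K}` on `C^k(U, E)`. -/
def seminormFamily (k : ℕ) (U : Set (EuclideanSpace ℝ (Fin n))) [IsLocallyConvexDenseInterior U]
    (E : Type*) [AddCommGroup E] [Module ℝ E] [TopologicalSpace E]
    [IsTopologicalAddGroup E] [ContinuousSMul ℝ E] [T2Space E] :
    SeminormFamily ℝ (Ck k U E)
      ({l : ℕ // l ≤ k} × {q : Seminorm ℝ E // Continuous q} × TopologicalSpace.Compacts U) :=
  fun i => seminorm i.1.2 i.2.1.1 i.2.1.2 i.2.2

/-- The compact-open `C^k`-topology: the vector space topology on `C^k(U, E)` generated by the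
seminorms `‖·‖_{C^l, q, K}`. -/
instance : TopologicalSpace (Ck k U E) :=
  (seminormFamily k U E).moduleFilterBasis.topology

theorem withSeminorms : WithSeminorms (seminormFamily k U E) := ⟨rfl⟩

end Ck

end Topology

end CkExt

end

set_option linter.unusedSectionVars false

noncomputable section

namespace CkExt

/-! ### Fréchet differentiability from continuous directional derivatives. -/

section LineDeriv

variable {X : Type*} [NormedAddCommGroup X] [NormedSpace ℝ X]

/-! The operator is Whitney's. Put `D = interior A`; since `A` has dense interior, `A ⊆ closure D`,
and since `A` is closed in `U`, every point of `U` lies in `A` or off `closure A`. Off `closure D`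
take a smooth partition of unity `φᵢ` with nodes `pᵢ ∈ D`: near `x` only boundedly many members
matter, their nodes lie within a fixed multiple of `δ = dist(x, D)`, and their `l`-th derivatives
are `O(δ⁻ˡ)` (`exists_whitneyPartition`). Set `Φ f = f` on `A` and `Φ f = ∑ φᵢ · T_{pᵢ} f`
elsewhere, where `T_p f` is the Taylor polynomial of order `k` at `p`. The nodes are interior, so
these polynomials are formed from genuine derivatives, and the formula is linear in `f`.

The analytic core is real-valued. Near a point of `A` the interior is convex, so Taylor's theorem
bounds the jets of `T_p u - T_b u` by powers of the distances times the oscillation `η` of the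
`k`-th derivative. Together with `∑ φᵢ = 1` and the Leibniz rule, the powers of `δ` lost in
differentiating `φᵢ` are regained, and `l`-th derivatives of the extension differ from those of `T_b
u` by `O(η ‖x - b‖^(k - l))` (`WhitneyPartition.exists_norm_iteratedFDeriv_whitneyExt_sub_le`). The
constant depends only on the partition and `k`.

For values in `E`, Hahn–Banach writes `q v` as the value at `v` of a functional dominated by `q`
(`seminorm_le_of_forall_dual`). Applying the scalar estimate to all such functionals at once yields
estimates in `q`. Off `closure A` the derivatives of `Φ f` are finite combinations of fixed vectors
with smooth scalar weights. Hence no integration or completeness in `E` is needed.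

The candidate differentials of `Φ f` are those of `f` on `A` and the termwise ones elsewhere
(`extFamily`). The bounds in `exists_extFamily_le_of_mem` make them continuous, and each the
directional derivative of its predecessor, at points of `A` as well
(`IsDifferentialFamily.isDifferentialFamily_extFamily`). Local compactness of `A` enters only in the
continuity of `Φ`: derivatives of `f` near `a ∈ A` are controlled by one seminorm over a compact
neighbourhood of `a` in `A`, on a ball whose radius is independent of `f`
(`exists_extFamily_le_seminorm_of_mem`). A finite cover of a compact subset of `U` finishes the
argument. -/

theorem exists_lineDeriv_eq_sub {h : X → ℝ} {h' : X → X → ℝ} {x z : X}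
    (hd : ∀ y ∈ segment ℝ x (x + z), HasLineDerivAt ℝ h (h' y z) y z) :
    ∃ y ∈ segment ℝ x (x + z), h (x + z) - h x = h' y z := by
  have hseg : ∀ t ∈ Icc (0 : ℝ) 1, x + t • z ∈ segment ℝ x (x + z) := fun t ht => by
    rw [segment_eq_image']; exact ⟨t, ht, by simp⟩
  have hder : ∀ t ∈ Icc (0 : ℝ) 1,
      HasDerivAt (fun s : ℝ => h (x + s • z)) (h' (x + t • z) z) t := by
    intro t ht
    have h1 : HasDerivAt (fun s : ℝ => h (x + t • z + s • z)) (h' (x + t • z) z) (t - t) := by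
      rw [sub_self]; exact hd _ (hseg t ht)
    have h2 := h1.comp_sub_const t t
    refine h2.congr_of_eventuallyEq (Eventually.of_forall fun s => ?_)
    simp only
    congr 1
    rw [add_assoc, ← add_smul]; congr 2; ring
  obtain ⟨c, hc, hce⟩ := exists_hasDerivAt_eq_slope (fun s : ℝ => h (x + s • z))
    (fun t => h' (x + t • z) z) one_pos
    (fun t ht => (hder t ht).continuousAt.continuousWithinAt)
    (fun t ht => hder t (Ioo_subset_Icc_self ht))
  exact ⟨_, hseg c (Ioo_subset_Icc_self hc), by simp at hce; exact hce.symm⟩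

variable {O : Set X} {h : X → ℝ} {h' : X → X → ℝ}

theorem lineDeriv_smul_eq (hd : ∀ x ∈ O, ∀ z, HasLineDerivAt ℝ h (h' x z) x z) {x : X} (hx : x ∈ O)
    (t : ℝ) (z : X) : h' x (t • z) = t * h' x z :=
  (hd x hx (t • z)).lineDeriv.symm.trans ((hd x hx z).smul t).lineDeriv

theorem lineDeriv_add_eq (hO : IsOpen O) (hd : ∀ x ∈ O, ∀ z, HasLineDerivAt ℝ h (h' x z) x z)
    (hc : ∀ z, ContinuousOn (fun x => h' x z) O) {x : X} (hx : x ∈ O) (z w : X) :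
    h' x (z + w) = h' x z + h' x w := by
  have key : HasLineDerivAt ℝ h (h' x z + h' x w) x (z + w) := by
    -- By the mean value theorem the increment equals `t * h' y z` for some `y` close to `x`;
    -- continuity of `h' · z` replaces `y` by `x`.
    have h1 : HasDerivAt (fun t : ℝ => h (x + t • w + t • z) - h (x + t • w)) (h' x z) 0 := by
      rw [hasDerivAt_iff_isLittleO]
      refine Asymptotics.isLittleO_iff.2 fun ε hε => ?_
      have hN : {y | y ∈ O ∧ |h' y z - h' x z| < ε} ∈ 𝓝 x := by
        have := ((hc z).continuousAt (hO.mem_nhds hx)).tendsto.eventually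
          (Metric.ball_mem_nhds _ hε)
        filter_upwards [this, hO.mem_nhds hx] with y hy hyO
        exact ⟨hyO, by simpa [Real.dist_eq] using hy⟩
      obtain ⟨ρ, hρ, hρN⟩ := Metric.mem_nhds_iff.1 hN
      have e1 : ∀ᶠ t : ℝ in 𝓝 0, x + t • w ∈ Metric.ball x ρ := by
        have : Continuous fun t : ℝ => x + t • w := by fun_prop
        exact this.continuousAt.eventually (by
          simp only [zero_smul, add_zero]; exact Metric.ball_mem_nhds x hρ)
      have e2 : ∀ᶠ t : ℝ in 𝓝 0, x + t • w + t • z ∈ Metric.ball x ρ := by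
        have : Continuous fun t : ℝ => x + t • w + t • z := by fun_prop
        exact this.continuousAt.eventually (by
          simp only [zero_smul, add_zero]; exact Metric.ball_mem_nhds x hρ)
      filter_upwards [e1, e2] with t ht1 ht2
      have hs := (convex_ball x ρ).segment_subset ht1 ht2
      obtain ⟨y, hy, hye⟩ := exists_lineDeriv_eq_sub (h := h) (h' := h') (x := x + t • w)
        (z := t • z) (fun y hy => hd y (hρN (hs hy)).1 _)
      have hyN := hρN (hs hy)
      rw [lineDeriv_smul_eq hd hyN.1] at hye
      simp only [zero_smul, add_zero, sub_self, sub_zero, smul_eq_mul]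
      rw [hye, ← mul_sub, norm_mul, mul_comm]
      exact mul_le_mul_of_nonneg_right hyN.2.le (norm_nonneg _)
    have h2 : HasDerivAt (fun t : ℝ => h (x + t • w)) (h' x w) 0 := hd x hx w
    refine (h1.add h2).congr_of_eventuallyEq (Eventually.of_forall fun t => ?_)
    simp only [smul_add, Pi.add_apply, sub_add_cancel]
    congr 1; abel
  exact (hd x hx _).lineDeriv.symm.trans key.lineDeriv

/-- A function with continuous directional derivatives on an open set is differentiable. -/
theorem hasFDerivAt_of_hasLineDerivAt [FiniteDimensional ℝ X] (hO : IsOpen O)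
    (hd : ∀ x ∈ O, ∀ z, HasLineDerivAt ℝ h (h' x z) x z)
    (hc : ∀ z, ContinuousOn (fun x => h' x z) O) {x : X} (hx : x ∈ O) :
    ∃ L : X →L[ℝ] ℝ, HasFDerivAt h L x ∧ ∀ z, L z = h' x z := by
  have hL : ∀ x : X, ∃ L : X →L[ℝ] ℝ, x ∈ O → ∀ z, L z = h' x z := by
    intro x
    by_cases hx : x ∈ O
    · refine ⟨LinearMap.toContinuousLinearMap
        { toFun := h' x
          map_add' := lineDeriv_add_eq hO hd hc hx
          map_smul' := lineDeriv_smul_eq hd hx }, fun _ z => rfl⟩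
    · exact ⟨0, fun h => absurd h hx⟩
  choose L hL using hL
  -- In finite dimension pointwise continuity of the linear maps gives continuity in operator norm,
  -- which makes the mean value estimate below uniform in the direction.
  have hLc : ContinuousOn L O := by
    rw [← contDiffOn_zero (𝕜 := ℝ), contDiffOn_clm_apply]
    intro y
    rw [contDiffOn_zero]
    exact (hc y).congr fun x hx => hL x hx y
  refine ⟨L x, ?_, hL x hx⟩
  rw [hasFDerivAt_iff_isLittleO]
  refine Asymptotics.isLittleO_iff.2 fun ε hε => ?_
  have hN : {y | y ∈ O ∧ ‖L y - L x‖ < ε} ∈ 𝓝 x := by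
    have := (hLc.continuousAt (hO.mem_nhds hx)).tendsto.eventually (Metric.ball_mem_nhds _ hε)
    filter_upwards [this, hO.mem_nhds hx] with y hy hyO
    exact ⟨hyO, by simpa [dist_eq_norm] using hy⟩
  obtain ⟨ρ, hρ, hρN⟩ := Metric.mem_nhds_iff.1 hN
  filter_upwards [Metric.ball_mem_nhds x hρ] with y hy
  have hs := (convex_ball x ρ).segment_subset (Metric.mem_ball_self hρ) hy
  obtain ⟨u, hu, hue⟩ := exists_lineDeriv_eq_sub (h := h) (h' := h') (x := x)
    (z := y - x) (fun u hu => hd u (hρN (hs (by simpa using hu))).1 _)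
  rw [add_sub_cancel] at hu hue
  have huN := hρN (hs hu)
  rw [hue, ← hL u huN.1, ← sub_apply]
  exact ((L u - L x).le_opNorm _).trans
    (mul_le_mul_of_nonneg_right huN.2.le (norm_nonneg _))

/-- A function with a family of iterated directional derivatives that are continuous in the base
point is `C^k`, and the family is given by the iterated Fréchet derivatives. -/
theorem contDiffOn_of_lineDeriv_family [FiniteDimensional ℝ X] (hO : IsOpen O) (k : ℕ) :
    ∀ (h : X → ℝ) (d : ∀ l : ℕ, X → (Fin l → X) → ℝ),
    (∀ x ∈ O, ∀ y, d 0 x y = h x) →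
    (∀ l < k, ∀ x ∈ O, ∀ y : Fin (l + 1) → X,
      HasLineDerivAt ℝ (fun z => d l z (Fin.init y)) (d (l + 1) x y) x (y (Fin.last l))) →
    (∀ l ≤ k, ∀ y, ContinuousOn (fun x => d l x y) O) →
    ContDiffOn ℝ k h O ∧
      ∀ l ≤ k, ∀ x ∈ O, ∀ y, d l x y = iteratedFDeriv ℝ l h x (fun i => y i.rev) := by
  induction k with
  | zero =>
    intro h d h0 _ hc
    refine ⟨?_, ?_⟩
    · rw [Nat.cast_zero, contDiffOn_zero]
      exact (hc 0 le_rfl Fin.elim0).congr fun x hx => (h0 x hx _).symm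
    · intro l hl x hx y
      obtain rfl : l = 0 := by omega
      rw [h0 x hx]; simp
  | succ k ih =>
    intro h d h0 hs hc
    have hd1 : ∀ x ∈ O, ∀ z, HasLineDerivAt ℝ h (d 1 x (fun _ => z)) x z := by
      intro x hx z
      have := hs 0 (Nat.succ_pos k) x hx (fun _ => z)
      refine HasDerivAt.congr_of_eventuallyEq this ?_
      have hcont : Continuous fun t : ℝ => x + t • z := by fun_prop
      have : ∀ᶠ t : ℝ in 𝓝 0, x + t • z ∈ O :=
        hcont.continuousAt.eventually (by simpa using hO.mem_nhds hx)
      filter_upwards [this] with t ht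
      exact (h0 _ ht _).symm
    have hF : ∀ x ∈ O, DifferentiableAt ℝ h x ∧ ∀ z, fderiv ℝ h x z = d 1 x (fun _ => z) := by
      intro x hx
      obtain ⟨L, hL, hLe⟩ := hasFDerivAt_of_hasLineDerivAt (h' := fun x z => d 1 x (fun _ => z))
        hO hd1 (fun z => hc 1 (by omega) _) hx
      exact ⟨hL.differentiableAt, fun z => by rw [hL.fderiv, hLe]⟩
    -- The first entry of the tuple is the innermost derivative. Fixing it as `z` leaves a family of
    -- one order less for `fderiv ℝ h · z`, to which the induction hypothesis applies. In
    -- `iteratedFDeriv` the first entry is the outermost derivative, hence the reversal of the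
    -- tuple.
    have hz : ∀ z : X, ContDiffOn ℝ k (fun x => fderiv ℝ h x z) O ∧ ∀ l ≤ k, ∀ x ∈ O,
        ∀ y : Fin l → X, d (l + 1) x (Fin.cons z y : Fin (l + 1) → X) =
          iteratedFDeriv ℝ l (fun x => fderiv ℝ h x z) x (fun i => y i.rev) := by
      intro z
      refine ih (fun x => fderiv ℝ h x z)
        (fun l x y => d (l + 1) x (Fin.cons z y : Fin (l + 1) → X)) ?_ ?_ ?_
      · intro x hx y
        rw [(hF x hx).2]
        congr 1
        funext i
        fin_cases i; rfl
      · intro l hl x hx y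
        have := hs (l + 1) (by omega) x hx (Fin.cons z y : Fin (l + 2) → X)
        have e : Fin.init (Fin.cons z y : Fin (l + 2) → X) = Fin.cons z (Fin.init y) := by
          funext i
          induction i using Fin.cases with
          | zero => rfl
          | succ i => rfl
        rw [e, ← Fin.succ_last, Fin.cons_succ] at this
        exact this
      · intro l hl y
        exact hc (l + 1) (by omega) _
    refine ⟨?_, ?_⟩
    · push_cast
      rw [contDiffOn_succ_iff_fderiv_of_isOpen hO]
      exact ⟨fun x hx => (hF x hx).1.differentiableWithinAt, by simp,
        contDiffOn_clm_apply.2 fun z => (hz z).1⟩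
    · intro l hl x hx y
      cases l with
      | zero => rw [h0 x hx]; simp
      | succ l =>
        have hfd : ContDiffAt ℝ l (fderiv ℝ h) x :=
          ((contDiffOn_clm_apply.2 fun z => (hz z).1).contDiffAt (hO.mem_nhds hx)).of_le
            (by exact_mod_cast (by omega : l ≤ k))
        rw [iteratedFDeriv_succ_apply_right]
        have := (hz (y 0)).2 l (by omega) x hx (Fin.tail y)
        rw [Fin.cons_self_tail] at this
        rw [this]
        have e := (ContinuousLinearMap.apply ℝ ℝ (y 0)).iteratedFDeriv_comp_left hfd le_rfl
        have e' : (fun x => fderiv ℝ h x (y 0)) =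
          ContinuousLinearMap.apply ℝ ℝ (y 0) ∘ fderiv ℝ h := rfl
        rw [e', e]
        simp only [Fin.rev_last, ContinuousLinearMap.compContinuousMultilinearMap_coe,
          Function.comp_apply, ContinuousLinearMap.apply_apply]
        congr 2
        funext i
        simp [Fin.tail, Fin.init, Fin.rev_castSucc]

end LineDeriv

/-! ### Symmetry of iterated Fréchet derivatives. -/

theorem fderiv_clm_comp_apply {X F G : Type*} [NormedAddCommGroup X] [NormedSpace ℝ X]
    [NormedAddCommGroup F] [NormedSpace ℝ F] [NormedAddCommGroup G] [NormedSpace ℝ G]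
    (L : F →L[ℝ] G) {g : X → F} {x : X} (hg : DifferentiableAt ℝ g x) (a : X) :
    fderiv ℝ (fun z => L (g z)) x a = L (fderiv ℝ g x a) :=
  congrArg (fun L => L a) (L.hasFDerivAt.comp x hg.hasFDerivAt).fderiv

/-- Iterated Fréchet derivatives of a `C^l`-function over `ℝ` are symmetric. -/
theorem iteratedFDeriv_comp_perm_real {X F : Type*} [NormedAddCommGroup X] [NormedSpace ℝ X]
    [NormedAddCommGroup F] [NormedSpace ℝ F] {u : X → F} :
    ∀ {l : ℕ} {x : X}, ContDiffAt ℝ l u x → ∀ (v : Fin l → X) (σ : Equiv.Perm (Fin l)),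
    iteratedFDeriv ℝ l u x (v ∘ σ) = iteratedFDeriv ℝ l u x v := by
  have hev : ∀ {l : ℕ} {x : X}, DifferentiableAt ℝ (iteratedFDeriv ℝ l u) x →
      ∀ (a : X) (w : Fin l → X), fderiv ℝ (iteratedFDeriv ℝ l u) x a w =
        fderiv ℝ (fun z => iteratedFDeriv ℝ l u z w) x a := by
    intro l x hdiff a w
    have h3 := ((ContinuousMultilinearMap.apply ℝ (fun _ : Fin l => X) F w).hasFDerivAt
      (x := iteratedFDeriv ℝ l u x)).comp x hdiff.hasFDerivAt
    exact (congrArg (fun L => L a) h3.fderiv).symm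
  -- Adjacent transpositions generate the symmetric group, so they suffice.
  have hswap : ∀ {l : ℕ} {x : X}, ContDiffAt ℝ (l + 1 : ℕ) u x → ∀ (i : Fin l)
      (v : Fin (l + 1) → X),
      iteratedFDeriv ℝ (l + 1) u x (v ∘ Equiv.swap i.castSucc i.succ) =
        iteratedFDeriv ℝ (l + 1) u x v := by
    intro l
    induction l with
    | zero => intro x _ i; exact i.elim0
    | succ l ih =>
      intro x hu i v
      induction i using Fin.cases with
      | zero =>
        -- Exchanging the two outermost directions is symmetry of the second derivative of
        -- `iteratedFDeriv ℝ l u`.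
        have hD : ContDiffAt ℝ 2 (iteratedFDeriv ℝ l u) x :=
          hu.iteratedFDeriv_right (by push_cast; rw [add_assoc, add_comm]; norm_num)
        have hD1 : DifferentiableAt ℝ (fderiv ℝ (iteratedFDeriv ℝ l u)) x :=
          (hD.fderiv_right (m := 1) (by norm_num)).differentiableAt (by simp)
        have h2 : ∀ v : Fin (l + 2) → X, iteratedFDeriv ℝ (l + 2) u x v =
            fderiv ℝ (fderiv ℝ (iteratedFDeriv ℝ l u)) x (v 0) (v 1)
              (fun j => v j.succ.succ) := by
          intro v
          have hdiff : DifferentiableAt ℝ (iteratedFDeriv ℝ (l + 1) u) x :=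
            hu.differentiableAt_iteratedFDeriv (by exact_mod_cast Nat.lt_succ_self _)
          rw [iteratedFDeriv_succ_apply_left, hev hdiff]
          have h4 := fderiv_clm_comp_apply (F := X →L[ℝ] (X [×l]→L[ℝ] F)) (G := F)
            (g := fderiv ℝ (iteratedFDeriv ℝ l u)) ((ContinuousMultilinearMap.apply ℝ
            (fun _ : Fin l => X) F (fun j => v j.succ.succ)).comp
            (ContinuousLinearMap.apply ℝ (X [×l]→L[ℝ] F) (v 1))) hD1 (v 0)
          exact h4
        have hsym := hD.isSymmSndFDerivAt (by simp)
        have e0 : (v ∘ Equiv.swap (Fin.castSucc (0 : Fin (l + 1))) (Fin.succ 0)) 0 = v 1 := by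
          simp
        have e1 : (v ∘ Equiv.swap (Fin.castSucc (0 : Fin (l + 1))) (Fin.succ 0)) 1 = v 0 := by
          simp
        refine (h2 _).trans (Eq.trans ?_ (h2 _).symm)
        rw [e0, e1, hsym.eq]
        congr 1
      | succ i =>
        -- The transposition avoids the outermost slot: differentiate, in that direction, the
        -- identity of order one less, which holds in a neighbourhood of `x`.
        rw [iteratedFDeriv_succ_apply_left, iteratedFDeriv_succ_apply_left]
        have e0 : (v ∘ Equiv.swap i.succ.castSucc i.succ.succ) 0 = v 0 := by
          simp only [Function.comp_apply]
          rw [Equiv.swap_apply_of_ne_of_ne]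
          · simp [Fin.ext_iff]
          · simp [Fin.ext_iff]
        have et : Fin.tail (v ∘ Equiv.swap i.succ.castSucc i.succ.succ) =
            Fin.tail v ∘ Equiv.swap i.castSucc i.succ := by
          funext j
          simp only [Fin.tail, Function.comp_apply]
          rw [← (Fin.succ_injective _).swap_apply]
          rfl
        rw [e0, et]
        have hdiff : DifferentiableAt ℝ (iteratedFDeriv ℝ (l + 1) u) x :=
          hu.differentiableAt_iteratedFDeriv (by exact_mod_cast Nat.lt_succ_self _)
        rw [hev hdiff, hev hdiff]
        congr 1
        apply Filter.EventuallyEq.fderiv_eq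
        have hu' : ContDiffAt ℝ (l + 1 : ℕ) u x :=
          hu.of_le (by exact_mod_cast Nat.le_succ _)
        filter_upwards [hu'.eventually (by simp)] with z hz
        exact ih hz i _
  intro l
  cases l with
  | zero =>
    intro x _ v σ
    congr 1
    funext i
    exact i.elim0
  | succ l =>
    intro x hu v σ
    have hσ : σ ∈ Submonoid.closure
        (Set.range fun i : Fin l ↦ Equiv.swap i.castSucc i.succ) := by
      rw [Equiv.Perm.mclosure_swap_castSucc_succ]; trivial
    induction hσ using Submonoid.closure_induction generalizing v with
    | mem σ h => obtain ⟨i, rfl⟩ := h; exact hswap hu i v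
    | one => rfl
    | mul σ τ _ _ h1 h2 =>
      rw [Equiv.Perm.coe_mul, ← Function.comp_assoc, h2, h1]

/-! ### Taylor polynomials and their quantitative estimates. -/

section Taylor

variable {X : Type*} [NormedAddCommGroup X] [NormedSpace ℝ X]

/-- The Taylor polynomial of order `k` of `u` at `p`. -/
def taylorPoly (k : ℕ) (u : X → ℝ) (p x : X) : ℝ :=
  ∑ l ∈ Finset.range (k + 1), (l.factorial : ℝ)⁻¹ * iteratedFDeriv ℝ l u p (fun _ => x - p)

/-- The formal power series of the Taylor polynomial. -/
def taylorSeriesUpTo (k : ℕ) (u : X → ℝ) (p : X) : FormalMultilinearSeries ℝ X ℝ := fun l =>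
  if l < k + 1 then (l.factorial : ℝ)⁻¹ • iteratedFDeriv ℝ l u p else 0

theorem hasFiniteFPowerSeriesOnBall_taylorPoly (k : ℕ) (u : X → ℝ) (p : X) :
    HasFiniteFPowerSeriesOnBall (taylorPoly k u p) (taylorSeriesUpTo k u p) p (k + 1) ⊤ := by
  refine .mk' (fun m hm => if_neg (not_lt.2 hm)) ENNReal.zero_lt_top fun y _ => ?_
  refine Finset.sum_congr rfl fun l hl => ?_
  rw [taylorSeriesUpTo, if_pos (Finset.mem_range.1 hl)]
  simp

theorem analyticOnNhd_taylorPoly (k : ℕ) (u : X → ℝ) (p : X) :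
    AnalyticOnNhd ℝ (taylorPoly k u p) univ := by
  have := (hasFiniteFPowerSeriesOnBall_taylorPoly k u p).cpolynomialOn.analyticOnNhd
  rwa [Metric.eball_top] at this

theorem contDiff_taylorPoly (k : ℕ) (u : X → ℝ) (p : X) {m : WithTop ℕ∞} :
    ContDiff ℝ m (taylorPoly k u p) :=
  (analyticOnNhd_taylorPoly k u p).contDiff

/-- Re-expanding the finite power series at `x` preserves its degree bound, so its coefficient of
order `k + 1` vanishes. -/
theorem iteratedFDeriv_taylorPoly_succ (k : ℕ) (u : X → ℝ) (p x : X) :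
    iteratedFDeriv ℝ (k + 1) (taylorPoly k u p) x = 0 := by
  have h := (hasFiniteFPowerSeriesOnBall_taylorPoly k u p).changeOrigin (y := x - p)
    ENNReal.coe_lt_top
  rw [add_sub_cancel] at h
  ext v
  rw [h.toHasFPowerSeriesOnBall.iteratedFDeriv_eq_sum_of_completeSpace]
  refine Finset.sum_eq_zero fun σ _ => ?_
  rw [h.finite _ le_rfl]; rfl

/-- The derivative of a power series at its centre is the sum of its coefficient over all
permutations of the arguments. By symmetry of the derivatives of `u` the `l!` summands agree and
cancel the factor `1 / l!`. -/
theorem iteratedFDeriv_taylorPoly_self {k : ℕ} {u : X → ℝ} {p : X} (hu : ContDiffAt ℝ k u p)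
    {l : ℕ} (hl : l ≤ k) :
    iteratedFDeriv ℝ l (taylorPoly k u p) p = iteratedFDeriv ℝ l u p := by
  ext v
  rw [(hasFiniteFPowerSeriesOnBall_taylorPoly k u
    p).toHasFPowerSeriesOnBall.iteratedFDeriv_eq_sum_of_completeSpace]
  have : ∀ σ : Equiv.Perm (Fin l), taylorSeriesUpTo k u p l (fun i => v (σ i)) =
      (l.factorial : ℝ)⁻¹ * iteratedFDeriv ℝ l u p v := by
    intro σ
    rw [taylorSeriesUpTo, if_pos (Nat.lt_succ_of_le hl)]
    have := iteratedFDeriv_comp_perm_real (hu.of_le (by exact_mod_cast hl)) v σ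
    rw [← this]; rfl
  rw [Finset.sum_congr rfl fun σ _ => this σ, Finset.sum_const, Finset.card_univ,
    Fintype.card_perm, Fintype.card_fin, nsmul_eq_mul, ← mul_assoc, mul_inv_cancel₀, one_mul]
  exact_mod_cast l.factorial_ne_zero

theorem norm_iteratedFDeriv_sub_le {O C : Set X} (hO : IsOpen O) (hC : Convex ℝ C) (hCO : C ⊆ O)
    {k : ℕ} {h : X → ℝ} (hh : ContDiffOn ℝ k h O) {l : ℕ} (hl : l < k) {B : ℝ}
    (hB : ∀ y ∈ C, ‖iteratedFDeriv ℝ (l + 1) h y‖ ≤ B) {x y : X} (hx : x ∈ C) (hy : y ∈ C) :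
    ‖iteratedFDeriv ℝ l h y - iteratedFDeriv ℝ l h x‖ ≤ B * ‖y - x‖ := by
  refine hC.norm_image_sub_le_of_norm_fderiv_le (𝕜 := ℝ) (fun z hz => ?_) (fun z hz => ?_) hx hy
  · exact (hh.contDiffAt (hO.mem_nhds (hCO hz))).differentiableAt_iteratedFDeriv
      (by exact_mod_cast hl)
  · rw [norm_fderiv_iteratedFDeriv]; exact hB z hz

/-- Descending induction on the order: a bound on the derivative of order `l + 1` within distance
`s` of `b` gives, by the mean value inequality, one of order `l`, to which the jet at `b` is added.
Each step gains a factor `s` and at most doubles the constant. -/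
theorem norm_iteratedFDeriv_le_of_jet {O C : Set X} (hO : IsOpen O) (hC : Convex ℝ C) (hCO : C ⊆ O)
    {k : ℕ} {h : X → ℝ} (hh : ContDiffOn ℝ k h O) {b : X} (hb : b ∈ C) {M s : ℝ} (hM : 0 ≤ M)
    (hs : 0 ≤ s) (hjet : ∀ l < k, ‖iteratedFDeriv ℝ l h b‖ ≤ M * s ^ (k - l))
    (htop : ∀ x ∈ C, ‖x - b‖ ≤ s → ‖iteratedFDeriv ℝ k h x‖ ≤ M) {l : ℕ} (hl : l ≤ k) {x : X}
    (hx : x ∈ C) (hxs : ‖x - b‖ ≤ s) :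
    ‖iteratedFDeriv ℝ l h x‖ ≤ 2 ^ k * M * s ^ (k - l) := by
  have key : ∀ j ≤ k, ∀ x ∈ C, ‖x - b‖ ≤ s →
      ‖iteratedFDeriv ℝ (k - j) h x‖ ≤ 2 ^ j * M * s ^ j := by
    intro j
    induction j with
    | zero => intro _ x hx hxs; simpa using htop x hx hxs
    | succ j ih =>
      intro hj x hx hxs
      have hC' : Convex ℝ (C ∩ Metric.closedBall b s) := hC.inter (convex_closedBall b s)
      have h1 := norm_iteratedFDeriv_sub_le hO hC' (inter_subset_left.trans hCO) hh
        (l := k - (j + 1)) (by omega) (B := 2 ^ j * M * s ^ j) (fun y hy => by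
          rw [show k - (j + 1) + 1 = k - j by omega]
          exact ih (by omega) y hy.1 (by simpa [dist_eq_norm] using hy.2))
        (x := b) (y := x) ⟨hb, by simpa using hs⟩ ⟨hx, by simpa [dist_eq_norm] using hxs⟩
      have h2 := hjet (k - (j + 1)) (by omega)
      rw [show k - (k - (j + 1)) = j + 1 by omega] at h2
      have h3 : 2 ^ j * M * s ^ j * ‖x - b‖ ≤ 2 ^ j * M * s ^ j * s := by gcongr
      have h4 : M * s ^ (j + 1) ≤ 2 ^ j * M * s ^ (j + 1) := by
        have : (1 : ℝ) ≤ 2 ^ j := one_le_pow₀ (by norm_num)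
        have h0 : 0 ≤ M * s ^ (j + 1) := by positivity
        nlinarith
      have h5 := norm_le_norm_add_norm_sub' (iteratedFDeriv ℝ (k - (j + 1)) h x)
        (iteratedFDeriv ℝ (k - (j + 1)) h b)
      calc _ ≤ 2 ^ j * M * s ^ (j + 1) + 2 ^ j * M * s ^ j * s :=
            h5.trans (add_le_add (h2.trans h4) (h1.trans h3))
        _ = _ := by ring
  have := key (k - l) (by omega) x hx hxs
  rw [show k - (k - l) = l by omega] at this
  refine this.trans ?_
  gcongr
  · norm_num
  · omega

theorem iteratedFDeriv_eq_of_succ_eq_zero {k : ℕ} {P : X → ℝ} (hP : ContDiff ℝ (k + 1 : ℕ) P)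
    (h0 : ∀ x, iteratedFDeriv ℝ (k + 1) P x = 0) (x y : X) :
    iteratedFDeriv ℝ k P x = iteratedFDeriv ℝ k P y := by
  have := norm_iteratedFDeriv_sub_le isOpen_univ convex_univ (subset_univ _) hP.contDiffOn
    (Nat.lt_succ_self k) (B := 0) (fun y _ => by rw [h0]; simp) (mem_univ y) (mem_univ x)
  simpa [sub_eq_zero] using this

/-- A polynomial of degree at most `k` with small jet at `a` is small near `a`. -/
theorem norm_iteratedFDeriv_le_of_succ_eq_zero {k : ℕ} {P : X → ℝ} (hP : ContDiff ℝ (k + 1 : ℕ) P)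
    (h0 : ∀ x, iteratedFDeriv ℝ (k + 1) P x = 0) {a : X} {M s : ℝ} (hM : 0 ≤ M) (hs : 0 ≤ s)
    (hjet : ∀ l ≤ k, ‖iteratedFDeriv ℝ l P a‖ ≤ M * s ^ (k - l)) {l : ℕ} (hl : l ≤ k) {x : X}
    (hxs : ‖x - a‖ ≤ s) : ‖iteratedFDeriv ℝ l P x‖ ≤ 2 ^ k * M * s ^ (k - l) := by
  refine norm_iteratedFDeriv_le_of_jet isOpen_univ convex_univ (subset_univ _)
    (hP.of_le (by exact_mod_cast Nat.le_succ k)).contDiffOn (mem_univ a) hM hs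
    (fun l hl => hjet l hl.le) (fun y _ _ => ?_) hl (mem_univ x) hxs
  rw [iteratedFDeriv_eq_of_succ_eq_zero hP h0 y a]
  simpa using hjet k le_rfl

/-- Taylor's theorem for the derivatives of a `C^k`-function on a convex set. -/
theorem norm_iteratedFDeriv_sub_taylorPoly_le {O C : Set X} (hO : IsOpen O) (hC : Convex ℝ C)
    (hCO : C ⊆ O) {k : ℕ} {u : X → ℝ} (hu : ContDiffOn ℝ k u O) {ω : ℝ}
    (hω : ∀ x ∈ C, ∀ y ∈ C, ‖iteratedFDeriv ℝ k u x - iteratedFDeriv ℝ k u y‖ ≤ ω)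
    {l : ℕ} (hl : l ≤ k) {x b : X} (hx : x ∈ C) (hb : b ∈ C) :
    ‖iteratedFDeriv ℝ l u x - iteratedFDeriv ℝ l (taylorPoly k u b) x‖ ≤
      2 ^ k * ω * ‖x - b‖ ^ (k - l) := by
  have hsub : ∀ l ≤ k, ∀ x ∈ C, iteratedFDeriv ℝ l (u - taylorPoly k u b) x =
      iteratedFDeriv ℝ l u x - iteratedFDeriv ℝ l (taylorPoly k u b) x := fun l hl x hx =>
    iteratedFDeriv_sub_apply ((hu.contDiffAt (hO.mem_nhds (hCO hx))).of_le (by exact_mod_cast hl))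
      (contDiff_taylorPoly k u b).contDiffAt
  have hbb : ∀ l ≤ k, iteratedFDeriv ℝ l (taylorPoly k u b) b = iteratedFDeriv ℝ l u b :=
    fun l hl => iteratedFDeriv_taylorPoly_self (hu.contDiffAt (hO.mem_nhds (hCO hb))) hl
  have hω0 : 0 ≤ ω := (norm_nonneg _).trans (hω b hb b hb)
  rw [← hsub l hl x hx]
  -- The remainder has zero jet at `b`, and since the `k`-th derivative of the Taylor polynomial is
  -- constant, that of the remainder is an oscillation of the `k`-th derivative of `u`.
  refine norm_iteratedFDeriv_le_of_jet (h := u - taylorPoly k u b) hO hC hCO (hu.sub (contDiff_taylorPoly k u b).contDiffOn)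
    hb hω0 (norm_nonneg _) (fun l hl => ?_) (fun y hy _ => ?_) hl hx le_rfl
  · rw [hsub l hl.le b hb, hbb l hl.le, sub_self, norm_zero]; positivity
  · rw [hsub k le_rfl y hy, iteratedFDeriv_eq_of_succ_eq_zero (contDiff_taylorPoly k u b)
      (iteratedFDeriv_taylorPoly_succ k u b) y b, hbb k le_rfl]
    exact hω y hy b hb

/-- Whitney's compatibility of jets. The difference is a polynomial of degree at most `k` whose jet
at `p` is the Taylor remainder at `b`; a small jet at `p` then spreads to the points within `s` of
`p`, which need not lie in `C`. -/
theorem norm_iteratedFDeriv_taylorPoly_sub_le {O C : Set X} (hO : IsOpen O) (hC : Convex ℝ C)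
    (hCO : C ⊆ O) {k : ℕ} {u : X → ℝ} (hu : ContDiffOn ℝ k u O) {ω : ℝ}
    (hω : ∀ x ∈ C, ∀ y ∈ C, ‖iteratedFDeriv ℝ k u x - iteratedFDeriv ℝ k u y‖ ≤ ω)
    {l : ℕ} (hl : l ≤ k) {p b x : X} (hp : p ∈ C) (hb : b ∈ C) {s : ℝ} (hpb : ‖p - b‖ ≤ s)
    (hxp : ‖x - p‖ ≤ s) :
    ‖iteratedFDeriv ℝ l (taylorPoly k u p - taylorPoly k u b) x‖ ≤
      2 ^ k * (2 ^ k * ω) * s ^ (k - l) := by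
  have hω0 : 0 ≤ ω := (norm_nonneg _).trans (hω b hb b hb)
  have hsub : ∀ l x, iteratedFDeriv ℝ l (taylorPoly k u p - taylorPoly k u b) x =
      iteratedFDeriv ℝ l (taylorPoly k u p) x - iteratedFDeriv ℝ l (taylorPoly k u b) x :=
    fun l x => iteratedFDeriv_sub_apply (contDiff_taylorPoly k u p).contDiffAt
      (contDiff_taylorPoly k u b).contDiffAt
  refine norm_iteratedFDeriv_le_of_succ_eq_zero (P := taylorPoly k u p - taylorPoly k u b)
    ((contDiff_taylorPoly k u p).sub (contDiff_taylorPoly k u b)) (fun x => ?_) (a := p)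
    (by positivity) ((norm_nonneg _).trans hpb) (fun l hl => ?_) hl hxp
  · rw [hsub, iteratedFDeriv_taylorPoly_succ, iteratedFDeriv_taylorPoly_succ, sub_self]
  · rw [hsub, iteratedFDeriv_taylorPoly_self (hu.contDiffAt (hO.mem_nhds (hCO hp))) hl]
    refine (norm_iteratedFDeriv_sub_taylorPoly_le hO hC hCO hu hω hl hp hb).trans ?_
    gcongr

/-- The order `l` is unrestricted because the mean value arguments below use one derivative more,
hence possibly order `k + 1`; beyond `k` everything vanishes. -/
theorem norm_iteratedFDeriv_taylorPoly_le {k : ℕ} {u : X → ℝ} {b : X} (hu : ContDiffAt ℝ k u b)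
    {M : ℝ} (hM : ∀ l ≤ k, ‖iteratedFDeriv ℝ l u b‖ ≤ M) (l : ℕ) {x : X}
    (hx : ‖x - b‖ ≤ 1) : ‖iteratedFDeriv ℝ l (taylorPoly k u b) x‖ ≤ 2 ^ k * M := by
  have hM0 : 0 ≤ M := (norm_nonneg _).trans (hM 0 (Nat.zero_le k))
  rcases le_or_gt l k with hl | hl
  · have := norm_iteratedFDeriv_le_of_succ_eq_zero (contDiff_taylorPoly k u b)
      (iteratedFDeriv_taylorPoly_succ k u b) hM0 zero_le_one (a := b) (fun l hl => by
        rw [iteratedFDeriv_taylorPoly_self hu hl]; simpa using hM l hl) hl hx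
    simpa using this
  · have : ∀ m, ∀ y, iteratedFDeriv ℝ (k + 1 + m) (taylorPoly k u b) y = 0 := by
      intro m
      induction m with
      | zero => exact iteratedFDeriv_taylorPoly_succ k u b
      | succ m ih =>
        intro y
        have h0 : iteratedFDeriv ℝ (k + 1 + m) (taylorPoly k u b) = fun _ => 0 := funext ih
        rw [← norm_eq_zero, ← add_assoc, ← norm_fderiv_iteratedFDeriv, h0]
        simp only [fderiv_fun_const, Pi.zero_apply]
        exact norm_zero (E := X →L[ℝ] (X [×k + 1 + m]→L[ℝ] ℝ))
    obtain ⟨m, rfl⟩ := Nat.exists_eq_add_of_le (Nat.succ_le_of_lt hl)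
    rw [Nat.succ_eq_add_one, this m x, norm_zero]; positivity

theorem norm_iteratedFDeriv_taylorPoly_sub_self_le {k : ℕ} {u : X → ℝ} {b : X}
    (hu : ContDiffAt ℝ k u b) {M : ℝ} (hM : ∀ l ≤ k, ‖iteratedFDeriv ℝ l u b‖ ≤ M) (l : ℕ) {x : X}
    (hx : ‖x - b‖ ≤ 1) :
    ‖iteratedFDeriv ℝ l (taylorPoly k u b) x - iteratedFDeriv ℝ l (taylorPoly k u b) b‖ ≤
      2 ^ k * M * ‖x - b‖ := by
  refine norm_iteratedFDeriv_sub_le isOpen_univ (convex_closedBall b 1) (subset_univ _)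
    (k := l + 1) (contDiff_taylorPoly k u b).contDiffOn (Nat.lt_succ_self l) (fun y hy => ?_)
    (by simp) (by simpa [dist_eq_norm] using hx)
  exact norm_iteratedFDeriv_taylorPoly_le hu hM _ (by simpa [dist_eq_norm] using hy)

/-- First-order expansion with quadratic remainder of the `l`-th derivative of the Taylor
polynomial. It serves to identify the limits of difference quotients of the extension at points of
`A`. -/
theorem norm_iteratedFDeriv_taylorPoly_sub_sub_le {k : ℕ} {u : X → ℝ} {b : X}
    (hu : ContDiffAt ℝ k u b) {M : ℝ} (hM : ∀ l ≤ k, ‖iteratedFDeriv ℝ l u b‖ ≤ M) {l : ℕ}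
    (hl : l < k) {x : X} (hx : ‖x - b‖ ≤ 1) (y : Fin l → X) :
    ‖iteratedFDeriv ℝ l (taylorPoly k u b) x y - iteratedFDeriv ℝ l u b y -
      iteratedFDeriv ℝ (l + 1) u b (Fin.cons (x - b) y : Fin (l + 1) → X)‖ ≤
      2 ^ k * M * ‖x - b‖ * ‖x - b‖ * ∏ i, ‖y i‖ := by
  set T := taylorPoly k u b
  have hT : ∀ z, DifferentiableAt ℝ (iteratedFDeriv ℝ l T) z := fun z =>
    ((contDiff_taylorPoly k u b (m := (l + 1 : ℕ))).contDiffAt).differentiableAt_iteratedFDeriv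
      (by exact_mod_cast Nat.lt_succ_self l)
  have h1 : ‖iteratedFDeriv ℝ l T x - iteratedFDeriv ℝ l T b -
      fderiv ℝ (iteratedFDeriv ℝ l T) b (x - b)‖ ≤ 2 ^ k * M * ‖x - b‖ * ‖x - b‖ := by
    refine (convex_closedBall b ‖x - b‖).norm_image_sub_le_of_norm_fderiv_le' (𝕜 := ℝ)
      (fun z _ => hT z) (fun z hz => ?_) (by simp) (by simp [dist_eq_norm])
    have hz : ‖z - b‖ ≤ ‖x - b‖ := by simpa [dist_eq_norm] using hz
    have hM0 : 0 ≤ M := (norm_nonneg _).trans (hM 0 (Nat.zero_le k))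
    have h2 := norm_iteratedFDeriv_taylorPoly_sub_self_le hu hM (l + 1) (hz.trans hx)
    -- Currying is an isometry.
    have h3 : ‖fderiv ℝ (iteratedFDeriv ℝ l T) z - fderiv ℝ (iteratedFDeriv ℝ l T) b‖ =
        ‖iteratedFDeriv ℝ (l + 1) T z - iteratedFDeriv ℝ (l + 1) T b‖ := by
      have := (continuousMultilinearCurryLeftEquiv ℝ (fun _ : Fin (l + 1) => X) ℝ).symm.dist_map
        (fderiv ℝ (iteratedFDeriv ℝ l T) z) (fderiv ℝ (iteratedFDeriv ℝ l T) b)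
      rw [dist_eq_norm, dist_eq_norm] at this
      exact this.symm
    rw [h3]
    exact h2.trans (by gcongr)
  have h2 : iteratedFDeriv ℝ (l + 1) u b (Fin.cons (x - b) y : Fin (l + 1) → X) =
      fderiv ℝ (iteratedFDeriv ℝ l T) b (x - b) y := by
    rw [← iteratedFDeriv_taylorPoly_self hu hl, iteratedFDeriv_succ_apply_left]
    simp [T]
  rw [h2, ← iteratedFDeriv_taylorPoly_self hu hl.le]
  have h4 := (iteratedFDeriv ℝ l T x - iteratedFDeriv ℝ l T b -
      fderiv ℝ (iteratedFDeriv ℝ l T) b (x - b)).le_opNorm y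
  refine le_trans (le_of_eq ?_) (h4.trans ?_)
  · simp [T]
  · gcongr

end Taylor

/-! ### A smooth partition of unity over the integer lattice, with uniform bounds. -/

section Lattice

open scoped ContDiff

/-- A smooth function on the line, supported in `[-1, 1]`, whose integer translates add up to 1. -/
def bumpOne (t : ℝ) : ℝ := Real.smoothTransition (t + 1) - Real.smoothTransition t

theorem contDiff_bumpOne : ContDiff ℝ ∞ bumpOne := by
  unfold bumpOne
  exact (Real.smoothTransition.contDiff.comp (contDiff_id.add contDiff_const)).sub
    Real.smoothTransition.contDiff

theorem bumpOne_eq_zero_of_le {t : ℝ} (ht : t ≤ -1) : bumpOne t = 0 := by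
  rw [bumpOne, Real.smoothTransition.zero_of_nonpos (by linarith),
    Real.smoothTransition.zero_of_nonpos (by linarith), sub_self]

theorem bumpOne_eq_zero_of_ge {t : ℝ} (ht : 1 ≤ t) : bumpOne t = 0 := by
  rw [bumpOne, Real.smoothTransition.one_of_one_le (by linarith),
    Real.smoothTransition.one_of_one_le ht, sub_self]

/-- The sum telescopes to a difference of two smooth transitions, one already equal to `1` and the
other still `0`. -/
theorem sum_bumpOne (a : ℤ) (N : ℕ) {t : ℝ} (h1 : a ≤ t) (h2 : t ≤ a + N) :
    ∑ m ∈ Finset.Icc a (a + N), bumpOne (t - m) = 1 := by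
  have key : ∀ N : ℕ, ∑ m ∈ Finset.Icc a (a + N), bumpOne (t - m) =
      Real.smoothTransition (t - a + 1) - Real.smoothTransition (t - a - N) := by
    intro N
    induction N with
    | zero => simp [bumpOne]
    | succ N ih =>
      have : Finset.Icc a (a + (N + 1 : ℕ)) = insert (a + (N + 1 : ℕ)) (Finset.Icc a (a + N)) := by
        ext m; simp only [Finset.mem_Icc, Finset.mem_insert]; omega
      rw [this, Finset.sum_insert (by simp), ih, bumpOne]
      push_cast
      rw [show t - (a + (N + 1 : ℝ)) + 1 = t - a - N by ring,
        show t - (a + (N + 1 : ℝ)) = t - a - (N + 1) by ring]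
      ring
  rw [key, Real.smoothTransition.one_of_one_le (by linarith),
    Real.smoothTransition.zero_of_nonpos (by linarith), sub_zero]

variable {n : ℕ}

/-- The product bump function on Euclidean space. -/
def latticeBump (x : EuclideanSpace ℝ (Fin n)) : ℝ := ∏ i, bumpOne (x i)

/-- The point of Euclidean space with the given integer coordinates. -/
def latticePoint (m : Fin n → ℤ) : EuclideanSpace ℝ (Fin n) := WithLp.toLp 2 fun i => (m i : ℝ)

theorem contDiff_latticeBump : ContDiff ℝ ∞ (latticeBump (n := n)) := by
  unfold latticeBump
  refine contDiff_prod fun i _ => contDiff_bumpOne.comp ?_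
  fun_prop

theorem norm_le_of_forall_abs_le {x : EuclideanSpace ℝ (Fin n)} {c : ℝ} (hc : 0 ≤ c)
    (h : ∀ i, |x i| ≤ c) : ‖x‖ ≤ c * n := by
  rw [EuclideanSpace.norm_eq]
  refine Real.sqrt_le_iff.2 ⟨by positivity, ?_⟩
  calc ∑ i, ‖x i‖ ^ 2 ≤ ∑ _i : Fin n, c ^ 2 := Finset.sum_le_sum fun i _ => by
        rw [Real.norm_eq_abs]; gcongr; exact h i
    _ = n * c ^ 2 := by simp
    _ ≤ n ^ 2 * c ^ 2 := by
        gcongr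
        exact_mod_cast Nat.le_self_pow two_ne_zero n
    _ = _ := by ring

theorem abs_le_of_latticeBump_ne_zero {x : EuclideanSpace ℝ (Fin n)} (h : latticeBump x ≠ 0)
    (i : Fin n) : |x i| ≤ 1 := by
  have := Finset.prod_ne_zero_iff.1 h i (Finset.mem_univ i)
  rw [abs_le]
  constructor
  · by_contra hc; exact this (bumpOne_eq_zero_of_le (by linarith))
  · by_contra hc; exact this (bumpOne_eq_zero_of_ge (by linarith))

theorem norm_lt_of_latticeBump_ne_zero {x : EuclideanSpace ℝ (Fin n)} (h : latticeBump x ≠ 0) :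
    ‖x‖ < n + 1 := by
  have := norm_le_of_forall_abs_le zero_le_one (abs_le_of_latticeBump_ne_zero h)
  linarith

theorem exists_norm_iteratedFDeriv_latticeBump_le (n l : ℕ) :
    ∃ c : ℝ, ∀ x : EuclideanSpace ℝ (Fin n), ‖iteratedFDeriv ℝ l latticeBump x‖ ≤ c := by
  have hc : HasCompactSupport (latticeBump (n := n)) := by
    refine HasCompactSupport.intro (isCompact_closedBall (0 : EuclideanSpace ℝ (Fin n)) (n + 1))
      fun x hx => ?_
    by_contra h
    exact hx (by simpa using (norm_lt_of_latticeBump_ne_zero h).le)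
  exact (contDiff_latticeBump.continuous_iteratedFDeriv
    (by exact_mod_cast le_top)).bounded_above_of_compact_support (hc.iteratedFDeriv l)

/-- The integer points near `y`. -/
def latticeBox (y : EuclideanSpace ℝ (Fin n)) : Finset (Fin n → ℤ) :=
  Fintype.piFinset fun i => Finset.Icc (⌊y i⌋ - 1) (⌊y i⌋ - 1 + (3 : ℕ))

theorem card_latticeBox (y : EuclideanSpace ℝ (Fin n)) : (latticeBox y).card = 4 ^ n := by
  have h : ∀ a : ℤ, (Finset.Icc (a - 1) (a - 1 + (3 : ℕ))).card = 4 := fun a => by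
    rw [Int.card_Icc]; omega
  rw [latticeBox, Fintype.card_piFinset, Finset.prod_congr rfl fun i _ => h _]
  simp

theorem norm_sub_latticePoint_le {y : EuclideanSpace ℝ (Fin n)} {m : Fin n → ℤ}
    (hm : m ∈ latticeBox y) : ‖y - latticePoint m‖ ≤ 3 * (n + 1) := by
  have : ‖y - latticePoint m‖ ≤ 3 * n := by
    refine norm_le_of_forall_abs_le (by norm_num) fun i => ?_
    have := Finset.mem_Icc.1 (Fintype.mem_piFinset.1 hm i)
    have h1 : ((⌊y i⌋ - 1 : ℤ) : ℝ) ≤ m i := by exact_mod_cast this.1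
    have h2 : (m i : ℝ) ≤ ((⌊y i⌋ - 1 + (3 : ℕ) : ℤ) : ℝ) := by exact_mod_cast this.2
    push_cast at h1 h2
    have h3 := Int.floor_le (y i)
    have h4 := Int.lt_floor_add_one (y i)
    simp only [latticePoint, PiLp.sub_apply]
    rw [abs_le]; constructor <;> linarith
  linarith

/-- Four integers per coordinate, from `⌊y i⌋ - 1` to `⌊y i⌋ + 2`, catch every bump that is nonzero
at some `z` with `⌊y i⌋ - 1 < z i < ⌊y i⌋ + 2`. So one finite index set serves a whole neighbourhood
of `y` and sums may be differentiated termwise. -/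
theorem eventually_latticeBox (y : EuclideanSpace ℝ (Fin n)) :
    ∀ᶠ z in 𝓝 y, (∀ m ∉ latticeBox y, latticeBump (z - latticePoint m) = 0) ∧
      ∑ m ∈ latticeBox y, latticeBump (z - latticePoint m) = 1 := by
  have h : ∀ᶠ z in 𝓝 y, ∀ i, ((⌊y i⌋ : ℝ) - 1) < z i ∧ z i < (⌊y i⌋ : ℝ) + 2 := by
    rw [eventually_all]
    intro i
    have hc : Continuous fun z : EuclideanSpace ℝ (Fin n) => z i := by fun_prop
    exact hc.continuousAt.eventually (Ioo_mem_nhds (a := (⌊y i⌋ : ℝ) - 1) (b := (⌊y i⌋ : ℝ) + 2) (by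
      simp only; linarith [Int.floor_le (y i)]) (by simp only; linarith [Int.lt_floor_add_one (y i)]))
  filter_upwards [h] with z hz
  constructor
  · intro m hm
    simp only [latticeBox, Fintype.mem_piFinset, not_forall, Finset.mem_Icc, not_and_or,
      not_le] at hm
    obtain ⟨i, hi⟩ := hm
    refine Finset.prod_eq_zero (Finset.mem_univ i) ?_
    simp only [latticePoint, PiLp.sub_apply]
    rcases hi with hi | hi
    · refine bumpOne_eq_zero_of_ge ?_
      have : (m i : ℝ) + 1 ≤ (⌊y i⌋ - 1 : ℤ) := by exact_mod_cast hi
      push_cast at this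
      linarith [(hz i).1]
    · refine bumpOne_eq_zero_of_le ?_
      have : ((⌊y i⌋ - 1 + (3 : ℕ) : ℤ) : ℝ) + 1 ≤ m i := by exact_mod_cast hi
      push_cast at this
      linarith [(hz i).2]
  · simp only [latticeBump, latticePoint, PiLp.sub_apply, latticeBox]
    -- The sum of products over the box factors into one-dimensional sums, each equal to `1`.
    rw [← Finset.prod_univ_sum (fun i => Finset.Icc (⌊y i⌋ - 1) (⌊y i⌋ - 1 + (3 : ℕ)))
      (fun i m => bumpOne (z i - m))]
    refine Finset.prod_eq_one fun i _ => sum_bumpOne _ 3 ?_ ?_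
    · push_cast; linarith [(hz i).1]
    · push_cast; linarith [(hz i).2]

open Classical in
/-- The sum of the lattice bumps centred at the points of `G`. -/
def latticeSum (G : Set (Fin n → ℤ)) (y : EuclideanSpace ℝ (Fin n)) : ℝ :=
  ∑ᶠ m, if m ∈ G then latticeBump (y - latticePoint m) else 0

open Classical in
theorem eventually_latticeSum_eq (G : Set (Fin n → ℤ)) (y : EuclideanSpace ℝ (Fin n)) :
    ∀ᶠ z in 𝓝 y, latticeSum G z =
      ∑ m ∈ latticeBox y, if m ∈ G then latticeBump (z - latticePoint m) else 0 := by
  filter_upwards [eventually_latticeBox y] with z hz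
  refine finsum_eq_sum_of_support_subset _ fun m hm => ?_
  by_contra hc
  exact hm (by simp [hz.1 m hc])

theorem contDiff_translate_latticeBump (m : Fin n → ℤ) :
    ContDiff ℝ ∞ fun z => latticeBump (z - latticePoint m) :=
  contDiff_latticeBump.comp (contDiff_id.sub contDiff_const)

open Classical in
theorem contDiff_ite_latticeBump (G : Set (Fin n → ℤ)) (m : Fin n → ℤ) :
    ContDiff ℝ ∞ fun z => if m ∈ G then latticeBump (z - latticePoint m) else 0 := by
  by_cases h : m ∈ G
  · simpa only [if_pos h] using contDiff_translate_latticeBump m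
  · simpa only [if_neg h] using contDiff_const

theorem contDiff_latticeSum (G : Set (Fin n → ℤ)) : ContDiff ℝ ∞ (latticeSum G) := by
  classical
  rw [contDiff_iff_contDiffAt]
  intro y
  refine ContDiffAt.congr_of_eventuallyEq ?_ (eventually_latticeSum_eq G y)
  exact (ContDiff.sum fun m _ => contDiff_ite_latticeBump G m).contDiffAt

theorem norm_iteratedFDeriv_latticeSum_le {l : ℕ} {c : ℝ}
    (hc : ∀ x : EuclideanSpace ℝ (Fin n), ‖iteratedFDeriv ℝ l latticeBump x‖ ≤ c)
    (G : Set (Fin n → ℤ)) (y : EuclideanSpace ℝ (Fin n)) :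
    ‖iteratedFDeriv ℝ l (latticeSum G) y‖ ≤ 4 ^ n * c := by
  classical
  rw [(Filter.EventuallyEq.iteratedFDeriv ℝ (eventually_latticeSum_eq G y) l).eq_of_nhds,
    iteratedFDeriv_fun_sum_apply
    fun m _ => ((contDiff_ite_latticeBump G m).of_le (by exact_mod_cast le_top)).contDiffAt]
  refine (norm_sum_le _ _).trans ?_
  have : (4 : ℝ) ^ n * c = ∑ m ∈ latticeBox y, c := by
    rw [Finset.sum_const, card_latticeBox]; simp
  rw [this]
  refine Finset.sum_le_sum fun m _ => ?_
  by_cases h : m ∈ G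
  · simp only [if_pos h]
    rw [iteratedFDeriv_comp_sub]
    exact hc _
  · simp only [if_neg h]
    rw [show (fun _ : EuclideanSpace ℝ (Fin n) => (0 : ℝ)) = 0 from rfl, iteratedFDeriv_zero]
    simpa using (norm_nonneg _).trans (hc 0)

theorem latticeSum_eq_one {G : Set (Fin n → ℤ)} {y : EuclideanSpace ℝ (Fin n)}
    (h : ∀ m, ‖y - latticePoint m‖ < n + 1 → m ∈ G) : latticeSum G y = 1 := by
  classical
  rw [(eventually_latticeSum_eq G y).self_of_nhds, ← (eventually_latticeBox y).self_of_nhds.2]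
  refine Finset.sum_congr rfl fun m _ => ?_
  by_cases hm : latticeBump (y - latticePoint m) = 0
  · simp [hm]
  · rw [if_pos (h m (norm_lt_of_latticeBump_ne_zero hm))]

theorem latticeSum_eq_zero {G : Set (Fin n → ℤ)} {y : EuclideanSpace ℝ (Fin n)}
    (h : ∀ m, ‖y - latticePoint m‖ < n + 1 → m ∉ G) : latticeSum G y = 0 := by
  classical
  rw [(eventually_latticeSum_eq G y).self_of_nhds]
  refine Finset.sum_eq_zero fun m _ => ?_
  by_cases hm : latticeBump (y - latticePoint m) = 0
  · simp [hm]
  · rw [if_neg (h m (norm_lt_of_latticeBump_ne_zero hm))]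

/-- Bounds, uniform in the data, for the derivatives of the building blocks of the Whitney
partition of unity, at unit scale. -/
theorem exists_norm_iteratedFDeriv_block_le (n l : ℕ) :
    ∃ K : ℝ, 0 ≤ K ∧ ∀ (G G' : Set (Fin n → ℤ)) (m : Fin n → ℤ) (y : EuclideanSpace ℝ (Fin n)),
      ‖iteratedFDeriv ℝ l (fun z => (latticeSum G z - latticeSum G' ((1 / 2 : ℝ) • z)) *
        latticeBump (z - latticePoint m)) y‖ ≤ K := by
  choose c hc using exists_norm_iteratedFDeriv_latticeBump_le n
  have hc0 : ∀ l, 0 ≤ c l := fun l => (norm_nonneg _).trans (hc l 0)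
  refine ⟨∑ i ∈ Finset.range (l + 1), (l.choose i : ℝ) * (2 * (4 ^ n * c i)) * c (l - i),
    Finset.sum_nonneg fun i _ => by have := hc0 i; have := hc0 (l - i); positivity,
    fun G G' m y => ?_⟩
  have hhalf : ContDiff ℝ ∞ fun z => latticeSum G' ((1 / 2 : ℝ) • z) :=
    (contDiff_latticeSum G').comp (contDiff_const_smul _)
  refine (norm_iteratedFDeriv_mul_le ((contDiff_latticeSum G).sub hhalf)
    (contDiff_translate_latticeBump m) y (by exact_mod_cast le_top)).trans ?_
  refine Finset.sum_le_sum fun i _ => ?_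
  have h1 : ‖iteratedFDeriv ℝ i (fun z => latticeSum G z - latticeSum G' ((1 / 2 : ℝ) • z)) y‖ ≤
      2 * (4 ^ n * c i) := by
    rw [show (fun z => latticeSum G z - latticeSum G' ((1 / 2 : ℝ) • z)) =
      latticeSum G - fun z => latticeSum G' ((1 / 2 : ℝ) • z) from rfl, iteratedFDeriv_sub_apply
      ((contDiff_latticeSum G).of_le (by exact_mod_cast le_top)).contDiffAt
      (hhalf.of_le (by exact_mod_cast le_top)).contDiffAt]
    have h2 := norm_iteratedFDeriv_latticeSum_le (hc i) G y
    have h3 := norm_iteratedFDeriv_latticeSum_le (hc i) G' ((1 / 2 : ℝ) • y)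
    rw [iteratedFDeriv_comp_const_smul (1 / 2 : ℝ)
      ((contDiff_latticeSum G').of_le (by exact_mod_cast le_top))]
    refine (norm_sub_le _ _).trans ?_
    simp only [norm_smul]
    have h4 : ‖(1 / 2 : ℝ) ^ i‖ ≤ 1 := by
      rw [norm_pow]; exact pow_le_one₀ (norm_nonneg _) (by norm_num)
    have h5 := mul_le_mul h4 h3 (norm_nonneg _) zero_le_one
    linarith
  have h2 : ‖iteratedFDeriv ℝ (l - i) (fun z => latticeBump (z - latticePoint m)) y‖ ≤
      c (l - i) := by
    rw [iteratedFDeriv_comp_sub]; exact hc _ _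
  have := hc0 i
  gcongr

end Lattice

/-! ### Construction of the Whitney partition of unity. -/

section WhitneyPartition

open scoped ContDiff

variable {n : ℕ}

/-- A smooth partition of unity on the complement of `closure D`, subordinate to balls whose radii
are comparable to the distance to `D`, with the usual bounds on derivatives. -/
structure WhitneyPartition (D : Set (EuclideanSpace ℝ (Fin n))) where
  /-- The index type. -/
  ι : Type
  /-- The members of the partition of unity. -/
  fn : ι → EuclideanSpace ℝ (Fin n) → ℝ
  /-- Points of `D` close to the supports. -/
  pt : ι → EuclideanSpace ℝ (Fin n)
  /-- A bound for the number of overlapping supports. -/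
  bound : ℕ
  /-- The constants in the bounds on derivatives. -/
  const : ℕ → ℝ
  pt_mem : ∀ i, pt i ∈ D
  contDiff : ∀ i, ContDiff ℝ ∞ (fn i)
  const_nonneg : ∀ l, 0 ≤ const l
  locally_finite : ∀ x ∉ closure D, ∃ S : Finset ι, S.card ≤ bound ∧
    (∀ᶠ z in 𝓝 x, (∀ i ∉ S, fn i z = 0) ∧ ∑ i ∈ S, fn i z = 1) ∧
    ∀ i ∈ S, dist x (pt i) ≤ 15 * Metric.infDist x D ∧
      ∀ l, ‖iteratedFDeriv ℝ l (fn i) x‖ ≤ const l / Metric.infDist x D ^ l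

/-- The lattice points of scale `2 ^ (-j)` that are far from `D` relative to the scale. -/
def farLattice (D : Set (EuclideanSpace ℝ (Fin n))) (j : ℤ) : Set (Fin n → ℤ) :=
  {m | 2 * (n + 1) * ((2 : ℝ) ^ j)⁻¹ ≤ Metric.infDist (((2 : ℝ) ^ j)⁻¹ • latticePoint m) D}

/-- A function that is `1` far from `D` and `0` near `D`, relative to the scale `2 ^ (-j)`. -/
def farCutoff (D : Set (EuclideanSpace ℝ (Fin n))) (j : ℤ) (x : EuclideanSpace ℝ (Fin n)) : ℝ :=
  latticeSum (farLattice D j) ((2 : ℝ) ^ j • x)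

theorem norm_smul_sub_lt_iff {r : ℝ} (hr : 0 < r) {x y : EuclideanSpace ℝ (Fin n)} {c : ℝ} :
    ‖r • x - y‖ < c ↔ dist x (r⁻¹ • y) < c * r⁻¹ := by
  have : r • x - y = r • (x - r⁻¹ • y) := by rw [smul_sub, smul_inv_smul₀ hr.ne']
  rw [this, norm_smul, Real.norm_of_nonneg hr.le, dist_eq_norm, ← div_eq_mul_inv, lt_div_iff₀ hr,
    mul_comm]

/-- A bump at scale `2 ^ (-j)` that is nonzero at `x` is centred within `(n + 1) * 2 ^ (-j)` of `x`.
The threshold `2 * (n + 1)` in `farLattice` therefore gives the constant `3 * (n + 1)` here and `n +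
1` in `farCutoff_eq_zero`. -/
theorem farCutoff_eq_one {D : Set (EuclideanSpace ℝ (Fin n))} {j : ℤ}
    {x : EuclideanSpace ℝ (Fin n)} (hx : 3 * (n + 1) * ((2 : ℝ) ^ j)⁻¹ ≤ Metric.infDist x D) :
    farCutoff D j x = 1 := by
  refine latticeSum_eq_one fun m hm => ?_
  rw [norm_smul_sub_lt_iff (by positivity)] at hm
  have := Metric.infDist_le_infDist_add_dist (s := D) (x := x)
    (y := ((2 : ℝ) ^ j)⁻¹ • latticePoint m)
  simp only [farLattice, mem_ofPred_eq]
  linarith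

theorem farCutoff_eq_zero {D : Set (EuclideanSpace ℝ (Fin n))} {j : ℤ}
    {x : EuclideanSpace ℝ (Fin n)} (hx : Metric.infDist x D ≤ (n + 1) * ((2 : ℝ) ^ j)⁻¹) :
    farCutoff D j x = 0 := by
  refine latticeSum_eq_zero fun m hm => ?_
  rw [norm_smul_sub_lt_iff (by positivity)] at hm
  have := Metric.infDist_le_infDist_add_dist (s := D) (y := x)
    (x := ((2 : ℝ) ^ j)⁻¹ • latticePoint m)
  rw [dist_comm] at this
  simp only [farLattice, mem_ofPred_eq, not_le]
  linarith

/-- The members of the Whitney partition of unity. -/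
def whitneyFn (D : Set (EuclideanSpace ℝ (Fin n))) (i : ℤ × (Fin n → ℤ))
    (x : EuclideanSpace ℝ (Fin n)) : ℝ :=
  (farCutoff D i.1 x - farCutoff D (i.1 - 1) x) *
    latticeBump ((2 : ℝ) ^ i.1 • x - latticePoint i.2)

theorem contDiff_farCutoff (D : Set (EuclideanSpace ℝ (Fin n))) (j : ℤ) :
    ContDiff ℝ ∞ (farCutoff D j) :=
  (contDiff_latticeSum _).comp (contDiff_const_smul _)

theorem contDiff_whitneyFn (D : Set (EuclideanSpace ℝ (Fin n))) (i : ℤ × (Fin n → ℤ)) :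
    ContDiff ℝ ∞ (whitneyFn D i) :=
  ((contDiff_farCutoff D _).sub (contDiff_farCutoff D _)).mul
    ((contDiff_translate_latticeBump _).comp (contDiff_const_smul _))

/-- By scaling: after dilation by `2 ^ i.1` this is the unit-scale block, the coarser cutoff
appearing with halved argument. Each derivative costs one factor `2 ^ i.1`. -/
theorem exists_norm_iteratedFDeriv_whitneyFn_le (n l : ℕ) :
    ∃ K : ℝ, 0 ≤ K ∧ ∀ (D : Set (EuclideanSpace ℝ (Fin n))) (i : ℤ × (Fin n → ℤ))
      (x : EuclideanSpace ℝ (Fin n)),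
      ‖iteratedFDeriv ℝ l (whitneyFn D i) x‖ ≤ ((2 : ℝ) ^ i.1) ^ l * K := by
  obtain ⟨K, hK, h⟩ := exists_norm_iteratedFDeriv_block_le n l
  refine ⟨K, hK, fun D i x => ?_⟩
  set H : EuclideanSpace ℝ (Fin n) → ℝ := fun z =>
    (latticeSum (farLattice D i.1) z - latticeSum (farLattice D (i.1 - 1)) ((1 / 2 : ℝ) • z)) *
        latticeBump (z - latticePoint i.2) with hH
  have e : whitneyFn D i = fun x => H ((2 : ℝ) ^ i.1 • x) := by
    funext x
    simp only [whitneyFn, hH, farCutoff, smul_smul]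
    rw [zpow_sub_one₀ two_ne_zero, mul_comm ((2 : ℝ) ^ i.1), one_div]
  have hHc : ContDiff ℝ l H := by
    have h1 : ContDiff ℝ ∞ H := ((contDiff_latticeSum _).sub ((contDiff_latticeSum _).comp
      (contDiff_const_smul _))).mul (contDiff_translate_latticeBump _)
    exact h1.of_le (by exact_mod_cast le_top)
  rw [e, iteratedFDeriv_comp_const_smul _ hHc, norm_smul, norm_pow,
    Real.norm_of_nonneg (by positivity)]
  exact mul_le_mul_of_nonneg_left (h _ _ _ _) (by positivity)

/-- The distance to `D` need not be attained, so nodes are chosen with a slack comparable to the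
cell size. -/
theorem exists_mem_dist_lt {D : Set (EuclideanSpace ℝ (Fin n))} (hD : D.Nonempty)
    (i : ℤ × (Fin n → ℤ)) : ∃ p ∈ D, dist (((2 : ℝ) ^ i.1)⁻¹ • latticePoint i.2) p <
      Metric.infDist (((2 : ℝ) ^ i.1)⁻¹ • latticePoint i.2) D + ((2 : ℝ) ^ i.1)⁻¹ :=
  (Metric.infDist_lt_iff hD).1 (lt_add_of_pos_right _ (by positivity))

theorem sum_farCutoff_sub (D : Set (EuclideanSpace ℝ (Fin n))) (j : ℤ)
    (x : EuclideanSpace ℝ (Fin n)) :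
    ∑ i ∈ Finset.Icc j (j + 3), (farCutoff D i x - farCutoff D (i - 1) x) =
      farCutoff D (j + 3) x - farCutoff D (j - 1) x := by
  have : Finset.Icc j (j + 3) = {j, j + 1, j + 2, j + 3} := by
    ext i; simp only [Finset.mem_Icc, Finset.mem_insert, Finset.mem_singleton]; omega
  rw [this, Finset.sum_insert (by simp), Finset.sum_insert (by simp),
    Finset.sum_insert (by simp), Finset.sum_singleton,
    show j + 1 - 1 = j by ring, show j + 2 - 1 = j + 1 by ring, show j + 3 - 1 = j + 2 by ring]
  ring

/-- At distance about `δ` from `D` only four consecutive scales contribute: the cutoff is `1` at all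
finer scales and `0` at all coarser ones, so the differences of cutoffs telescope to `1`. At each of
the four scales the lattice bumps sum to `1`. -/
theorem whitneyFn_locally_finite {D : Set (EuclideanSpace ℝ (Fin n))} (hD : D.Nonempty)
    {x : EuclideanSpace ℝ (Fin n)} (hx : x ∉ closure D) :
    ∃ S : Finset (ℤ × (Fin n → ℤ)), S.card ≤ 4 * 4 ^ n ∧
    (∀ᶠ z in 𝓝 x, (∀ i ∉ S, whitneyFn D i z = 0) ∧ ∑ i ∈ S, whitneyFn D i z = 1) ∧
    ∀ i ∈ S, (2 : ℝ) ^ i.1 ≤ 8 * (n + 1) / Metric.infDist x D ∧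
      (n + 1) * ((2 : ℝ) ^ i.1)⁻¹ ≤ 2 * Metric.infDist x D ∧
      ‖(2 : ℝ) ^ i.1 • x - latticePoint i.2‖ ≤ 3 * (n + 1) := by
  have hδ : 0 < Metric.infDist x D := by
    rw [← Metric.infDist_closure]
    exact (isClosed_closure.notMem_iff_infDist_pos hD.closure).1 hx
  set δ := Metric.infDist x D with hδd
  -- The base scale satisfies `2 ^ j ≤ (n + 1) / δ < 2 ^ (j + 1)`. Cutoffs of index at least `j + 3`
  -- are then `1` where the distance exceeds `3 / 4 * δ`, and those of index at most `j - 1` vanish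
  -- where it is below `2 * δ`.
  obtain ⟨j, hj1, hj2⟩ := exists_mem_Ico_zpow (x := (n + 1) / δ) (y := (2 : ℝ)) (by positivity)
    one_lt_two
  rw [le_div_iff₀ hδ] at hj1
  rw [div_lt_iff₀ hδ, zpow_add_one₀ two_ne_zero] at hj2
  have hpos : ∀ i : ℤ, (0 : ℝ) < 2 ^ i := fun i => by positivity
  have hinv : ∀ {i : ℤ} {a b : ℝ}, a ≤ b * 2 ^ i → a * ((2 : ℝ) ^ i)⁻¹ ≤ b := fun {i a b} h => by
    rw [← div_eq_mul_inv, div_le_iff₀ (hpos i)]; exact h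
  have hinv' : ∀ {i : ℤ} {a b : ℝ}, b * 2 ^ i ≤ a → b ≤ a * ((2 : ℝ) ^ i)⁻¹ := fun {i a b} h => by
    rw [← div_eq_mul_inv, le_div_iff₀ (hpos i)]; exact h
  have hup : ∀ i : ℤ, j + 3 ≤ i → 4 * (n + 1) < δ * 2 ^ i := fun i hi => by
    have h1 : (2 : ℝ) ^ (j + 3) ≤ 2 ^ i := zpow_le_zpow_right₀ one_le_two hi
    have h2 : (2 : ℝ) ^ (j + 3) = 2 ^ j * 8 := by rw [zpow_add₀ two_ne_zero]; norm_num
    nlinarith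
  have hlow : ∀ i : ℤ, i ≤ j - 1 → 2 * δ * 2 ^ i ≤ n + 1 := fun i hi => by
    have h1 : (2 : ℝ) ^ i ≤ 2 ^ (j - 1) := zpow_le_zpow_right₀ one_le_two hi
    have h2 : (2 : ℝ) ^ (j - 1) = 2 ^ j / 2 := by rw [zpow_sub_one₀ two_ne_zero]; rfl
    nlinarith
  have hcont : ContinuousAt (fun z => Metric.infDist z D) x :=
    (Metric.continuous_infDist_pt D).continuousAt
  have hN : ∀ᶠ z in 𝓝 x, 3 / 4 * δ < Metric.infDist z D ∧ Metric.infDist z D < 2 * δ :=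
    hcont.eventually (Ioo_mem_nhds (by linarith) (by linarith))
  have hB : ∀ᶠ z in 𝓝 x, ∀ i ∈ Finset.Icc j (j + 3),
      (∀ m ∉ latticeBox ((2 : ℝ) ^ i • x), latticeBump ((2 : ℝ) ^ i • z - latticePoint m) = 0) ∧
      ∑ m ∈ latticeBox ((2 : ℝ) ^ i • x), latticeBump ((2 : ℝ) ^ i • z - latticePoint m) = 1 := by
    rw [Finset.eventually_all]
    intro i _
    have hc : Continuous fun z : EuclideanSpace ℝ (Fin n) => (2 : ℝ) ^ i • z := by fun_prop
    exact hc.continuousAt.eventually (eventually_latticeBox _)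
  have hone : ∀ z, 3 / 4 * δ < Metric.infDist z D → ∀ i : ℤ, j + 3 ≤ i → farCutoff D i z = 1 :=
    fun z hz i hi => farCutoff_eq_one ((hinv (b := 3 / 4 * δ) (by linarith [hup i hi])).trans hz.le)
  have hzero : ∀ z, Metric.infDist z D < 2 * δ → ∀ i : ℤ, i ≤ j - 1 → farCutoff D i z = 0 :=
    fun z hz i hi => farCutoff_eq_zero (hz.le.trans (hinv' (hlow i hi)))
  let S : Finset (Σ _ : ℤ, (Fin n → ℤ)) :=
    (Finset.Icc j (j + 3)).sigma fun i => latticeBox ((2 : ℝ) ^ i • x)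
  let e : (Σ _ : ℤ, (Fin n → ℤ)) ≃ ℤ × (Fin n → ℤ) := Equiv.sigmaEquivProd _ _
  have hmem : ∀ i, i ∈ S.map e.toEmbedding ↔
      i.1 ∈ Finset.Icc j (j + 3) ∧ i.2 ∈ latticeBox ((2 : ℝ) ^ i.1 • x) := by
    intro i
    rw [Finset.mem_map_equiv, Finset.mem_sigma]
    rfl
  refine ⟨S.map e.toEmbedding, ?_, ?_, ?_⟩
  · rw [Finset.card_map, Finset.card_sigma, Finset.sum_congr rfl fun i _ => card_latticeBox _,
      Finset.sum_const, Int.card_Icc, smul_eq_mul, show (j + 3 + 1 - j).toNat = 4 by omega]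
  · filter_upwards [hN, hB] with z hz hzB
    constructor
    · intro i hi
      rw [hmem, not_and_or] at hi
      by_cases hi1 : i.1 ∈ Finset.Icc j (j + 3)
      · have := hi.resolve_left (not_not_intro hi1)
        rw [whitneyFn, (hzB i.1 hi1).1 _ this, mul_zero]
      · rw [Finset.mem_Icc, not_and_or, not_le, not_le] at hi1
        rcases hi1 with h | h
        · rw [whitneyFn, hzero z hz.2 _ (by omega), hzero z hz.2 _ (by omega), sub_zero, zero_mul]
        · rw [whitneyFn, hone z hz.1 _ (by omega), hone z hz.1 _ (by omega), sub_self, zero_mul]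
    · rw [Finset.sum_map, Finset.sum_sigma]
      have : ∀ i ∈ Finset.Icc j (j + 3), ∑ m ∈ latticeBox ((2 : ℝ) ^ i • x),
          whitneyFn D (e.toEmbedding ⟨i, m⟩) z = farCutoff D i z - farCutoff D (i - 1) z := by
        intro i hi
        change ∑ m ∈ latticeBox ((2 : ℝ) ^ i • x), (farCutoff D i z - farCutoff D (i - 1) z) *
          latticeBump ((2 : ℝ) ^ i • z - latticePoint m) = _
        rw [← Finset.mul_sum, (hzB i hi).2, mul_one]
      rw [Finset.sum_congr rfl this, sum_farCutoff_sub, hone z hz.1 _ le_rfl,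
        hzero z hz.2 _ le_rfl, sub_zero]
  · intro i hi
    rw [hmem, Finset.mem_Icc] at hi
    refine ⟨?_, ?_, norm_sub_latticePoint_le hi.2⟩
    · rw [le_div_iff₀ hδ]
      have h1 : (2 : ℝ) ^ i.1 ≤ 2 ^ (j + 3) := zpow_le_zpow_right₀ one_le_two hi.1.2
      have h2 : (2 : ℝ) ^ (j + 3) = 2 ^ j * 8 := by rw [zpow_add₀ two_ne_zero]; norm_num
      nlinarith
    · refine hinv ?_
      have h1 : (2 : ℝ) ^ j ≤ 2 ^ i.1 := zpow_le_zpow_right₀ one_le_two hi.1.1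
      nlinarith

/-- Existence of Whitney partitions of unity. -/
theorem exists_whitneyPartition {D : Set (EuclideanSpace ℝ (Fin n))} (hD : D.Nonempty) :
    Nonempty (WhitneyPartition D) := by
  choose p hpD hp using exists_mem_dist_lt hD
  choose K hK0 hK using exists_norm_iteratedFDeriv_whitneyFn_le n
  refine ⟨{ ι := ℤ × (Fin n → ℤ), fn := whitneyFn D, pt := p, bound := 4 * 4 ^ n,
            const := fun l => (8 * (n + 1)) ^ l * K l, pt_mem := hpD,
            contDiff := contDiff_whitneyFn D,
            const_nonneg := fun l => by have := hK0 l; positivity,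
            locally_finite := fun x hx => ?_ }⟩
  obtain ⟨S, hS1, hS2, hS3⟩ := whitneyFn_locally_finite hD hx
  refine ⟨S, hS1, hS2, fun i hi => ?_⟩
  obtain ⟨h1, h2, h3⟩ := hS3 i hi
  constructor
  · have hr : (0 : ℝ) < 2 ^ i.1 := by positivity
    -- With `δ` the distance of `x` to `D`: the lattice point is within `6δ` of `x`, hence within
    -- `7δ` of `D`; the slack adds at most `2δ`. Altogether `6 + 7 + 2 = 15`.
    have h4 : dist x (((2 : ℝ) ^ i.1)⁻¹ • latticePoint i.2) ≤ 6 * Metric.infDist x D := by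
      have h5 : (2 : ℝ) ^ i.1 • x - latticePoint i.2 =
          (2 : ℝ) ^ i.1 • (x - ((2 : ℝ) ^ i.1)⁻¹ • latticePoint i.2) := by
        rw [smul_sub, smul_inv_smul₀ hr.ne']
      rw [h5, norm_smul, Real.norm_of_nonneg hr.le, ← dist_eq_norm] at h3
      have h6 := mul_le_mul_of_nonneg_left h3 (inv_pos.2 hr).le
      rw [← mul_assoc, inv_mul_cancel₀ hr.ne', one_mul] at h6
      linarith
    have h7 := Metric.infDist_le_infDist_add_dist (s := D) (y := x)
      (x := ((2 : ℝ) ^ i.1)⁻¹ • latticePoint i.2)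
    rw [dist_comm] at h7
    have h8 := hp i
    have h9 := dist_triangle x (((2 : ℝ) ^ i.1)⁻¹ • latticePoint i.2) (p i)
    have h10 : ((2 : ℝ) ^ i.1)⁻¹ ≤ (n + 1) * ((2 : ℝ) ^ i.1)⁻¹ :=
      le_mul_of_one_le_left (inv_pos.2 hr).le (by linarith [Nat.cast_nonneg (α := ℝ) n])
    linarith
  · intro l
    refine (hK l D i x).trans ?_
    have : (8 * (n + 1 : ℝ)) ^ l * K l / Metric.infDist x D ^ l =
        (8 * (n + 1) / Metric.infDist x D) ^ l * K l := by rw [div_pow]; ring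
    rw [this]
    exact mul_le_mul_of_nonneg_right (pow_le_pow_left₀ (by positivity) h1 l) (hK0 l)

end WhitneyPartition

/-! ### The Whitney estimate for real-valued functions. -/

section WhitneyEstimate

open scoped ContDiff

variable {n : ℕ} {D : Set (EuclideanSpace ℝ (Fin n))}

/-- The Whitney extension, off the closure of `D`, of a real-valued function on `D`. -/
def whitneyExt (P : WhitneyPartition D) (k : ℕ) (u : EuclideanSpace ℝ (Fin n) → ℝ)
    (x : EuclideanSpace ℝ (Fin n)) : ℝ :=
  ∑ᶠ i, P.fn i x * taylorPoly k u (P.pt i) x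

theorem infDist_pos_of_notMem_closure (hD : D.Nonempty) {x : EuclideanSpace ℝ (Fin n)}
    (hx : x ∉ closure D) : 0 < Metric.infDist x D := by
  rw [← Metric.infDist_closure]
  exact (isClosed_closure.notMem_iff_infDist_pos hD.closure).1 hx

/-- In the Leibniz rule, `m` derivatives on `P.fn i` cost `δ ^ m`, while the `m` fewer derivatives
on `Q i` gain exactly `δ ^ m`. The constant does not depend on the functions `Q`, the point or `δ`.
-/
theorem WhitneyPartition.exists_norm_iteratedFDeriv_sum_le (P : WhitneyPartition D) (k : ℕ) :
    ∃ K : ℝ, 0 ≤ K ∧ ∀ (Q : P.ι → EuclideanSpace ℝ (Fin n) → ℝ) (_ : ∀ i, ContDiff ℝ ∞ (Q i))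
      (S : Finset P.ι) (_ : S.card ≤ P.bound) (x : EuclideanSpace ℝ (Fin n)) (δ B : ℝ) (_ : 0 < δ)
      (_ : 0 ≤ B)
      (_ : ∀ i ∈ S, ∀ l, ‖iteratedFDeriv ℝ l (P.fn i) x‖ ≤ P.const l / δ ^ l)
      (_ : ∀ i ∈ S, ∀ l ≤ k, ‖iteratedFDeriv ℝ l (Q i) x‖ ≤ B * δ ^ (k - l)) (l : ℕ) (_ : l ≤ k),
      ‖iteratedFDeriv ℝ l (fun z => ∑ i ∈ S, P.fn i z * Q i z) x‖ ≤ K * B * δ ^ (k - l) := by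
  set K : ℕ → ℝ := fun l => ∑ m ∈ Finset.range (l + 1), (l.choose m : ℝ) * P.const m with hK
  have hK0 : ∀ l, 0 ≤ K l := fun l => Finset.sum_nonneg fun m _ =>
    mul_nonneg (Nat.cast_nonneg _) (P.const_nonneg m)
  refine ⟨P.bound * ∑ l ∈ Finset.range (k + 1), K l,
    mul_nonneg (Nat.cast_nonneg _) (Finset.sum_nonneg fun l _ => hK0 l),
    fun Q hQ S hS x δ B hδ hB hP hQB l hl => ?_⟩
  have h1 : ∀ i ∈ S, ‖iteratedFDeriv ℝ l (fun z => P.fn i z * Q i z) x‖ ≤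
      K l * B * δ ^ (k - l) := by
    intro i hi
    refine (norm_iteratedFDeriv_mul_le (P.contDiff i) (hQ i) x
      (by exact_mod_cast le_top)).trans ?_
    rw [hK, Finset.sum_mul, Finset.sum_mul]
    refine Finset.sum_le_sum fun m hm => ?_
    have hml : m ≤ l := Nat.lt_succ_iff.1 (Finset.mem_range.1 hm)
    have h2 := hP i hi m
    have h3 := hQB i hi (l - m) (by omega)
    rw [show k - (l - m) = (k - l) + m by omega] at h3
    have h4 : P.const m / δ ^ m * (B * δ ^ (k - l + m)) = P.const m * B * δ ^ (k - l) := by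
      rw [pow_add]; field_simp
    have h5 := mul_le_mul h2 h3 (norm_nonneg _) (by have := P.const_nonneg m; positivity)
    rw [h4] at h5
    calc _ = (l.choose m : ℝ) * (‖iteratedFDeriv ℝ m (P.fn i) x‖ *
          ‖iteratedFDeriv ℝ (l - m) (Q i) x‖) := by ring
      _ ≤ (l.choose m : ℝ) * (P.const m * B * δ ^ (k - l)) := by gcongr
      _ = _ := by ring
  rw [iteratedFDeriv_fun_sum_apply fun i _ => (((P.contDiff i).mul (hQ i)).of_le
    (by exact_mod_cast le_top)).contDiffAt]
  refine (norm_sum_le_of_le S h1).trans ?_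
  rw [Finset.sum_const, nsmul_eq_mul]
  have h6 : K l ≤ ∑ l ∈ Finset.range (k + 1), K l :=
    Finset.single_le_sum (fun l _ => hK0 l) (Finset.mem_range.2 (by omega))
  have h7 : (S.card : ℝ) ≤ P.bound := by exact_mod_cast hS
  have h8 : 0 ≤ B * δ ^ (k - l) := by positivity
  have h9 := mul_le_mul h7 h6 (hK0 l) (Nat.cast_nonneg _)
  calc _ = (S.card : ℝ) * K l * (B * δ ^ (k - l)) := by ring
    _ ≤ _ := mul_le_mul_of_nonneg_right h9 h8
    _ = _ := by ring

theorem WhitneyPartition.eventually_whitneyExt_eq (P : WhitneyPartition D) {k : ℕ}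
    {x : EuclideanSpace ℝ (Fin n)} {S : Finset P.ι}
    (hS : ∀ᶠ z in 𝓝 x, (∀ i ∉ S, P.fn i z = 0) ∧ ∑ i ∈ S, P.fn i z = 1)
    (u : EuclideanSpace ℝ (Fin n) → ℝ) :
    ∀ᶠ z in 𝓝 x, whitneyExt P k u z = ∑ i ∈ S, P.fn i z * taylorPoly k u (P.pt i) z := by
  filter_upwards [hS] with z hz
  refine finsum_eq_sum_of_support_subset _ fun i hi => ?_
  by_contra hc
  exact hi (by simp [hz.1 i hc])

/-- **Whitney's estimate**: the Whitney extension has the expected jets at the points of `D`. -/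
theorem WhitneyPartition.exists_norm_iteratedFDeriv_whitneyExt_sub_le (P : WhitneyPartition D)
    (hD : IsOpen D) (k : ℕ) :
    ∃ K : ℝ, 0 ≤ K ∧ ∀ (u : EuclideanSpace ℝ (Fin n) → ℝ) (_ : ContDiffOn ℝ k u D)
      (a : EuclideanSpace ℝ (Fin n)) (_ : a ∈ closure D) (r η : ℝ)
      (_ : Convex ℝ (D ∩ Metric.ball a r))
      (_ : ∀ x ∈ D ∩ Metric.ball a r, ∀ y ∈ D ∩ Metric.ball a r,
        ‖iteratedFDeriv ℝ k u x - iteratedFDeriv ℝ k u y‖ ≤ η)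
      (x : EuclideanSpace ℝ (Fin n)) (_ : x ∉ closure D) (_ : x ∈ Metric.ball a (r / 16))
      (b : EuclideanSpace ℝ (Fin n)) (_ : b ∈ D ∩ Metric.ball a r) (l : ℕ) (_ : l ≤ k),
      ‖iteratedFDeriv ℝ l (whitneyExt P k u) x - iteratedFDeriv ℝ l (taylorPoly k u b) x‖ ≤
        K * η * ‖x - b‖ ^ (k - l) := by
  obtain ⟨K, hK0, hK⟩ := P.exists_norm_iteratedFDeriv_sum_le k
  refine ⟨K * (2 ^ k * 2 ^ k * 30 ^ k) + 2 ^ k * 2 ^ k * 16 ^ k, by positivity,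
    fun u hu a ha r η hC hη x hx hxa b hb l hl => ?_⟩
  set C := D ∩ Metric.ball a r
  have hCD : C ⊆ D := inter_subset_left
  have hDne : D.Nonempty := ⟨b, hb.1⟩
  have hδ := infDist_pos_of_notMem_closure hDne hx
  set δ := Metric.infDist x D with hδd
  have hη0 : 0 ≤ η := (norm_nonneg _).trans (hη b hb b hb)
  obtain ⟨S, hS1, hS2, hS3⟩ := P.locally_finite x hx
  have hδa : δ ≤ dist x a := by
    rw [hδd, ← Metric.infDist_closure]; exact Metric.infDist_le_dist_of_mem ha
  have hδb : δ ≤ ‖x - b‖ := by rw [← dist_eq_norm]; exact Metric.infDist_le_dist_of_mem hb.1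
  -- The radius `r / 16` leaves room for this: a node is at distance at most `15 * δ + dist x a ≤ 16
  -- * dist x a < r` from `a`.
  have hpC : ∀ i ∈ S, P.pt i ∈ C := by
    intro i hi
    refine ⟨P.pt_mem i, ?_⟩
    rw [Metric.mem_ball] at hxa ⊢
    have h1 := dist_triangle (P.pt i) x a
    rw [dist_comm (P.pt i) x] at h1
    linarith [(hS3 i hi).1]
  have hSne : S.Nonempty := by
    rw [Finset.nonempty_iff_ne_empty]
    rintro rfl
    simpa using hS2.self_of_nhds.2
  obtain ⟨i₀, hi₀⟩ := hSne
  set b' := P.pt i₀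
  have hb' : b' ∈ C := hpC i₀ hi₀
  have hxb' : ‖x - b'‖ ≤ 15 * δ := by rw [← dist_eq_norm]; exact (hS3 i₀ hi₀).1
  have hQc : ∀ i, ContDiff ℝ ∞ (taylorPoly k u (P.pt i) - taylorPoly k u b') := fun i =>
    (contDiff_taylorPoly _ _ _).sub (contDiff_taylorPoly _ _ _)
  -- Since the partition sums to `1` near `x`, a single reference polynomial splits off, and only
  -- differences of Taylor polynomials at nearby nodes are multiplied by the members of the
  -- partition.
  have hdiff : whitneyExt P k u =ᶠ[𝓝 x] taylorPoly k u b' +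
      fun z => ∑ i ∈ S, P.fn i z * (taylorPoly k u (P.pt i) - taylorPoly k u b') z := by
    filter_upwards [P.eventually_whitneyExt_eq hS2 u, hS2] with z hz hz2
    rw [hz]
    simp only [Pi.add_apply, Pi.sub_apply, mul_sub, Finset.sum_sub_distrib]
    rw [← Finset.sum_mul, hz2.2]
    ring
  have hWb' : ‖iteratedFDeriv ℝ l (whitneyExt P k u) x - iteratedFDeriv ℝ l (taylorPoly k u b') x‖ ≤
      K * (2 ^ k * (2 ^ k * η) * 30 ^ k) * δ ^ (k - l) := by
    rw [(Filter.EventuallyEq.iteratedFDeriv ℝ hdiff l).eq_of_nhds, iteratedFDeriv_add_apply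
      (contDiff_taylorPoly k u b').contDiffAt
      (ContDiff.sum fun i _ => ((P.contDiff i).mul (hQc i)).of_le
        (by exact_mod_cast le_top)).contDiffAt, add_sub_cancel_left]
    refine hK _ hQc S hS1 x δ _ hδ (by positivity) (fun i hi => (hS3 i hi).2)
      (fun i hi m hm => ?_) l hl
    have hxi : ‖x - P.pt i‖ ≤ 15 * δ := by rw [← dist_eq_norm]; exact (hS3 i hi).1
    have hpb : ‖P.pt i - b'‖ ≤ 30 * δ := by
      have := norm_sub_le_norm_sub_add_norm_sub (P.pt i) x b'
      rw [norm_sub_rev (P.pt i) x] at this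
      linarith
    refine (norm_iteratedFDeriv_taylorPoly_sub_le hD hC hCD hu hη hm (hpC i hi) hb' hpb
      (by linarith)).trans ?_
    rw [mul_pow, ← mul_assoc]
    have : (30 : ℝ) ^ (k - m) ≤ 30 ^ k := pow_le_pow_right₀ (by norm_num) (by omega)
    gcongr
  -- The reference node is replaced by the given `b`; because `δ ≤ ‖x - b‖`, all distances involved
  -- are at most `16 * ‖x - b‖`.
  have hbb : ‖iteratedFDeriv ℝ l (taylorPoly k u b') x - iteratedFDeriv ℝ l (taylorPoly k u b) x‖ ≤
      2 ^ k * (2 ^ k * η) * (16 * ‖x - b‖) ^ (k - l) := by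
    rw [← iteratedFDeriv_sub_apply (contDiff_taylorPoly k u b').contDiffAt
      (contDiff_taylorPoly k u b).contDiffAt]
    refine norm_iteratedFDeriv_taylorPoly_sub_le hD hC hCD hu hη hl hb' hb ?_ (by linarith)
    have := norm_sub_le_norm_sub_add_norm_sub b' x b
    rw [norm_sub_rev b' x] at this
    linarith
  refine (norm_sub_le_norm_sub_add_norm_sub _ (iteratedFDeriv ℝ l (taylorPoly k u b') x) _).trans
    ((add_le_add hWb' hbb).trans ?_)
  rw [mul_pow, add_mul, add_mul]
  refine add_le_add ?_ ?_
  · calc _ ≤ K * (2 ^ k * (2 ^ k * η) * 30 ^ k) * ‖x - b‖ ^ (k - l) := by gcongr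
      _ = _ := by ring
  · calc _ ≤ 2 ^ k * (2 ^ k * η) * (16 ^ k * ‖x - b‖ ^ (k - l)) := by
          gcongr
          · norm_num
          · omega
      _ = _ := by ring

end WhitneyEstimate

/-! ### Seminorms as suprema of functionals. -/

section LocallyConvex

variable {E : Type*} [AddCommGroup E] [Module ℝ E] [TopologicalSpace E]
  [IsTopologicalAddGroup E] [ContinuousSMul ℝ E] [LocallyConvexSpace ℝ E]

/-- Hahn–Banach, starting from the functional `c • v ↦ c * q v` on the line through `v`. -/
theorem exists_dual_eq_seminorm {q : Seminorm ℝ E} (hq : Continuous q) (v : E) :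
    ∃ φ : E →L[ℝ] ℝ, φ v = q v ∧ ∀ w, |φ w| ≤ q w := by
  by_cases hv : v = 0
  · exact ⟨0, by simp [hv], fun w => by simp⟩
  · obtain ⟨φ, h1, h2⟩ := Module.Dual.exists_continuous_extension_of_le_seminorm_real
      (ℝ ∙ v) (q v • ((LinearEquiv.coord ℝ E v hv : (ℝ ∙ v) ≃ₗ[ℝ] ℝ) : (ℝ ∙ v) →ₗ[ℝ] ℝ)) hq (fun x => by
        obtain ⟨c, hc⟩ := Submodule.mem_span_singleton.1 x.2
        have hx : x = c • (⟨v, Submodule.mem_span_singleton_self v⟩ : ℝ ∙ v) :=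
          Subtype.ext hc.symm
        have h1 : (LinearEquiv.coord ℝ E v hv) x = c := by
          rw [hx, map_smul, LinearEquiv.coord_self, smul_eq_mul, mul_one]
        rw [LinearMap.smul_apply, LinearEquiv.coe_coe, h1, ← hc, map_smul_eq_mul, smul_eq_mul,
          mul_comm]
        exact mul_le_mul_of_nonneg_right (le_abs_self c) (apply_nonneg q v))
    refine ⟨φ, ?_, h2⟩
    have := h1 ⟨v, Submodule.mem_span_singleton_self v⟩
    rw [this, LinearMap.smul_apply, LinearEquiv.coe_coe, LinearEquiv.coord_self, smul_eq_mul,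
      mul_one]

theorem tendsto_nhds_iff_seminorm {α : Type*} {u : α → E} {F : Filter α} {y : E} :
    Tendsto u F (𝓝 y) ↔ ∀ q : Seminorm ℝ E, Continuous q → ∀ ε > 0, ∀ᶠ x in F, q (u x - y) < ε := by
  rw [(PolynormableSpace.withSeminorms ℝ E).tendsto_nhds]
  exact ⟨fun h q hq => h ⟨q, hq⟩, fun h q => h q.1 q.2⟩

/-- The passage from scalar to vector-valued estimates: bounds uniform over the functionals
dominated by `q` are bounds in `q`. -/
theorem seminorm_le_of_forall_dual {q : Seminorm ℝ E} (hq : Continuous q) {v : E} {c : ℝ}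
    (h : ∀ φ : E →L[ℝ] ℝ, (∀ w, |φ w| ≤ q w) → |φ v| ≤ c) : q v ≤ c := by
  obtain ⟨φ, h1, h2⟩ := exists_dual_eq_seminorm hq v
  rw [← h1]
  exact (le_abs_self _).trans (h φ h2)

end LocallyConvex

/-! ### Multilinear maps in coordinate directions. -/

section Words

variable {n : ℕ} {E : Type*} [AddCommGroup E] [Module ℝ E] [TopologicalSpace E]

/-- The coordinate directions given by a word. -/
def dirWord {l : ℕ} (w : Fin l → Fin n) : Fin l → EuclideanSpace ℝ (Fin n) :=
  fun j => EuclideanSpace.single (w j) 1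

theorem sum_coord_smul_single (y : EuclideanSpace ℝ (Fin n)) :
    ∑ i, y i • EuclideanSpace.single i (1 : ℝ) = y := by
  ext j
  simp [Pi.single_apply]

theorem continuousMultilinearMap_eq_sum_words {l : ℕ} {F : Type*} [AddCommGroup F] [Module ℝ F]
    [TopologicalSpace F]
    (L : ContinuousMultilinearMap ℝ (fun _ : Fin l => EuclideanSpace ℝ (Fin n)) F)
    (y : Fin l → EuclideanSpace ℝ (Fin n)) :
    L y = ∑ w : Fin l → Fin n, (∏ j, y j (w j)) • L (dirWord w) := by
  have h : y = fun j => ∑ i, y j i • EuclideanSpace.single i (1 : ℝ) :=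
    funext fun j => (sum_coord_smul_single (y j)).symm
  conv_lhs => rw [h]
  rw [L.map_sum]
  exact Finset.sum_congr rfl fun w _ => L.map_smul_univ _ _

/-- The seminorms on `C^k` see only coordinate derivatives; this turns control of those into control
of operator norms. -/
theorem norm_le_sum_words {l : ℕ}
    (L : ContinuousMultilinearMap ℝ (fun _ : Fin l => EuclideanSpace ℝ (Fin n)) ℝ) :
    ‖L‖ ≤ ∑ w : Fin l → Fin n, |L (dirWord w)| := by
  refine L.opNorm_le_bound (Finset.sum_nonneg fun w _ => abs_nonneg _) fun y => ?_
  rw [continuousMultilinearMap_eq_sum_words L y, Finset.sum_mul]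
  refine norm_sum_le_of_le _ fun w _ => ?_
  rw [norm_smul, mul_comm, Real.norm_eq_abs]
  refine mul_le_mul_of_nonneg_left ?_ (abs_nonneg _)
  rw [norm_prod]
  exact Finset.prod_le_prod (fun _ _ => norm_nonneg _) fun j _ => PiLp.norm_apply_le (y j) (w j)

theorem norm_dirWord {l : ℕ} (w : Fin l → Fin n) (j : Fin l) : ‖dirWord w j‖ = 1 := by
  simp [dirWord]

end Words

/-! ### Composition with functionals; multilinearity and symmetry of the differentials. -/

section Scalarize

variable {n : ℕ} {E : Type*} [AddCommGroup E] [Module ℝ E] [TopologicalSpace E]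
  {A : Set (EuclideanSpace ℝ (Fin n))}

/-- The composition of a function on `A` with a functional, extended by zero. -/
def scalarExt (φ : E →L[ℝ] ℝ) (f : A → E) : EuclideanSpace ℝ (Fin n) → ℝ :=
  Function.extend Subtype.val (fun a => φ (f a)) 0

theorem scalarExt_coe (φ : E →L[ℝ] ℝ) (f : A → E) (a : A) : scalarExt φ f a = φ (f a) :=
  Subtype.val_injective.extend_apply _ _ _

theorem scalarExt_eq (φ : E →L[ℝ] ℝ) (f : A → E) (x : EuclideanSpace ℝ (Fin n)) :
    scalarExt φ f x = φ (Function.extend Subtype.val f 0 x) := by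
  by_cases hx : ∃ a : A, (a : EuclideanSpace ℝ (Fin n)) = x
  · obtain ⟨a, rfl⟩ := hx
    rw [scalarExt_coe, Subtype.val_injective.extend_apply]
  · rw [scalarExt, Function.extend_apply' _ _ _ hx, Function.extend_apply' _ _ _ hx]
    simp

variable {k : ℕ} {f : A → E} {d : ∀ l : ℕ, A → (Fin l → EuclideanSpace ℝ (Fin n)) → E}

theorem IsDifferentialFamily.continuous_left (h : IsDifferentialFamily k f d) {l : ℕ} (hl : l ≤ k)
    (y : Fin l → EuclideanSpace ℝ (Fin n)) : Continuous fun x => d l x y :=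
  (h.continuous l hl).comp (continuous_id.prodMk continuous_const)

/-- A continuous functional commutes with limits of difference quotients, so `φ ∘ d` is a family of
iterated directional derivatives of a real function on the interior, where finite-dimensional
calculus applies. The reversal of arguments disappears by symmetry. -/
theorem IsDifferentialFamily.scalarize (h : IsDifferentialFamily k f d) (φ : E →L[ℝ] ℝ) :
    ContDiffOn ℝ k (scalarExt φ f) (interior A) ∧
      ∀ l ≤ k, ∀ x : A, (x : EuclideanSpace ℝ (Fin n)) ∈ interior A → ∀ y,
        φ (d l x y) = iteratedFDeriv ℝ l (scalarExt φ f) x y := by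
  have H := contDiffOn_of_lineDeriv_family (isOpen_interior (s := A)) k (scalarExt φ f)
    (fun l x y => scalarExt φ (fun a => d l a y) x) (fun x hx y => ?_) (fun l hl x hx y => ?_)
    (fun l hl y => ?_)
  · obtain ⟨h1, h2⟩ := H
    refine ⟨h1, fun l hl x hx y => ?_⟩
    have hs : ∀ v : Fin l → EuclideanSpace ℝ (Fin n), iteratedFDeriv ℝ l (scalarExt φ f) x
        (v ∘ Fin.revPerm) = iteratedFDeriv ℝ l (scalarExt φ f) x v := fun v =>
      iteratedFDeriv_comp_perm_real ((h1.contDiffAt (isOpen_interior.mem_nhds hx)).of_le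
        (by exact_mod_cast hl)) v Fin.revPerm
    have h4 := h2 l hl x hx y
    rw [scalarExt_coe] at h4
    exact h4.trans (hs y)
  · obtain ⟨a, rfl⟩ : ∃ a : A, (a : EuclideanSpace ℝ (Fin n)) = x := ⟨⟨x, interior_subset hx⟩, rfl⟩
    rw [scalarExt_coe, scalarExt_coe, h.zero]
  · obtain ⟨a, rfl⟩ : ∃ a : A, (a : EuclideanSpace ℝ (Fin n)) = x := ⟨⟨x, interior_subset hx⟩, rfl⟩
    rw [HasLineDerivAt, hasDerivAt_iff_tendsto_slope_zero, scalarExt_coe]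
    have h3 := (φ.continuous.tendsto _).comp (h.succ l hl a hx y)
    refine h3.congr fun t => ?_
    simp only [Function.comp_apply, zero_add, zero_smul, add_zero, map_smul, map_sub]
    rw [scalarExt_coe, scalarExt_eq]
  · rw [continuousOn_iff_continuous_domRestrict]
    have h3 : Continuous fun x : interior A => φ (d l (inclusion interior_subset x) y) :=
      φ.continuous.comp ((h.continuous_left hl y).comp (continuous_inclusion _))
    refine h3.congr fun x => ?_
    exact (scalarExt_coe φ (fun a => d l a y) (inclusion interior_subset x)).symm

theorem dense_coe_interior [hA : IsLocallyConvexDenseInterior A] :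
    Dense {x : A | (x : EuclideanSpace ℝ (Fin n)) ∈ interior A} := by
  rw [Subtype.dense_iff]
  intro z hz
  refine closure_mono ?_ (hA.subset_closure_interior hz)
  intro w hw
  exact ⟨⟨w, interior_subset hw⟩, hw, rfl⟩

variable [IsTopologicalAddGroup E] [ContinuousSMul ℝ E] [LocallyConvexSpace ℝ E] [T2Space E]
  [IsLocallyConvexDenseInterior A]

/-- The differentials are multilinear. -/
theorem IsDifferentialFamily.eq_sum_words (h : IsDifferentialFamily k f d) {l : ℕ} (hl : l ≤ k)
    (x : A) (y : Fin l → EuclideanSpace ℝ (Fin n)) :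
    d l x y = ∑ w : Fin l → Fin n, (∏ j, y j (w j)) • d l x (dirWord w) := by
  -- By density it suffices to argue at interior points, where functionals separate the points of
  -- `E` and reduce the identity to iterated Fréchet derivatives.
  refine congrFun (Continuous.ext_on dense_coe_interior (h.continuous_left hl y)
    (continuous_finsetSum _ fun w _ => (h.continuous_left hl _).const_smul _) ?_) x
  intro z hz
  refine (SeparatingDual.eq_iff_forall_dual_eq (R := ℝ)).2 fun φ => ?_
  have h1 := (h.scalarize φ).2 l hl z hz
  rw [map_sum, h1, continuousMultilinearMap_eq_sum_words]
  exact Finset.sum_congr rfl fun w _ => by rw [Pi.smul_apply, map_smul, h1]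

/-- The differentials are symmetric. -/
theorem IsDifferentialFamily.comp_perm (h : IsDifferentialFamily k f d) {l : ℕ} (hl : l ≤ k)
    (x : A) (y : Fin l → EuclideanSpace ℝ (Fin n)) (σ : Equiv.Perm (Fin l)) :
    d l x (y ∘ σ) = d l x y := by
  refine congrFun (Continuous.ext_on dense_coe_interior (h.continuous_left hl (y ∘ σ))
    (h.continuous_left hl y) ?_) x
  intro z hz
  refine (SeparatingDual.eq_iff_forall_dual_eq (R := ℝ)).2 fun φ => ?_
  obtain ⟨h0, h1⟩ := h.scalarize φ
  rw [h1 l hl z hz, h1 l hl z hz]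
  exact iteratedFDeriv_comp_perm_real ((h0.contDiffAt (isOpen_interior.mem_nhds hz)).of_le
        (by exact_mod_cast hl)) y σ

/-- Each letter has fibres of equal size under `v` and `w`; bijections between the fibres glue to a
permutation. -/
theorem exists_perm_of_perm_ofFn {α : Type*} {l : ℕ} {v w : Fin l → α}
    (h : (List.ofFn v).Perm (List.ofFn w)) : ∃ σ : Equiv.Perm (Fin l), v = w ∘ σ := by
  classical
  have hcard : ∀ a, Nonempty ({j // v j = a} ≃ {j // w j = a}) := by
    intro a
    rw [← Fintype.card_eq, Fintype.card_subtype, Fintype.card_subtype]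
    have h1 := congrArg (Multiset.count a) (Multiset.coe_eq_coe.2 h)
    rw [← Fin.univ_val_map, ← Fin.univ_val_map, Multiset.count_map, Multiset.count_map] at h1
    simp only [eq_comm (b := a)]
    exact h1
  let e := fun a => (hcard a).some
  exact ⟨Equiv.ofFiberEquiv e, funext fun j => (Equiv.ofFiberEquiv_map e j).symm⟩

theorem count_multiIndexWord (α : Fin n → ℕ) (i : Fin n) : (multiIndexWord α).count i = α i := by
  rw [multiIndexWord, List.count_flatMap, List.map_reverse, List.sum_reverse, ← Fin.sum_univ_def]
  simp [List.count_replicate]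

/-- By symmetry a word may be sorted, so the derivatives along arbitrary coordinate words are among
the `∂^α` that define the topology. -/
theorem IsDifferentialFamily.dirWord_eq (h : IsDifferentialFamily k f d) {l : ℕ} (hl : l ≤ k)
    (x : A) (w : Fin l → Fin n) : ∃ α : Fin n → ℕ, ∑ i, α i = l ∧
      d l x (dirWord w) = d (multiIndexWord α).length x
        fun i => EuclideanSpace.single ((multiIndexWord α).get i) (1 : ℝ) := by
  classical
  have key : ∀ L : List (Fin n), L.length = l → (List.ofFn w).Perm L → d l x (dirWord w) =
      d L.length x fun i => EuclideanSpace.single (L.get i) (1 : ℝ) := by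
    rintro L rfl hL
    obtain ⟨σ, hσ⟩ := exists_perm_of_perm_ofFn (v := w) (w := L.get) (by rwa [List.ofFn_get])
    subst hσ
    exact h.comp_perm hl x (dirWord L.get) σ
  have hperm : (List.ofFn w).Perm (multiIndexWord fun i => (List.ofFn w).count i) := by
    rw [List.perm_iff_count]
    intro i
    rw [count_multiIndexWord]
  have hlen := hperm.length_eq
  rw [List.length_ofFn] at hlen
  exact ⟨_, by rw [← length_multiIndexWord, ← hlen], key _ hlen.symm hperm⟩

end Scalarize

/-! ### Locally finite sums of vectors with smooth scalar weights. -/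

section SmoothSum

open scoped ContDiff

variable {n : ℕ} {E : Type*} [AddCommGroup E] [Module ℝ E] [TopologicalSpace E] {κ : Type*}

/-- The `m`-th derivative of the function `∑ᶠ c, g c • v c`, for smooth real-valued functions `g c`
and vectors `v c`, computed term by term. -/
def sumDeriv (g : κ → EuclideanSpace ℝ (Fin n) → ℝ) (v : κ → E) (m : ℕ)
    (x : EuclideanSpace ℝ (Fin n)) (y : Fin m → EuclideanSpace ℝ (Fin n)) : E :=
  ∑ᶠ c, iteratedFDeriv ℝ m (g c) x y • v c

variable {g : κ → EuclideanSpace ℝ (Fin n) → ℝ} {S : Finset κ} {x : EuclideanSpace ℝ (Fin n)}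

theorem iteratedFDeriv_eq_zero_of_eventually {h : EuclideanSpace ℝ (Fin n) → ℝ}
    (hh : ∀ᶠ z in 𝓝 x, h z = 0) (m : ℕ) : iteratedFDeriv ℝ m h x = 0 := by
  have h1 : h =ᶠ[𝓝 x] fun _ => 0 := hh
  rw [(Filter.EventuallyEq.iteratedFDeriv ℝ h1 m).eq_of_nhds]
  exact congrFun iteratedFDeriv_zero x

theorem support_sumDeriv_subset (hS : ∀ᶠ z in 𝓝 x, ∀ c ∉ S, g c z = 0) (v : κ → E) (m : ℕ)
    (y : Fin m → EuclideanSpace ℝ (Fin n)) :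
    (Function.support fun c => iteratedFDeriv ℝ m (g c) x y • v c) ⊆ S := by
  intro c hc
  by_contra hcS
  refine hc ?_
  simp only
  rw [iteratedFDeriv_eq_zero_of_eventually (hS.mono fun z hz => hz c hcS), zero_apply, zero_smul]

theorem sumDeriv_eq (hS : ∀ᶠ z in 𝓝 x, ∀ c ∉ S, g c z = 0) (v : κ → E) (m : ℕ)
    (y : Fin m → EuclideanSpace ℝ (Fin n)) :
    sumDeriv g v m x y = ∑ c ∈ S, iteratedFDeriv ℝ m (g c) x y • v c :=
  finsum_eq_sum_of_support_subset _ (support_sumDeriv_subset hS v m y)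

theorem eventually_sumDeriv_eq (hS : ∀ᶠ z in 𝓝 x, ∀ c ∉ S, g c z = 0) (v : κ → E) (m : ℕ)
    (y : Fin m → EuclideanSpace ℝ (Fin n)) :
    ∀ᶠ z in 𝓝 x, sumDeriv g v m z y = ∑ c ∈ S, iteratedFDeriv ℝ m (g c) z y • v c := by
  filter_upwards [eventually_eventually_nhds.2 hS] with z hz
  exact sumDeriv_eq hz v m y

theorem continuous_iteratedFDeriv_apply {h : EuclideanSpace ℝ (Fin n) → ℝ} (hh : ContDiff ℝ ∞ h)
    (m : ℕ) (y : Fin m → EuclideanSpace ℝ (Fin n)) :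
    Continuous fun z => iteratedFDeriv ℝ m h z y :=
  (ContinuousMultilinearMap.apply ℝ (fun _ : Fin m => EuclideanSpace ℝ (Fin n)) ℝ y).continuous.comp
    (hh.continuous_iteratedFDeriv (by exact_mod_cast le_top))

theorem hasLineDerivAt_iteratedFDeriv {h : EuclideanSpace ℝ (Fin n) → ℝ} (hh : ContDiff ℝ ∞ h)
    (m : ℕ) (y : Fin m → EuclideanSpace ℝ (Fin n)) (x z : EuclideanSpace ℝ (Fin n)) :
    HasLineDerivAt ℝ (fun x => iteratedFDeriv ℝ m h x y)
      (iteratedFDeriv ℝ (m + 1) h x (Fin.cons z y : Fin (m + 1) → EuclideanSpace ℝ (Fin n))) x z := by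
  have hd : DifferentiableAt ℝ (iteratedFDeriv ℝ m h) x :=
    hh.contDiffAt.differentiableAt_iteratedFDeriv (by exact_mod_cast WithTop.coe_lt_top _)
  have h1 := ((ContinuousMultilinearMap.apply ℝ (fun _ : Fin m => EuclideanSpace ℝ (Fin n)) ℝ
    y).hasFDerivAt (x := iteratedFDeriv ℝ m h x)).comp x hd.hasFDerivAt
  have h2 := h1.hasLineDerivAt z
  rw [iteratedFDeriv_succ_apply_left, Fin.cons_zero, Fin.tail_cons]
  exact h2

variable [IsTopologicalAddGroup E] [ContinuousSMul ℝ E]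

theorem continuousAt_sumDeriv (hg : ∀ c, ContDiff ℝ ∞ (g c))
    (hS : ∀ᶠ z in 𝓝 x, ∀ c ∉ S, g c z = 0) (v : κ → E) (m : ℕ)
    (y : Fin m → EuclideanSpace ℝ (Fin n)) : ContinuousAt (fun z => sumDeriv g v m z y) x := by
  have h1 : Continuous fun z => ∑ c ∈ S, iteratedFDeriv ℝ m (g c) z y • v c :=
    continuous_finsetSum _ fun c _ => (continuous_iteratedFDeriv_apply (hg c) m y).smul
      continuous_const
  exact h1.continuousAt.congr (EventuallyEq.symm (eventually_sumDeriv_eq hS v m y))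

theorem tendsto_sumDeriv_slope (hg : ∀ c, ContDiff ℝ ∞ (g c))
    (hS : ∀ᶠ z in 𝓝 x, ∀ c ∉ S, g c z = 0) (v : κ → E) (m : ℕ)
    (y : Fin m → EuclideanSpace ℝ (Fin n)) (z : EuclideanSpace ℝ (Fin n)) :
    Tendsto (fun t : ℝ => t⁻¹ • (sumDeriv g v m (x + t • z) y - sumDeriv g v m x y)) (𝓝[≠] 0)
      (𝓝 (sumDeriv g v (m + 1) x (Fin.cons z y : Fin (m + 1) → EuclideanSpace ℝ (Fin n)))) := by
  rw [sumDeriv_eq hS v (m + 1)]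
  have h1 : Tendsto (fun t : ℝ => ∑ c ∈ S, (t⁻¹ • (iteratedFDeriv ℝ m (g c) (x + t • z) y -
      iteratedFDeriv ℝ m (g c) x y)) • v c) (𝓝[≠] 0) (𝓝 (∑ c ∈ S, iteratedFDeriv ℝ (m + 1) (g c) x
        (Fin.cons z y : Fin (m + 1) → EuclideanSpace ℝ (Fin n)) • v c)) := by
    refine tendsto_finsetSum _ fun c _ => Tendsto.smul_const ?_ _
    have h2 := hasLineDerivAt_iteratedFDeriv (hg c) m y x z
    rw [HasLineDerivAt, hasDerivAt_iff_tendsto_slope_zero] at h2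
    simpa only [zero_add, zero_smul, add_zero] using h2
  refine h1.congr' ?_
  have hlim : Tendsto (fun t : ℝ => x + t • z) (𝓝[≠] 0) (𝓝 x) := by
    have hcont : Continuous fun t : ℝ => x + t • z := by fun_prop
    simpa using (hcont.tendsto 0).mono_left nhdsWithin_le_nhds
  filter_upwards [hlim.eventually (eventually_sumDeriv_eq hS v m y)] with t ht
  rw [ht, sumDeriv_eq hS v m y, ← Finset.sum_sub_distrib, Finset.smul_sum]
  refine Finset.sum_congr rfl fun c _ => ?_
  rw [← sub_smul, smul_smul, smul_eq_mul]

theorem sumDeriv_eq_sum_words (hS : ∀ᶠ z in 𝓝 x, ∀ c ∉ S, g c z = 0) (v : κ → E) (m : ℕ)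
    (y : Fin m → EuclideanSpace ℝ (Fin n)) (σ : Equiv.Perm (Fin m)) :
    sumDeriv g v m x (y ∘ σ) =
      ∑ w : Fin m → Fin n, (∏ j, y j (w j)) • sumDeriv g v m x (dirWord w ∘ σ) := by
  simp only [sumDeriv_eq hS]
  have : ∀ c, iteratedFDeriv ℝ m (g c) x (y ∘ σ) = ∑ w : Fin m → Fin n,
      (∏ j, y j (w j)) * iteratedFDeriv ℝ m (g c) x (dirWord w ∘ σ) := fun c =>
    continuousMultilinearMap_eq_sum_words
      ((iteratedFDeriv ℝ m (g c) x).domDomCongr σ) y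
  simp only [this, Finset.sum_smul, Finset.smul_sum, mul_smul]
  exact Finset.sum_comm

/-- Termwise derivatives with values in `E` become true iterated derivatives of a real function
after applying a functional, so the scalar estimates can be used. -/
theorem dual_sumDeriv (hg : ∀ c, ContDiff ℝ ∞ (g c)) (hS : ∀ᶠ z in 𝓝 x, ∀ c ∉ S, g c z = 0)
    (v : κ → E) (m : ℕ) (y : Fin m → EuclideanSpace ℝ (Fin n)) (φ : E →L[ℝ] ℝ) :
    φ (sumDeriv g v m x y) = iteratedFDeriv ℝ m (fun z => ∑ c ∈ S, g c z * φ (v c)) x y := by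
  have hg' : ∀ c, ContDiff ℝ m (g c) := fun c => (hg c).of_le (by exact_mod_cast le_top)
  rw [sumDeriv_eq hS, map_sum, iteratedFDeriv_fun_sum_apply fun c _ =>
    ((hg' c).mul contDiff_const).contDiffAt, sum_apply]
  refine Finset.sum_congr rfl fun c _ => ?_
  have : (fun z => g c z * φ (v c)) = fun z => φ (v c) • g c z := by
    funext z; rw [smul_eq_mul, mul_comm]
  rw [map_smul, this, iteratedFDeriv_const_smul_apply' (hg' c).contDiffAt, smul_apply,
    smul_eq_mul, smul_eq_mul, mul_comm]

end SmoothSum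

/-! ### The extended differentials and their estimates. -/

section ExtFamily

open scoped ContDiff

variable {n : ℕ} {E : Type*} [AddCommGroup E] [Module ℝ E] [TopologicalSpace E]
  {A : Set (EuclideanSpace ℝ (Fin n))} {k : ℕ} {f : A → E}
  {d : ∀ l : ℕ, A → (Fin l → EuclideanSpace ℝ (Fin n)) → E}

theorem taylorPoly_eq_sum_words (k : ℕ) (u : EuclideanSpace ℝ (Fin n) → ℝ)
    (p x : EuclideanSpace ℝ (Fin n)) :
    taylorPoly k u p x = ∑ c : Σ l : Fin (k + 1), (Fin l → Fin n),
      ((Nat.factorial c.1 : ℝ)⁻¹ * ∏ j, (x - p) (c.2 j)) * iteratedFDeriv ℝ c.1 u p (dirWord c.2) := by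
  rw [taylorPoly, Finset.sum_range, Fintype.sum_sigma]
  refine Finset.sum_congr rfl fun l _ => ?_
  rw [continuousMultilinearMap_eq_sum_words, Finset.mul_sum]
  exact Finset.sum_congr rfl fun w _ => by rw [smul_eq_mul, mul_assoc]

/-- The weights of the Taylor coefficients in the Whitney extension. -/
def taylorWeight (P : WhitneyPartition (interior A)) (k : ℕ)
    (c : P.ι × Σ l : Fin (k + 1), (Fin l → Fin n)) (x : EuclideanSpace ℝ (Fin n)) : ℝ :=
  P.fn c.1 x * ((Nat.factorial c.2.1 : ℝ)⁻¹ * ∏ j, (x - P.pt c.1) (c.2.2 j))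

/-- The Taylor coefficients at the points of the partition. -/
def taylorCoeff (P : WhitneyPartition (interior A))
    (d : ∀ l : ℕ, A → (Fin l → EuclideanSpace ℝ (Fin n)) → E)
    (c : P.ι × Σ l : Fin (k + 1), (Fin l → Fin n)) : E :=
  d c.2.1 ⟨P.pt c.1, interior_subset (P.pt_mem c.1)⟩ (dirWord c.2.2)

theorem contDiff_taylorWeight (P : WhitneyPartition (interior A)) (k : ℕ)
    (c : P.ι × Σ l : Fin (k + 1), (Fin l → Fin n)) : ContDiff ℝ ∞ (taylorWeight P k c) := by
  refine (P.contDiff c.1).mul (contDiff_const.mul (contDiff_prod fun j _ => ?_))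
  exact (EuclideanSpace.proj (𝕜 := ℝ) (c.2.2 j)).contDiff.comp (contDiff_id.sub contDiff_const)

theorem eventually_taylorWeight_eq_zero {P : WhitneyPartition (interior A)}
    {x : EuclideanSpace ℝ (Fin n)} {S : Finset P.ι}
    (hS : ∀ᶠ z in 𝓝 x, (∀ i ∉ S, P.fn i z = 0) ∧ ∑ i ∈ S, P.fn i z = 1) :
    ∀ᶠ z in 𝓝 x, ∀ c ∉ S ×ˢ (Finset.univ : Finset (Σ l : Fin (k + 1), (Fin l → Fin n))),
      taylorWeight P k c z = 0 := by
  filter_upwards [hS] with z hz c hc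
  rw [taylorWeight, hz.1 c.1 fun h => hc (Finset.mem_product.2 ⟨h, Finset.mem_univ _⟩), zero_mul]

/-- The extended family of differentials. -/
def extFamily (P : WhitneyPartition (interior A)) (k : ℕ)
    (d : ∀ l : ℕ, A → (Fin l → EuclideanSpace ℝ (Fin n)) → E) (l : ℕ)
    (x : EuclideanSpace ℝ (Fin n)) (y : Fin l → EuclideanSpace ℝ (Fin n)) : E :=
  open scoped Classical in
  if hx : x ∈ A then d l ⟨x, hx⟩ y else sumDeriv (taylorWeight P k) (taylorCoeff P d) l x y

theorem extFamily_coe (P : WhitneyPartition (interior A)) (l : ℕ) (x : A)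
    (y : Fin l → EuclideanSpace ℝ (Fin n)) : extFamily P k d l x y = d l x y :=
  dif_pos x.2

theorem extFamily_of_notMem (P : WhitneyPartition (interior A)) (l : ℕ)
    {x : EuclideanSpace ℝ (Fin n)} (hx : x ∉ A) (y : Fin l → EuclideanSpace ℝ (Fin n)) :
    extFamily P k d l x y = sumDeriv (taylorWeight P k) (taylorCoeff P d) l x y :=
  dif_neg hx

variable [IsTopologicalAddGroup E] [ContinuousSMul ℝ E]

theorem sumDeriv_comp_perm {κ : Type*} {g : κ → EuclideanSpace ℝ (Fin n) → ℝ}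
    (hg : ∀ c, ContDiff ℝ ∞ (g c)) (v : κ → E) (m : ℕ) (x : EuclideanSpace ℝ (Fin n))
    (y : Fin m → EuclideanSpace ℝ (Fin n)) (σ : Equiv.Perm (Fin m)) :
    sumDeriv g v m x (y ∘ σ) = sumDeriv g v m x y := by
  have : ∀ c, iteratedFDeriv ℝ m (g c) x (y ∘ σ) = iteratedFDeriv ℝ m (g c) x y := fun c =>
    iteratedFDeriv_comp_perm_real ((hg c).of_le (by exact_mod_cast le_top)).contDiffAt y σ
  simp only [sumDeriv, this]

/-- Expanding Taylor polynomials in coordinate words shows that the vector-valued extension composed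
with `φ` is the scalar Whitney extension of `φ ∘ f`. -/
theorem IsDifferentialFamily.dual_sumDeriv_taylor (h : IsDifferentialFamily k f d)
    (P : WhitneyPartition (interior A)) {x : EuclideanSpace ℝ (Fin n)}
    (hx : x ∉ closure (interior A)) (φ : E →L[ℝ] ℝ) (l : ℕ)
    (y : Fin l → EuclideanSpace ℝ (Fin n)) :
    φ (sumDeriv (taylorWeight P k) (taylorCoeff P d) l x y) =
      iteratedFDeriv ℝ l (whitneyExt P k (scalarExt φ f)) x y := by
  obtain ⟨S, -, hS, -⟩ := P.locally_finite x hx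
  rw [dual_sumDeriv (contDiff_taylorWeight P k) (eventually_taylorWeight_eq_zero hS)]
  refine congrFun (congrArg DFunLike.coe ?_) y
  refine (Filter.EventuallyEq.iteratedFDeriv ℝ ?_ l).eq_of_nhds
  filter_upwards [P.eventually_whitneyExt_eq (k := k) hS (scalarExt φ f)] with z hz
  rw [hz, Finset.sum_product]
  refine Finset.sum_congr rfl fun i _ => ?_
  rw [taylorPoly_eq_sum_words, Finset.mul_sum]
  refine Finset.sum_congr rfl fun c _ => ?_
  rw [taylorWeight, taylorCoeff, (h.scalarize φ).2 c.1 (Nat.lt_succ_iff.1 c.1.2) _ (P.pt_mem i),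
    mul_assoc]

/-- In a small ball the interior of `A` coincides with the interior of a convex neighbourhood of `a`
in `A`, and interiors of convex sets are convex. -/
theorem exists_convex_interior_inter_ball [hA : IsLocallyConvexDenseInterior A]
    {a : EuclideanSpace ℝ (Fin n)} (ha : a ∈ A) :
    ∃ r > 0, ∀ r' ≤ r, Convex ℝ (interior A ∩ Metric.ball a r') := by
  obtain ⟨V, hVA, hV, hc⟩ := hA.exists_convex_nhds a ha
  obtain ⟨r, hr, hrV⟩ := Metric.mem_nhdsWithin_iff.1 hV
  refine ⟨r, hr, fun r' hr' => ?_⟩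
  have h1 : interior A ∩ Metric.ball a r' = interior V ∩ Metric.ball a r' := by
    refine Subset.antisymm (fun z hz => ⟨?_, hz.2⟩) (inter_subset_inter_left _ (interior_mono hVA))
    refine mem_interior.2 ⟨interior A ∩ Metric.ball a r', fun w hw =>
      hrV ⟨Metric.ball_subset_ball hr' hw.2, interior_subset hw.1⟩,
      isOpen_interior.inter Metric.isOpen_ball, hz⟩
  rw [h1]
  exact hc.interior.inter (convex_ball a r')

variable [LocallyConvexSpace ℝ E] [T2Space E] [IsLocallyConvexDenseInterior A]

/-- The local hypotheses under which the extended family is estimated near the point `a`. -/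
structure LocalBound (k : ℕ) (d : ∀ l : ℕ, A → (Fin l → EuclideanSpace ℝ (Fin n)) → E)
    (q : Seminorm ℝ E) (a : EuclideanSpace ℝ (Fin n)) (r η M : ℝ) : Prop where
  mem : a ∈ A
  convex : Convex ℝ (interior A ∩ Metric.ball a r)
  osc : ∀ x y : A, (x : EuclideanSpace ℝ (Fin n)) ∈ interior A ∩ Metric.ball a r →
    (y : EuclideanSpace ℝ (Fin n)) ∈ interior A ∩ Metric.ball a r →
    ∑ w : Fin k → Fin n, q (d k x (dirWord w) - d k y (dirWord w)) ≤ η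
  bound : ∀ l ≤ k, ∀ x : A, (x : EuclideanSpace ℝ (Fin n)) ∈ interior A ∩ Metric.ball a r →
    ∑ w : Fin l → Fin n, q (d l x (dirWord w)) ≤ M

/-- The constants `η` and `M` pass unchanged to every functional dominated by `q`; this uniformity
is what later allows the return to `q`. -/
theorem LocalBound.scalarize (h : IsDifferentialFamily k f d) {q : Seminorm ℝ E}
    {a : EuclideanSpace ℝ (Fin n)} {r η M : ℝ} (hB : LocalBound k d q a r η M) {φ : E →L[ℝ] ℝ}
    (hφ : ∀ w, |φ w| ≤ q w) :
    (∀ x ∈ interior A ∩ Metric.ball a r, ∀ y ∈ interior A ∩ Metric.ball a r,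
      ‖iteratedFDeriv ℝ k (scalarExt φ f) x - iteratedFDeriv ℝ k (scalarExt φ f) y‖ ≤ η) ∧
    ∀ x ∈ interior A ∩ Metric.ball a r, ∀ l ≤ k, ‖iteratedFDeriv ℝ l (scalarExt φ f) x‖ ≤ M := by
  obtain ⟨-, h1⟩ := h.scalarize φ
  constructor
  · intro x hx y hy
    refine (norm_le_sum_words _).trans (le_trans (Finset.sum_le_sum fun w _ => ?_)
      (hB.osc ⟨x, interior_subset hx.1⟩ ⟨y, interior_subset hy.1⟩ hx hy))
    refine le_trans (le_of_eq ?_) (hφ _)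
    rw [map_sub, h1 k le_rfl _ hx.1, h1 k le_rfl _ hy.1, sub_apply]
  · intro x hx l hl
    refine (norm_le_sum_words _).trans (le_trans (Finset.sum_le_sum fun w _ => ?_)
      (hB.bound l hl ⟨x, interior_subset hx.1⟩ hx))
    refine le_trans (le_of_eq ?_) (hφ _)
    rw [h1 l hl _ hx.1]

/-- The functionals of the extended family are close to the Taylor polynomials. -/
theorem exists_abs_dual_extFamily_sub_le (P : WhitneyPartition (interior A)) (k : ℕ) :
    ∃ K : ℝ, 0 ≤ K ∧ ∀ (f : A → E) (d : ∀ l : ℕ, A → (Fin l → EuclideanSpace ℝ (Fin n)) → E)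
      (_ : IsDifferentialFamily k f d) (q : Seminorm ℝ E) (a : EuclideanSpace ℝ (Fin n))
      (r η M : ℝ) (_ : LocalBound k d q a r η M) (x : EuclideanSpace ℝ (Fin n))
      (_ : x ∈ interior A ∨ x ∉ closure A) (_ : x ∈ Metric.ball a (r / 16))
      (b : EuclideanSpace ℝ (Fin n)) (_ : b ∈ interior A ∩ Metric.ball a r) (l : ℕ) (_ : l ≤ k)
      (y : Fin l → EuclideanSpace ℝ (Fin n)) (φ : E →L[ℝ] ℝ) (_ : ∀ w, |φ w| ≤ q w),
      |φ (extFamily P k d l x y) - iteratedFDeriv ℝ l (taylorPoly k (scalarExt φ f) b) x y| ≤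
        K * η * ‖x - b‖ ^ (k - l) * ∏ i, ‖y i‖ := by
  obtain ⟨K, hK0, hK⟩ := P.exists_norm_iteratedFDeriv_whitneyExt_sub_le isOpen_interior k
  refine ⟨K + 2 ^ k, by positivity,
    fun f d h q a r η M hB x hx hxa b hb l hl y φ hφ => ?_⟩
  obtain ⟨hu, h1⟩ := h.scalarize φ
  obtain ⟨hη, -⟩ := hB.scalarize h hφ
  have hη0 : 0 ≤ η := (norm_nonneg _).trans (hη b hb b hb)
  have hr : 0 < r / 16 := dist_nonneg.trans_lt hxa
  have hp : 0 ≤ η * ‖x - b‖ ^ (k - l) := by positivity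
  -- `T` is the `l`-th derivative at `x` of `φ ∘ f` if `x` is interior to `A`, and of its Whitney
  -- extension if `x` is off the closure. The bound is Taylor's theorem in the first case and
  -- Whitney's estimate in the second.
  obtain ⟨T, hT, hle⟩ : ∃ T : ContinuousMultilinearMap ℝ (fun _ : Fin l =>
      EuclideanSpace ℝ (Fin n)) ℝ, φ (extFamily P k d l x y) = T y ∧
      ‖T - iteratedFDeriv ℝ l (taylorPoly k (scalarExt φ f) b) x‖ ≤
        (K + 2 ^ k) * η * ‖x - b‖ ^ (k - l) := by
    rcases hx with hx | hx
    · have hxr : x ∈ interior A ∩ Metric.ball a r :=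
        ⟨hx, Metric.ball_subset_ball (by linarith) hxa⟩
      refine ⟨_, ?_, (norm_iteratedFDeriv_sub_taylorPoly_le isOpen_interior hB.convex
        inter_subset_left hu hη hl hxr hb).trans ?_⟩
      · rw [extFamily_coe P l ⟨x, interior_subset hx⟩ y, h1 l hl _ hx]
      · nlinarith [mul_nonneg hK0 hp]
    · have hx' : x ∉ closure (interior A) := fun hc => hx (closure_mono interior_subset hc)
      refine ⟨_, ?_, (hK _ hu a
        (IsLocallyConvexDenseInterior.subset_closure_interior hB.mem) r η hB.convex hη x hx' hxa b
        hb l hl).trans ?_⟩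
      · rw [extFamily_of_notMem P l (fun hc => hx (subset_closure hc)),
          h.dual_sumDeriv_taylor P hx']
      · nlinarith [mul_nonneg (pow_nonneg (zero_le_two (α := ℝ)) k) hp]
  rw [hT, ← sub_apply, ← Real.norm_eq_abs]
  exact (ContinuousMultilinearMap.le_opNorm _ _).trans
    (mul_le_mul_of_nonneg_right hle (Finset.prod_nonneg fun _ _ => norm_nonneg _))

/-- Density of the interior. This carries the estimates from interior points, where Taylor
polynomials are available, to boundary points of `A`. -/
theorem le_of_forall_interior {F G : A → ℝ} (hF : Continuous F) (hG : Continuous G)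
    {a : EuclideanSpace ℝ (Fin n)} {r : ℝ}
    (h : ∀ b : A, (b : EuclideanSpace ℝ (Fin n)) ∈ interior A ∩ Metric.ball a r → F b ≤ G b)
    (b : A) (hb : (b : EuclideanSpace ℝ (Fin n)) ∈ Metric.ball a r) : F b ≤ G b := by
  have hO : IsOpen {x : A | (x : EuclideanSpace ℝ (Fin n)) ∈ Metric.ball a r} :=
    Metric.isOpen_ball.preimage continuous_subtype_val
  have h1 := dense_coe_interior (A := A) |>.open_subset_closure_inter hO hb
  exact closure_minimal (fun x hx => h x ⟨hx.2, hx.1⟩) (isClosed_le hF hG) h1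

/-- Bounds for the extended family in terms of the differentials at the points of `A`. -/
theorem exists_extFamily_le (P : WhitneyPartition (interior A)) (k : ℕ) :
    ∃ K : ℝ, 0 ≤ K ∧ ∀ (f : A → E) (d : ∀ l : ℕ, A → (Fin l → EuclideanSpace ℝ (Fin n)) → E)
      (_ : IsDifferentialFamily k f d) (q : Seminorm ℝ E) (_ : Continuous q)
      (a : EuclideanSpace ℝ (Fin n)) (r η M : ℝ) (_ : LocalBound k d q a r η M) (_ : r ≤ 1 / 2)
      (x : EuclideanSpace ℝ (Fin n))
      (_ : x ∈ interior A ∨ x ∉ closure A) (_ : x ∈ Metric.ball a (r / 16))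
      (b : A) (_ : (b : EuclideanSpace ℝ (Fin n)) ∈ interior A ∩ Metric.ball a r) (l : ℕ)
      (_ : l ≤ k) (y : Fin l → EuclideanSpace ℝ (Fin n)),
      q (extFamily P k d l x y) ≤ (K * η + 2 ^ k * M) * ∏ i, ‖y i‖ ∧
      q (extFamily P k d l x y - d l b y) ≤
        (K * η * ‖x - b‖ ^ (k - l) + 2 ^ k * M * ‖x - b‖) * ∏ i, ‖y i‖ ∧
      (l < k → q (extFamily P k d l x y - d l b y -
          d (l + 1) b (Fin.cons (x - b) y : Fin (l + 1) → EuclideanSpace ℝ (Fin n))) ≤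
        (K * η * ‖x - b‖ ^ (k - l) + 2 ^ k * M * ‖x - b‖ * ‖x - b‖) * ∏ i, ‖y i‖) := by
  obtain ⟨K, hK0, hK⟩ := exists_abs_dual_extFamily_sub_le (E := E) P k
  refine ⟨K, hK0, fun f d h q hq a r η M hB hr x hx hxa b hb l hl y => ?_⟩
  have hxb : ‖x - b‖ ≤ 1 := by
    rw [← dist_eq_norm]
    have h1 := dist_triangle_right x b a
    have h2 := Metric.mem_ball.1 hxa
    have h3 := Metric.mem_ball.1 hb.2
    have h4 : 0 < r := dist_nonneg.trans_lt h3
    linarith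
  have hη0 : 0 ≤ η := le_trans (Finset.sum_nonneg fun _ _ => apply_nonneg q _) (hB.osc b b hb hb)
  have hy0 : 0 ≤ ∏ i, ‖y i‖ := Finset.prod_nonneg fun _ _ => norm_nonneg _
  have hcd : ∀ φ : E →L[ℝ] ℝ, ContDiffAt ℝ k (scalarExt φ f) b := fun φ =>
    (h.scalarize φ).1.contDiffAt (isOpen_interior.mem_nhds hb.1)
  have hd : ∀ φ : E →L[ℝ] ℝ, ∀ l ≤ k, ∀ y, φ (d l b y) =
      iteratedFDeriv ℝ l (scalarExt φ f) b y := fun φ l hl y => (h.scalarize φ).2 l hl b hb.1 y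
  have hM : ∀ φ : E →L[ℝ] ℝ, (∀ w, |φ w| ≤ q w) → ∀ l ≤ k,
      ‖iteratedFDeriv ℝ l (scalarExt φ f) b‖ ≤ M := fun φ hφ => (hB.scalarize h hφ).2 b hb
  -- All three bounds compare with the Taylor polynomial at `b`, whose own size, increment and
  -- first-order remainder at `b` are known on the unit ball.
  have key : ∀ φ : E →L[ℝ] ℝ, (∀ w, |φ w| ≤ q w) → |φ (extFamily P k d l x y) -
      iteratedFDeriv ℝ l (taylorPoly k (scalarExt φ f) b) x y| ≤
        K * η * ‖x - b‖ ^ (k - l) * ∏ i, ‖y i‖ :=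
    fun φ hφ => hK f d h q a r η M hB x hx hxa b hb l hl y φ hφ
  refine ⟨seminorm_le_of_forall_dual hq fun φ hφ => ?_,
    seminorm_le_of_forall_dual hq fun φ hφ => ?_,
    fun hlk => seminorm_le_of_forall_dual hq fun φ hφ => ?_⟩
  · have h1 := key φ hφ
    have h2 := (ContinuousMultilinearMap.le_opNorm _ y).trans (mul_le_mul_of_nonneg_right
      (norm_iteratedFDeriv_taylorPoly_le (hcd φ) (hM φ hφ) l hxb) hy0)
    rw [Real.norm_eq_abs] at h2
    have h3 : K * η * ‖x - b‖ ^ (k - l) * ∏ i, ‖y i‖ ≤ K * η * ∏ i, ‖y i‖ :=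
      mul_le_mul_of_nonneg_right (mul_le_of_le_one_right (mul_nonneg hK0 hη0)
        (pow_le_one₀ (norm_nonneg _) hxb)) hy0
    have h4 := abs_sub_abs_le_abs_sub (φ (extFamily P k d l x y))
      (iteratedFDeriv ℝ l (taylorPoly k (scalarExt φ f) b) x y)
    rw [add_mul]
    linarith
  · have h1 := key φ hφ
    have h2 := (ContinuousMultilinearMap.le_opNorm _ y).trans (mul_le_mul_of_nonneg_right
      (norm_iteratedFDeriv_taylorPoly_sub_self_le (hcd φ) (hM φ hφ) l hxb) hy0)
    rw [iteratedFDeriv_taylorPoly_self (hcd φ) hl, sub_apply, Real.norm_eq_abs] at h2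
    rw [map_sub, hd φ l hl, add_mul]
    exact (abs_sub_le _ _ _).trans (add_le_add h1 h2)
  · have h1 := key φ hφ
    have h2 := norm_iteratedFDeriv_taylorPoly_sub_sub_le (hcd φ) (hM φ hφ) hlk hxb y
    rw [Real.norm_eq_abs] at h2
    rw [map_sub, map_sub, hd φ l hl, hd φ (l + 1) hlk, add_mul, sub_sub]
    rw [sub_sub] at h2
    exact (abs_sub_le _ _ _).trans (add_le_add h1 h2)

/-- Bounds for the extended family near a point of `A`. -/
theorem exists_extFamily_le_of_mem (P : WhitneyPartition (interior A)) (k : ℕ) :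
    ∃ K : ℝ, 0 ≤ K ∧ ∀ (f : A → E) (d : ∀ l : ℕ, A → (Fin l → EuclideanSpace ℝ (Fin n)) → E)
      (_ : IsDifferentialFamily k f d) (q : Seminorm ℝ E) (_ : Continuous q)
      (a : A) (r η M : ℝ) (_ : LocalBound k d q a r η M) (_ : r ≤ 1 / 2)
      (x : EuclideanSpace ℝ (Fin n)) (_ : x ∈ A ∨ x ∉ closure A)
      (_ : x ∈ Metric.ball (a : EuclideanSpace ℝ (Fin n)) (r / 16)) (l : ℕ)
      (_ : l ≤ k) (y : Fin l → EuclideanSpace ℝ (Fin n)),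
      q (extFamily P k d l x y) ≤ (K * η + 2 ^ k * M) * ∏ i, ‖y i‖ ∧
      q (extFamily P k d l x y - d l a y) ≤
        (K * η * ‖x - a‖ ^ (k - l) + 2 ^ k * M * ‖x - a‖) * ∏ i, ‖y i‖ ∧
      (l < k → q (extFamily P k d l x y - d l a y -
          d (l + 1) a (Fin.cons (x - a) y : Fin (l + 1) → EuclideanSpace ℝ (Fin n))) ≤
        (K * η * ‖x - a‖ ^ (k - l) + 2 ^ k * M * ‖x - a‖ * ‖x - a‖) * ∏ i, ‖y i‖) := by
  obtain ⟨K, hK0, hK⟩ := exists_extFamily_le (E := E) P k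
  refine ⟨K, hK0, fun f d h q hq a r η M hB hr x hx hxa l hl y => ?_⟩
  have hr0 : 0 < r := by linarith [dist_nonneg.trans_lt hxa]
  have haa : (a : EuclideanSpace ℝ (Fin n)) ∈ Metric.ball (a : EuclideanSpace ℝ (Fin n)) r :=
    Metric.mem_ball_self hr0
  have hc : ∀ x : EuclideanSpace ℝ (Fin n), Continuous fun b : A => ‖x - b‖ := fun x =>
    (continuous_const.sub continuous_subtype_val).norm
  have hdc : Continuous fun b : A => d l b y := h.continuous_left hl y
  have hdc' : l < k → Continuous fun p : EuclideanSpace ℝ (Fin n) × A =>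
      d (l + 1) p.2 (Fin.cons (p.1 - p.2) y : Fin (l + 1) → EuclideanSpace ℝ (Fin n)) := by
    intro hlk
    refine (h.continuous (l + 1) hlk).comp (continuous_snd.prodMk ?_)
    have h1 : Continuous fun p : EuclideanSpace ℝ (Fin n) × A =>
        p.1 - (p.2 : EuclideanSpace ℝ (Fin n)) := by fun_prop
    exact Continuous.finCons (A := fun _ => EuclideanSpace ℝ (Fin n)) h1 continuous_const
  -- With `x` fixed, let the interior point `b` tend to `a`. If `x` is a point of `A`, a second
  -- limit in `x` follows.
  have key : ∀ x : EuclideanSpace ℝ (Fin n), x ∈ interior A ∨ x ∉ closure A →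
      x ∈ Metric.ball (a : EuclideanSpace ℝ (Fin n)) (r / 16) →
      q (extFamily P k d l x y) ≤ (K * η + 2 ^ k * M) * ∏ i, ‖y i‖ ∧
      q (extFamily P k d l x y - d l a y) ≤
        (K * η * ‖x - a‖ ^ (k - l) + 2 ^ k * M * ‖x - a‖) * ∏ i, ‖y i‖ ∧
      (l < k → q (extFamily P k d l x y - d l a y -
          d (l + 1) a (Fin.cons (x - a) y : Fin (l + 1) → EuclideanSpace ℝ (Fin n))) ≤
        (K * η * ‖x - a‖ ^ (k - l) + 2 ^ k * M * ‖x - a‖ * ‖x - a‖) * ∏ i, ‖y i‖) := by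
    intro x hx hxa
    have h1 := fun b hb => hK f d h q hq a r η M hB hr x hx hxa b hb l hl y
    have hx' := hc x
    refine ⟨le_of_forall_interior continuous_const continuous_const
        (fun b hb => (h1 b hb).1) a haa,
      le_of_forall_interior (hq.comp (continuous_const.sub hdc)) (by fun_prop)
        (fun b hb => (h1 b hb).2.1) a haa,
      fun hlk => le_of_forall_interior (hq.comp ((continuous_const.sub hdc).sub
        ((hdc' hlk).comp (continuous_const.prodMk continuous_id)))) (by fun_prop)
        (fun b hb => (h1 b hb).2.2 hlk) a haa⟩
  rcases hx with hx | hx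
  · have h1 : ∀ b : A, _ := fun b : A => key b
    have hGc : Continuous fun b : A => extFamily P k d l b y := by
      simpa only [extFamily_coe] using hdc
    have hx' : Continuous fun b : A => ‖(b : EuclideanSpace ℝ (Fin n)) - a‖ :=
      (continuous_subtype_val.sub continuous_const).norm
    refine ⟨le_of_forall_interior (hq.comp hGc) continuous_const
        (fun b hb => (h1 b (Or.inl hb.1) hb.2).1) ⟨x, hx⟩ hxa,
      le_of_forall_interior (hq.comp (hGc.sub continuous_const)) (by fun_prop)
        (fun b hb => (h1 b (Or.inl hb.1) hb.2).2.1) ⟨x, hx⟩ hxa,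
      fun hlk => le_of_forall_interior (hq.comp ((hGc.sub continuous_const).sub
        ((hdc' hlk).comp (continuous_subtype_val.prodMk continuous_const)))) (by fun_prop)
        (fun b hb => (h1 b (Or.inl hb.1) hb.2).2.2 hlk) ⟨x, hx⟩ hxa⟩
  · exact key x (Or.inr hx) hxa

end ExtFamily

/-! ### The extension is a `C^k`-function. -/

section ExtIsCk

open scoped ContDiff

variable {n : ℕ} {E : Type*} [AddCommGroup E] [Module ℝ E] [TopologicalSpace E]
  [IsTopologicalAddGroup E] [ContinuousSMul ℝ E] [LocallyConvexSpace ℝ E] [T2Space E]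
  {A U : Set (EuclideanSpace ℝ (Fin n))} [IsLocallyConvexDenseInterior A] {k : ℕ} {f : A → E}
  {d : ∀ l : ℕ, A → (Fin l → EuclideanSpace ℝ (Fin n)) → E}

theorem IsDifferentialFamily.exists_localBound (h : IsDifferentialFamily k f d) {q : Seminorm ℝ E}
    (hq : Continuous q) (a : A) {η : ℝ} (hη : 0 < η) :
    ∃ r > 0, r ≤ 1 / 2 ∧ ∃ M, LocalBound k d q a r η M := by
  obtain ⟨r₀, hr₀, hconv⟩ := exists_convex_interior_inter_ball a.2
  have hc : ∀ l ≤ k, Continuous fun x : A =>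
      ∑ w : Fin l → Fin n, q (d l x (dirWord w)) := fun l hl =>
    continuous_finsetSum _ fun w _ => hq.comp (h.continuous_left hl _)
  have hc' : Continuous fun x : A =>
      ∑ w : Fin k → Fin n, q (d k x (dirWord w) - d k a (dirWord w)) :=
    continuous_finsetSum _ fun w _ => hq.comp ((h.continuous_left le_rfl _).sub continuous_const)
  have e1 : ∀ᶠ x in 𝓝 a, ∑ w : Fin k → Fin n, q (d k x (dirWord w) - d k a (dirWord w)) < η / 2 :=
    hc'.continuousAt.eventually_lt continuousAt_const (by simpa using half_pos hη)
  have e2 : ∀ᶠ x in 𝓝 a, ∀ l ∈ Finset.range (k + 1), ∑ w : Fin l → Fin n, q (d l x (dirWord w)) <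
      ∑ w : Fin l → Fin n, q (d l a (dirWord w)) + 1 := by
    rw [Finset.eventually_all]
    exact fun l hl => (hc l (Nat.lt_succ_iff.1 (Finset.mem_range.1 hl))).continuousAt.eventually_lt
      continuousAt_const (lt_add_one _)
  obtain ⟨r₁, hr₁, H⟩ := Metric.eventually_nhds_iff.1 (e1.and e2)
  refine ⟨min (min r₀ r₁) (1 / 2), lt_min (lt_min hr₀ hr₁) (by norm_num), min_le_right _ _,
    ∑ l ∈ Finset.range (k + 1), (∑ w : Fin l → Fin n, q (d l a (dirWord w)) + 1), a.2,
    hconv _ ((min_le_left _ _).trans (min_le_left _ _)), fun x y hx hy => ?_, fun l hl x hx => ?_⟩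
  · have hx1 := (H (hx.2.trans_le ((min_le_left _ _).trans (min_le_right _ _)))).1
    have hy1 := (H (hy.2.trans_le ((min_le_left _ _).trans (min_le_right _ _)))).1
    have h1 : ∑ w : Fin k → Fin n, q (d k x (dirWord w) - d k y (dirWord w)) ≤
        ∑ w : Fin k → Fin n, q (d k x (dirWord w) - d k a (dirWord w)) +
        ∑ w : Fin k → Fin n, q (d k y (dirWord w) - d k a (dirWord w)) := by
      rw [← Finset.sum_add_distrib]
      refine Finset.sum_le_sum fun w _ => ?_
      rw [← sub_sub_sub_cancel_right _ _ (d k a (dirWord w))]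
      exact map_sub_le_add q _ _
    linarith
  · have hx1 := (H (hx.2.trans_le ((min_le_left _ _).trans (min_le_right _ _)))).2 l
      (Finset.mem_range.2 (Nat.lt_succ_iff.2 hl))
    refine hx1.le.trans (Finset.single_le_sum
      (f := fun l => ∑ w : Fin l → Fin n, q (d l a (dirWord w)) + 1) (fun m _ => ?_)
      (Finset.mem_range.2 (Nat.lt_succ_iff.2 hl)))
    exact add_nonneg (Finset.sum_nonneg fun _ _ => apply_nonneg q _) zero_le_one

theorem mem_of_mem_closure (hAU : A ⊆ U)
    (hclosed : IsClosed {x : U | (x : EuclideanSpace ℝ (Fin n)) ∈ A}) {x : EuclideanSpace ℝ (Fin n)}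
    (hxU : x ∈ U) (hx : x ∈ closure A) : x ∈ A := by
  have h1 : (⟨x, hxU⟩ : U) ∈ closure {x : U | (x : EuclideanSpace ℝ (Fin n)) ∈ A} := by
    rw [closure_subtype]
    refine closure_mono (fun z hz => ?_) hx
    exact ⟨⟨z, hAU hz⟩, hz, rfl⟩
  exact hclosed.closure_subset h1

theorem WhitneyPartition.exists_taylorWeight_eq_zero (P : WhitneyPartition (interior A)) (k : ℕ)
    {x : EuclideanSpace ℝ (Fin n)} (hx : x ∉ closure A) :
    ∃ S : Finset P.ι, ∀ᶠ z in 𝓝 x,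
      ∀ c ∉ S ×ˢ (Finset.univ : Finset (Σ l : Fin (k + 1), (Fin l → Fin n))),
        taylorWeight P k c z = 0 := by
  obtain ⟨S, -, hS, -⟩ := P.locally_finite x fun hc => hx (closure_mono interior_subset hc)
  exact ⟨S, eventually_taylorWeight_eq_zero hS⟩

theorem IsDifferentialFamily.extFamily_eq_sum_words (h : IsDifferentialFamily k f d)
    (P : WhitneyPartition (interior A)) {l : ℕ} (hl : l ≤ k) {x : EuclideanSpace ℝ (Fin n)}
    (hx : x ∈ A ∨ x ∉ closure A) (y : Fin l → EuclideanSpace ℝ (Fin n)) :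
    extFamily P k d l x y =
      ∑ w : Fin l → Fin n, (∏ j, y j (w j)) • extFamily P k d l x (dirWord w) := by
  rcases hx with hx | hx
  · have := h.eq_sum_words hl ⟨x, hx⟩ y
    simpa only [← extFamily_coe (k := k) P l (⟨x, hx⟩ : A)] using this
  · have hxA : x ∉ A := fun hc => hx (subset_closure hc)
    obtain ⟨S, hS⟩ := P.exists_taylorWeight_eq_zero k hx
    simp only [extFamily_of_notMem P l hxA]
    exact sumDeriv_eq_sum_words hS (taylorCoeff P d) l y (Equiv.refl _)

theorem IsDifferentialFamily.cons_smul (h : IsDifferentialFamily k f d) {l : ℕ} (hl : l < k)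
    (x : A) (t : ℝ) (z : EuclideanSpace ℝ (Fin n)) (y : Fin l → EuclideanSpace ℝ (Fin n)) :
    d (l + 1) x (Fin.cons (t • z) y : Fin (l + 1) → EuclideanSpace ℝ (Fin n)) =
      t • d (l + 1) x (Fin.cons z y : Fin (l + 1) → EuclideanSpace ℝ (Fin n)) := by
  rw [h.eq_sum_words hl, h.eq_sum_words hl x (Fin.cons z y), Finset.smul_sum]
  refine Finset.sum_congr rfl fun w _ => ?_
  rw [Fin.prod_univ_succ, Fin.prod_univ_succ, smul_smul]
  simp only [Fin.cons_zero, Fin.cons_succ, PiLp.smul_apply, smul_eq_mul, mul_assoc]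

/-- Differential families record the newest direction last, Fréchet derivatives record it first; a
rotation, harmless by symmetry, converts between them. -/
theorem cons_last_comp_finRotate {α : Type*} {l : ℕ} (y : Fin (l + 1) → α) :
    (Fin.cons (y (Fin.last l)) (Fin.init y) : Fin (l + 1) → α) ∘ finRotate (l + 1) = y := by
  have h1 := Fin.snoc_eq_cons_rotate (Fin.init y) (y (Fin.last l))
  conv_rhs => rw [← Fin.snoc_init_self y]
  exact h1.symm

/-- For `l = k` the error term `K * η * ‖x - a‖ ^ (k - l)` does not decay as `x → a`. Hence `η` is
chosen small in terms of `ε` first, and then the ball on which the oscillation is at most `η`. -/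
theorem IsDifferentialFamily.continuousWithinAt_extFamily (h : IsDifferentialFamily k f d)
    (P : WhitneyPartition (interior A)) {l : ℕ} (hl : l ≤ k)
    (y : Fin l → EuclideanSpace ℝ (Fin n)) (a : A) :
    ContinuousWithinAt (fun x => extFamily P k d l x y) (A ∪ (closure A)ᶜ) a := by
  obtain ⟨K, hK0, hK⟩ := exists_extFamily_le_of_mem (E := E) P k
  rw [ContinuousWithinAt, extFamily_coe, tendsto_nhds_iff_seminorm]
  intro q hq ε hε
  have hy0 : 0 ≤ ∏ i, ‖y i‖ := Finset.prod_nonneg fun _ _ => norm_nonneg _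
  obtain ⟨η, hη, hηε⟩ : ∃ η > 0, K * η * ∏ i, ‖y i‖ < ε := by
    refine ⟨ε / (K * (∏ i, ‖y i‖) + 1), by positivity, ?_⟩
    have h1 : 0 < K * (∏ i, ‖y i‖) + 1 := by positivity
    rw [mul_right_comm, mul_div_assoc', div_lt_iff₀ h1]
    nlinarith
  obtain ⟨r, hr0, hr, M, hB⟩ := h.exists_localBound hq a hη
  have hlim : Tendsto (fun x : EuclideanSpace ℝ (Fin n) =>
      (K * η + 2 ^ k * M * ‖x - a‖) * ∏ i, ‖y i‖) (𝓝[A ∪ (closure A)ᶜ] a)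
      (𝓝 (K * η * ∏ i, ‖y i‖)) := by
    have hcont : Continuous (fun x : EuclideanSpace ℝ (Fin n) =>
      (K * η + 2 ^ k * M * ‖x - a‖) * ∏ i, ‖y i‖) := by fun_prop
    simpa using (hcont.tendsto a).mono_left nhdsWithin_le_nhds
  filter_upwards [hlim.eventually_lt_const hηε, self_mem_nhdsWithin,
    mem_nhdsWithin_of_mem_nhds (Metric.ball_mem_nhds (a : EuclideanSpace ℝ (Fin n))
      (show 0 < r / 16 by positivity))] with x hx1 hxA hxr
  refine lt_of_le_of_lt (((hK f d h q hq a r η M hB hr x hxA hxr l hl y).2.1).trans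
    (mul_le_mul_of_nonneg_right (add_le_add_left ?_ _) hy0)) hx1
  refine mul_le_of_le_one_right (by positivity) (pow_le_one₀ (norm_nonneg _) ?_)
  rw [← dist_eq_norm]
  linarith [Metric.mem_ball.1 hxr]

/-- As `l < k`, the error is at most linear in `|t|` with coefficient proportional to `η`, plus a
quadratic term. After division by `t` the first part is made small by the choice of `η` and the
second tends to `0`. -/
theorem IsDifferentialFamily.tendsto_extFamily_slope (h : IsDifferentialFamily k f d)
    (P : WhitneyPartition (interior A)) {l : ℕ} (hl : l < k)
    (y : Fin l → EuclideanSpace ℝ (Fin n)) (a : A) (z : EuclideanSpace ℝ (Fin n))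
    (hz : ∀ᶠ t in 𝓝[≠] (0 : ℝ), (a : EuclideanSpace ℝ (Fin n)) + t • z ∈ A ∪ (closure A)ᶜ) :
    Tendsto (fun t : ℝ => t⁻¹ • (extFamily P k d l (a + t • z) y - d l a y)) (𝓝[≠] 0)
      (𝓝 (d (l + 1) a (Fin.cons z y : Fin (l + 1) → EuclideanSpace ℝ (Fin n)))) := by
  obtain ⟨K, hK0, hK⟩ := exists_extFamily_le_of_mem (E := E) P k
  rw [tendsto_nhds_iff_seminorm]
  intro q hq ε hε
  have hy0 : 0 ≤ ∏ i, ‖y i‖ := Finset.prod_nonneg fun _ _ => norm_nonneg _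
  obtain ⟨η, hη, hηε⟩ : ∃ η > 0, K * η * ‖z‖ * ∏ i, ‖y i‖ < ε := by
    refine ⟨ε / (K * ‖z‖ * (∏ i, ‖y i‖) + 1), by positivity, ?_⟩
    have h1 : 0 < K * ‖z‖ * (∏ i, ‖y i‖) + 1 := by positivity
    rw [mul_right_comm K, mul_right_comm (K * ‖z‖), mul_div_assoc', div_lt_iff₀ h1]
    nlinarith
  obtain ⟨r, hr0, hr, M, hB⟩ := h.exists_localBound hq a hη
  have hlim : Tendsto (fun t : ℝ => (K * η * ‖z‖ + 2 ^ k * M * |t| * (‖z‖ * ‖z‖)) * ∏ i, ‖y i‖)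
      (𝓝[≠] 0) (𝓝 (K * η * ‖z‖ * ∏ i, ‖y i‖)) := by
    have hcont : Continuous (fun t : ℝ =>
      (K * η * ‖z‖ + 2 ^ k * M * |t| * (‖z‖ * ‖z‖)) * ∏ i, ‖y i‖) := by fun_prop
    simpa using (hcont.tendsto 0).mono_left nhdsWithin_le_nhds
  have hlim2 : Tendsto (fun t : ℝ => (a : EuclideanSpace ℝ (Fin n)) + t • z) (𝓝[≠] 0) (𝓝 a) := by
    have hcont : Continuous fun t : ℝ => (a : EuclideanSpace ℝ (Fin n)) + t • z := by fun_prop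
    simpa using (hcont.tendsto 0).mono_left nhdsWithin_le_nhds
  filter_upwards [hlim.eventually_lt_const hηε, hz, hlim2.eventually (Metric.ball_mem_nhds
      (a : EuclideanSpace ℝ (Fin n)) (show 0 < r / 16 by positivity)), self_mem_nhdsWithin]
    with t ht1 htA htr ht0
  have ht0' : 0 < |t| := abs_pos.2 ht0
  have h1 := (hK f d h q hq a r η M hB hr _ htA htr l hl.le y).2.2 hl
  have hn : ‖(a : EuclideanSpace ℝ (Fin n)) + t • z - a‖ = |t| * ‖z‖ := by
    rw [add_sub_cancel_left, norm_smul, Real.norm_eq_abs]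
  have hle : |t| * ‖z‖ ≤ 1 := by
    rw [← hn, ← dist_eq_norm]
    linarith [Metric.mem_ball.1 htr]
  have hpow : (|t| * ‖z‖) ^ (k - l) ≤ |t| * ‖z‖ :=
    pow_le_of_le_one (by positivity) hle (Nat.sub_ne_zero_of_lt hl)
  rw [hn, add_sub_cancel_left, h.cons_smul hl] at h1
  have h2 : t⁻¹ • (extFamily P k d l (a + t • z) y - d l a y) -
      d (l + 1) a (Fin.cons z y : Fin (l + 1) → EuclideanSpace ℝ (Fin n)) =
      t⁻¹ • (extFamily P k d l (a + t • z) y - d l a y -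
        t • d (l + 1) a (Fin.cons z y : Fin (l + 1) → EuclideanSpace ℝ (Fin n))) := by
    rw [smul_sub t⁻¹ (_ - _), inv_smul_smul₀ ht0]
  rw [h2, map_smul_eq_mul, norm_inv, Real.norm_eq_abs, inv_mul_lt_iff₀ ht0']
  refine lt_of_le_of_lt (h1.trans (mul_le_mul_of_nonneg_right (add_le_add_left
    (mul_le_mul_of_nonneg_left hpow (by positivity)) _) hy0)) ?_
  calc _ = |t| * ((K * η * ‖z‖ + 2 ^ k * M * |t| * (‖z‖ * ‖z‖)) * ∏ i, ‖y i‖) := by ring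
    _ < |t| * ε := mul_lt_mul_of_pos_left ht1 ht0'

theorem IsDifferentialFamily.isDifferentialFamily_extFamily (h : IsDifferentialFamily k f d)
    (P : WhitneyPartition (interior A)) (hAU : A ⊆ U)
    (hclosed : IsClosed {x : U | (x : EuclideanSpace ℝ (Fin n)) ∈ A}) :
    IsDifferentialFamily k (fun x : U => extFamily P k d 0 x Fin.elim0)
      (fun l (x : U) y => extFamily P k d l x y) := by
  have hU : ∀ x ∈ U, x ∈ A ∪ (closure A)ᶜ := fun x hx => by
    by_cases hc : x ∈ closure A
    · exact Or.inl (mem_of_mem_closure hAU hclosed hx hc)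
    · exact Or.inr hc
  refine ⟨fun x y => congrArg _ (Subsingleton.elim _ _), fun l hl x hx y => ?_, fun l hl => ?_⟩
  · have hlim : Tendsto (fun t : ℝ => (x : EuclideanSpace ℝ (Fin n)) + t • y (Fin.last l))
        (𝓝[≠] 0) (𝓝 x) := by
      have hcont : Continuous fun t : ℝ =>
        (x : EuclideanSpace ℝ (Fin n)) + t • y (Fin.last l) := by fun_prop
      simpa using (hcont.tendsto 0).mono_left nhdsWithin_le_nhds
    have hxU := hlim.eventually (mem_interior_iff_mem_nhds.1 hx)
    have hval : ∀ᶠ t in 𝓝[≠] (0 : ℝ), Function.extend Subtype.val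
        (fun z : U => extFamily P k d l z (Fin.init y)) 0 (x + t • y (Fin.last l)) =
        extFamily P k d l (x + t • y (Fin.last l)) (Fin.init y) := by
      filter_upwards [hxU] with t ht
      exact Subtype.val_injective.extend_apply
        (fun z : U => extFamily P k d l z (Fin.init y)) 0 ⟨_, ht⟩
    rw [HasDirDerivAt]
    by_cases hxA : (x : EuclideanSpace ℝ (Fin n)) ∈ A
    · have h1 := h.tendsto_extFamily_slope P hl (Fin.init y) ⟨x, hxA⟩ (y (Fin.last l))
        (hxU.mono fun t ht => hU _ ht)
      have h2 : extFamily P k d (l + 1) x y = d (l + 1) ⟨x, hxA⟩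
          (Fin.cons (y (Fin.last l)) (Fin.init y) : Fin (l + 1) → EuclideanSpace ℝ (Fin n)) := by
        have h3 := h.comp_perm hl ⟨x, hxA⟩ (Fin.cons (y (Fin.last l)) (Fin.init y) :
          Fin (l + 1) → EuclideanSpace ℝ (Fin n)) (finRotate (l + 1))
        rw [cons_last_comp_finRotate] at h3
        rw [extFamily_coe P (l + 1) ⟨x, hxA⟩]
        exact h3
      rw [h2]
      refine h1.congr' ?_
      filter_upwards [hval] with t ht
      rw [ht, extFamily_coe P l ⟨x, hxA⟩]
    · have hxc : (x : EuclideanSpace ℝ (Fin n)) ∉ closure A := fun hc =>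
        hxA (mem_of_mem_closure hAU hclosed x.2 hc)
      obtain ⟨S, hS⟩ := P.exists_taylorWeight_eq_zero k hxc
      have h1 := tendsto_sumDeriv_slope (contDiff_taylorWeight P k) hS (taylorCoeff P d) l
        (Fin.init y) (y (Fin.last l))
      rw [← sumDeriv_comp_perm (contDiff_taylorWeight P k) _ _ _ _ (finRotate (l + 1)),
        cons_last_comp_finRotate] at h1
      rw [extFamily_of_notMem P (l + 1) hxA]
      refine h1.congr' ?_
      filter_upwards [hval, hlim.eventually (isClosed_closure.isOpen_compl.mem_nhds hxc)]
        with t ht htA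
      rw [ht, extFamily_of_notMem P l fun hc => htA (subset_closure hc),
        extFamily_of_notMem P l hxA]
  · have hcw : ∀ y : Fin l → EuclideanSpace ℝ (Fin n),
        Continuous fun x : U => extFamily P k d l x y := by
      refine fun y => continuous_iff_continuousAt.2 fun x => ?_
      by_cases hxA : (x : EuclideanSpace ℝ (Fin n)) ∈ A
      · have h1 := (h.continuousWithinAt_extFamily P hl y ⟨x, hxA⟩).mono fun z hz => hU z hz
        exact continuousWithinAt_iff_continuousAt_domRestrict _ x.2 |>.1 h1
      · have hxc : (x : EuclideanSpace ℝ (Fin n)) ∉ closure A := fun hc =>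
          hxA (mem_of_mem_closure hAU hclosed x.2 hc)
        obtain ⟨S, hS⟩ := P.exists_taylorWeight_eq_zero k hxc
        have h1 := continuousAt_sumDeriv (contDiff_taylorWeight P k) hS (taylorCoeff P d) l y
        have h2 : ContinuousAt (fun x => extFamily P k d l x y)
            (x : EuclideanSpace ℝ (Fin n)) := by
          refine h1.congr ?_
          filter_upwards [isClosed_closure.isOpen_compl.mem_nhds hxc] with z hz
          rw [extFamily_of_notMem P l fun hc => hz (subset_closure hc)]
        exact ContinuousAt.comp (f := ((↑) : U → EuclideanSpace ℝ (Fin n))) h2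
          continuous_subtype_val.continuousAt
    -- Joint continuity follows from multilinearity: finitely many functions of the point with
    -- coefficients polynomial in the directions.
    have h3 : (fun p : U × (Fin l → EuclideanSpace ℝ (Fin n)) => extFamily P k d l p.1 p.2) =
        fun p => ∑ w : Fin l → Fin n, (∏ j, p.2 j (w j)) •
          extFamily P k d l p.1 (dirWord w) :=
      funext fun p => h.extFamily_eq_sum_words P hl (hU _ p.1.2) p.2
    rw [h3]
    refine continuous_finsetSum _ fun w _ => Continuous.smul ?_ ((hcw _).comp continuous_fst)
    exact continuous_finsetProd _ fun j _ =>
      (EuclideanSpace.proj (𝕜 := ℝ) (w j)).continuous.comp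
        ((continuous_apply j).comp continuous_snd)

end ExtIsCk

/-! ### Linearity and continuity of the extension operator. -/

section ExtOperator

open scoped ContDiff NNReal

variable {n : ℕ} {E : Type*} [AddCommGroup E] [Module ℝ E] [TopologicalSpace E]
  [IsTopologicalAddGroup E] [ContinuousSMul ℝ E] [LocallyConvexSpace ℝ E] [T2Space E]
  {A U : Set (EuclideanSpace ℝ (Fin n))} [IsLocallyConvexDenseInterior A]
  [IsLocallyConvexDenseInterior U] {k : ℕ}

theorem mem_union_compl_closure (hAU : A ⊆ U)
    (hclosed : IsClosed {x : U | (x : EuclideanSpace ℝ (Fin n)) ∈ A}) (x : U) :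
    (x : EuclideanSpace ℝ (Fin n)) ∈ A ∨ (x : EuclideanSpace ℝ (Fin n)) ∉ closure A := by
  by_cases hc : (x : EuclideanSpace ℝ (Fin n)) ∈ closure A
  · exact Or.inl (mem_of_mem_closure hAU hclosed x.2 hc)
  · exact Or.inr hc

/-- `Ck.differential` is a choice, so additivity rests on uniqueness of the differentials of order
at most `k`; the Taylor coefficients involve no others. -/
theorem extFamily_add (P : WhitneyPartition (interior A)) (f g : Ck k A E) {l : ℕ} (hl : l ≤ k)
    {x : EuclideanSpace ℝ (Fin n)} (hx : x ∈ A ∨ x ∉ closure A)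
    (y : Fin l → EuclideanSpace ℝ (Fin n)) :
    extFamily P k (f + g).differential l x y =
      extFamily P k f.differential l x y + extFamily P k g.differential l x y := by
  have h1 := (f + g).isDifferentialFamily.unique
    (f.isDifferentialFamily.add g.isDifferentialFamily)
  rcases hx with hx | hx
  · simp only [extFamily_coe P l ⟨x, hx⟩]
    exact h1 l hl _ _
  · have hxA : x ∉ A := fun hc => hx (subset_closure hc)
    obtain ⟨S, hS⟩ := P.exists_taylorWeight_eq_zero k hx
    simp only [extFamily_of_notMem P l hxA, sumDeriv_eq hS]
    rw [← Finset.sum_add_distrib]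
    refine Finset.sum_congr rfl fun c _ => ?_
    rw [← smul_add]
    exact congrArg _ (h1 _ (Nat.lt_succ_iff.1 c.2.1.2) _ _)

theorem extFamily_smul (P : WhitneyPartition (interior A)) (t : ℝ) (f : Ck k A E) {l : ℕ}
    (hl : l ≤ k) {x : EuclideanSpace ℝ (Fin n)} (hx : x ∈ A ∨ x ∉ closure A)
    (y : Fin l → EuclideanSpace ℝ (Fin n)) :
    extFamily P k (t • f).differential l x y = t • extFamily P k f.differential l x y := by
  have h1 := (t • f).isDifferentialFamily.unique (f.isDifferentialFamily.const_smul t)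
  rcases hx with hx | hx
  · simp only [extFamily_coe P l ⟨x, hx⟩]
    exact h1 l hl _ _
  · have hxA : x ∉ A := fun hc => hx (subset_closure hc)
    obtain ⟨S, hS⟩ := P.exists_taylorWeight_eq_zero k hx
    simp only [extFamily_of_notMem P l hxA, sumDeriv_eq hS]
    rw [Finset.smul_sum]
    refine Finset.sum_congr rfl fun c _ => ?_
    rw [smul_comm]
    exact congrArg _ (h1 _ (Nat.lt_succ_iff.1 c.2.1.2) _ _)

/-- The extension operator `C^k(A, E) → C^k(U, E)`. -/
def extLinearMap (P : WhitneyPartition (interior A)) (k : ℕ) (E : Type*) [AddCommGroup E]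
    [Module ℝ E] [TopologicalSpace E] [IsTopologicalAddGroup E] [ContinuousSMul ℝ E]
    [LocallyConvexSpace ℝ E] [T2Space E] (hAU : A ⊆ U)
    (hclosed : IsClosed {x : U | (x : EuclideanSpace ℝ (Fin n)) ∈ A}) :
    Ck k A E →ₗ[ℝ] Ck k U E where
  toFun f := ⟨fun x : U => extFamily P k f.differential 0 x Fin.elim0, _,
    f.isDifferentialFamily.isDifferentialFamily_extFamily P hAU hclosed⟩
  map_add' f g := Subtype.ext <| funext fun x =>
    extFamily_add P f g (Nat.zero_le k) (mem_union_compl_closure hAU hclosed x) _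
  map_smul' t f := Subtype.ext <| funext fun x =>
    extFamily_smul P t f (Nat.zero_le k) (mem_union_compl_closure hAU hclosed x) _

theorem restrict_extLinearMap (P : WhitneyPartition (interior A)) (hAU : A ⊆ U)
    (hclosed : IsClosed {x : U | (x : EuclideanSpace ℝ (Fin n)) ∈ A}) (f : Ck k A E) :
    Ck.restrict hAU (extLinearMap P k E hAU hclosed f) = f := by
  refine Subtype.ext <| funext fun a => ?_
  exact (extFamily_coe P 0 a Fin.elim0).trans (f.isDifferentialFamily.zero a _)

theorem partialDeriv_extLinearMap (P : WhitneyPartition (interior A)) (hAU : A ⊆ U)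
    (hclosed : IsClosed {x : U | (x : EuclideanSpace ℝ (Fin n)) ∈ A}) (f : Ck k A E)
    {α : Fin n → ℕ} (hα : ∑ i, α i ≤ k) (x : U) :
    (extLinearMap P k E hAU hclosed f).partialDeriv α x =
      extFamily P k f.differential _ x (dirWord (multiIndexWord α).get) :=
  (extLinearMap P k E hAU hclosed f).isDifferentialFamily.unique
    (f.isDifferentialFamily.isDifferentialFamily_extFamily P hAU hclosed) _
    ((length_multiIndexWord α).trans_le hα) _ _

theorem Ck.seminorm_differential_le (f : Ck k A E) {q : Seminorm ℝ E} (hq : Continuous q)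
    (L : TopologicalSpace.Compacts A) {l : ℕ} (hl : l ≤ k) {x : A} (hx : x ∈ L)
    (w : Fin l → Fin n) :
    q (f.differential l x (dirWord w)) ≤
      Ck.seminormFamily k A E (⟨k, le_rfl⟩, ⟨q, hq⟩, L) f := by
  obtain ⟨α, hα, h1⟩ := f.isDifferentialFamily.dirWord_eq hl x w
  rw [h1]
  exact le_ciSup (f.bddAbove_partialDeriv le_rfl hq L)
    (⟨⟨α, hα.trans_le hl⟩, ⟨x, hx⟩⟩ : {α : Fin n → ℕ // ∑ i, α i ≤ k} × L)

/-- Local boundedness of the extension operator near the points of `A`. -/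
theorem exists_extFamily_le_seminorm_of_mem [LocallyCompactSpace A]
    (P : WhitneyPartition (interior A)) {q : Seminorm ℝ E} (hq : Continuous q) (a : A) :
    ∃ i, ∃ C : ℝ≥0, ∀ᶠ x in 𝓝 (a : EuclideanSpace ℝ (Fin n)), x ∈ A ∨ x ∉ closure A →
      ∀ f : Ck k A E, ∀ l ≤ k, ∀ w : Fin l → Fin n,
        q (extFamily P k f.differential l x (dirWord w)) ≤ C * Ck.seminormFamily k A E i f := by
  obtain ⟨K, hK0, hK⟩ := exists_extFamily_le_of_mem (E := E) P k
  obtain ⟨r₀, hr₀, hconv⟩ := exists_convex_interior_inter_ball a.2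
  -- Local compactness of `A`: the radius below comes from `L` and local convexity alone, hence is
  -- the same for all `f`.
  obtain ⟨L, hL, hLa⟩ := exists_compact_mem_nhds a
  obtain ⟨r₁, hr₁, hrL⟩ := Metric.mem_nhds_iff.1 hLa
  set r := min (min r₀ r₁) (1 / 2)
  have hr0 : 0 < r := lt_min (lt_min hr₀ hr₁) (by norm_num)
  set N : ℝ := ∑ l ∈ Finset.range (k + 1), (Fintype.card (Fin l → Fin n) : ℝ)
  have hN0 : 0 ≤ N := Finset.sum_nonneg fun _ _ => Nat.cast_nonneg _
  set i : {l : ℕ // l ≤ k} × {q : Seminorm ℝ E // Continuous q} × TopologicalSpace.Compacts A :=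
    (⟨k, le_rfl⟩, ⟨q, hq⟩, ⟨L, hL⟩)
  refine ⟨i, NNReal.mk (K * (2 * N) + 2 ^ k * N) (by positivity), ?_⟩
  filter_upwards [Metric.ball_mem_nhds (a : EuclideanSpace ℝ (Fin n))
    (show 0 < r / 16 by positivity)] with x hxr hxA f l hl w
  set p : ℝ := Ck.seminormFamily k A E i f
  have hp0 : 0 ≤ p := apply_nonneg _ _
  have hb : ∀ l ≤ k, ∀ x : A,
      (x : EuclideanSpace ℝ (Fin n)) ∈ Metric.ball (a : EuclideanSpace ℝ (Fin n)) r →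
      ∑ w : Fin l → Fin n, q (f.differential l x (dirWord w)) ≤ N * p := by
    intro l hl x hx
    have hxL : x ∈ L := hrL (Metric.ball_subset_ball
      ((min_le_left _ _).trans (min_le_right _ _)) (show x ∈ Metric.ball a r from hx))
    calc _ ≤ ∑ w : Fin l → Fin n, p := Finset.sum_le_sum fun w _ =>
          f.seminorm_differential_le hq ⟨L, hL⟩ hl hxL w
      _ = Fintype.card (Fin l → Fin n) * p := by
          rw [Finset.sum_const, nsmul_eq_mul, Finset.card_univ]
      _ ≤ N * p := mul_le_mul_of_nonneg_right (Finset.single_le_sum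
          (f := fun l => (Fintype.card (Fin l → Fin n) : ℝ)) (fun _ _ => Nat.cast_nonneg _)
          (Finset.mem_range.2 (Nat.lt_succ_iff.2 hl))) hp0
  -- No small oscillation is needed for boundedness: twice the supremum serves as `η`, which keeps
  -- the bound linear in the seminorm `p` of `f`. The constant `N` dominates the number of words of
  -- each length up to `k`.
  have hB : LocalBound k f.differential q a r (2 * N * p) (N * p) := by
    refine ⟨a.2, hconv _ ((min_le_left _ _).trans (min_le_left _ _)), fun x y hx hy => ?_,
      fun l hl x hx => hb l hl x hx.2⟩
    calc _ ≤ ∑ w : Fin k → Fin n, (q (f.differential k x (dirWord w)) +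
          q (f.differential k y (dirWord w))) := Finset.sum_le_sum fun w _ => map_sub_le_add q _ _
      _ ≤ 2 * N * p := by
          rw [Finset.sum_add_distrib]
          linarith [hb k le_rfl x hx.2, hb k le_rfl y hy.2]
  refine ((hK f f.differential f.isDifferentialFamily q hq a r _ _ hB (min_le_right _ _) x hxA hxr
    l hl (dirWord w)).1).trans (le_of_eq ?_)
  simp only [norm_dirWord, Finset.prod_const_one, NNReal.coe_mk]
  ring

/-- Local boundedness of the extension operator off the closure of `A`. -/
theorem exists_extFamily_le_seminorm_of_notMem (P : WhitneyPartition (interior A))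
    {q : Seminorm ℝ E} (hq : Continuous q) {x₀ : EuclideanSpace ℝ (Fin n)} (hx₀ : x₀ ∉ closure A) :
    ∃ i, ∃ C : ℝ≥0, ∀ᶠ x in 𝓝 x₀,
      ∀ f : Ck k A E, ∀ l ≤ k, ∀ w : Fin l → Fin n,
        q (extFamily P k f.differential l x (dirWord w)) ≤ C * Ck.seminormFamily k A E i f := by
  classical
  obtain ⟨S, hS⟩ := P.exists_taylorWeight_eq_zero k hx₀
  set pt : P.ι → A := fun i => ⟨P.pt i, interior_subset (P.pt_mem i)⟩
  -- Near `x₀` the extension involves only the jets of `f` at finitely many nodes, which form a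
  -- compact set.
  set L : TopologicalSpace.Compacts A := ⟨(S.image pt : Finset A), (Finset.finite_toSet _).isCompact⟩
  set T := S ×ˢ (Finset.univ : Finset (Σ l : Fin (k + 1), (Fin l → Fin n)))
  set F : EuclideanSpace ℝ (Fin n) → ℝ := fun z => ∑ l ∈ Finset.range (k + 1),
    ∑ w : Fin l → Fin n, ∑ c ∈ T, |iteratedFDeriv ℝ l (taylorWeight P k c) z (dirWord w)|
  have hFc : Continuous F := continuous_finsetSum _ fun l _ => continuous_finsetSum _ fun w _ =>
    continuous_finsetSum _ fun c _ =>
      (continuous_iteratedFDeriv_apply (contDiff_taylorWeight P k c) l _).abs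
  have hF0 : ∀ z, 0 ≤ F z := fun z => Finset.sum_nonneg fun _ _ => Finset.sum_nonneg fun _ _ =>
    Finset.sum_nonneg fun _ _ => abs_nonneg _
  refine ⟨(⟨k, le_rfl⟩, ⟨q, hq⟩, L), NNReal.mk (F x₀ + 1) (add_nonneg (hF0 _) zero_le_one), ?_⟩
  filter_upwards [eventually_eventually_nhds.2 hS, isClosed_closure.isOpen_compl.mem_nhds hx₀,
    hFc.continuousAt.eventually_lt continuousAt_const (lt_add_one (F x₀))] with x hxS hxA hxF
    f l hl w
  set p : ℝ := Ck.seminormFamily k A E (⟨k, le_rfl⟩, ⟨q, hq⟩, L) f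
  have hp0 : 0 ≤ p := apply_nonneg _ _
  rw [extFamily_of_notMem P l fun hc => hxA (subset_closure hc), sumDeriv_eq hxS, NNReal.coe_mk]
  calc _ ≤ ∑ c ∈ T, |iteratedFDeriv ℝ l (taylorWeight P k c) x (dirWord w)| * p := by
        refine (Finset.le_sum_of_subadditive q (map_zero q).le (map_add_le_add q) _ _).trans (Finset.sum_le_sum fun c hc => ?_)
        rw [map_smul_eq_mul, Real.norm_eq_abs]
        refine mul_le_mul_of_nonneg_left (f.seminorm_differential_le hq L
          (Nat.lt_succ_iff.1 c.2.1.2) ?_ _) (abs_nonneg _)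
        exact Finset.mem_coe.2 (Finset.mem_image_of_mem pt (Finset.mem_product.1 hc).1)
    _ ≤ F x * p := by
        rw [← Finset.sum_mul]
        refine mul_le_mul_of_nonneg_right ?_ hp0
        refine le_trans ?_ (Finset.single_le_sum (fun l _ => Finset.sum_nonneg fun w _ =>
          Finset.sum_nonneg fun c _ => abs_nonneg _) (Finset.mem_range.2 (Nat.lt_succ_iff.2 hl)))
        exact Finset.single_le_sum (f := fun w : Fin l → Fin n => ∑ c ∈ T,
          |iteratedFDeriv ℝ l (taylorWeight P k c) x (dirWord w)|) (fun w _ =>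
          Finset.sum_nonneg fun c _ => abs_nonneg _) (Finset.mem_univ w)
    _ ≤ _ := mul_le_mul_of_nonneg_right hxF.le hp0

/-- Compactness glues the local bounds, the finitely many seminorms being collected in one supremum.
-/
theorem exists_extFamily_le_sup_seminorm [LocallyCompactSpace A]
    (P : WhitneyPartition (interior A)) (hAU : A ⊆ U)
    (hclosed : IsClosed {x : U | (x : EuclideanSpace ℝ (Fin n)) ∈ A}) {q : Seminorm ℝ E}
    (hq : Continuous q) {L : Set U} (hL : IsCompact L) :
    ∃ s : Finset ({l : ℕ // l ≤ k} × {q : Seminorm ℝ E // Continuous q} ×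
        TopologicalSpace.Compacts A), ∃ C : ℝ≥0, ∀ x ∈ L, ∀ f : Ck k A E, ∀ l ≤ k,
      ∀ w : Fin l → Fin n, q (extFamily P k f.differential l x (dirWord w)) ≤
        C * s.sup (Ck.seminormFamily k A E) f := by
  classical
  refine hL.induction_on ⟨∅, 0, fun x hx => hx.elim⟩
    (fun s t hst ⟨T, C, hC⟩ => ⟨T, C, fun x hx => hC x (hst hx)⟩)
    (fun s t ⟨T, C, hC⟩ ⟨T', C', hC'⟩ => ?_) (fun x _ => ?_)
  · refine ⟨T ∪ T', max C C', fun x hx f l hl w => ?_⟩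
    rcases hx with hx | hx
    · refine (hC x hx f l hl w).trans ?_
      gcongr
      · exact le_max_left _ _
      · exact Seminorm.le_def.1 (Finset.sup_mono Finset.subset_union_left) f
    · refine (hC' x hx f l hl w).trans ?_
      gcongr
      · exact le_max_right _ _
      · exact Seminorm.le_def.1 (Finset.sup_mono Finset.subset_union_right) f
  · obtain ⟨i, C, hC⟩ : ∃ i, ∃ C : ℝ≥0, ∀ᶠ z in 𝓝 (x : EuclideanSpace ℝ (Fin n)),
        z ∈ A ∨ z ∉ closure A → ∀ f : Ck k A E, ∀ l ≤ k, ∀ w : Fin l → Fin n,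
        q (extFamily P k f.differential l z (dirWord w)) ≤ C * Ck.seminormFamily k A E i f := by
      rcases mem_union_compl_closure hAU hclosed x with hx | hx
      · exact exists_extFamily_le_seminorm_of_mem P hq ⟨x, hx⟩
      · obtain ⟨i, C, hC⟩ := exists_extFamily_le_seminorm_of_notMem (k := k) P hq hx
        exact ⟨i, C, hC.mono fun z hz _ => hz⟩
    refine ⟨_, mem_nhdsWithin_of_mem_nhds (continuous_subtype_val.continuousAt.eventually hC),
      {i}, C, fun z hz f l hl w => ?_⟩
    rw [Finset.sup_singleton]
    exact hz (mem_union_compl_closure hAU hclosed z) f l hl w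

theorem continuous_extLinearMap [LocallyCompactSpace A] (P : WhitneyPartition (interior A))
    (hAU : A ⊆ U) (hclosed : IsClosed {x : U | (x : EuclideanSpace ℝ (Fin n)) ∈ A}) :
    Continuous (extLinearMap P k E hAU hclosed) := by
  refine WithSeminorms.continuous_of_isBounded Ck.withSeminorms Ck.withSeminorms _ fun i => ?_
  obtain ⟨s, C, hC⟩ := exists_extFamily_le_sup_seminorm (k := k) P hAU hclosed i.2.1.2
    i.2.2.isCompact
  refine ⟨s, C, fun f => ?_⟩
  refine Real.iSup_le (fun p => ?_) (apply_nonneg _ _)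
  have hα : ∑ j, p.1.1 j ≤ k := p.1.2.trans i.1.2
  rw [partialDeriv_extLinearMap P hAU hclosed f hα]
  exact hC _ p.2.2 f _ ((length_multiIndexWord _).trans_le hα) _

end ExtOperator

end CkExt

end

theorem mainTheorem3 {n : ℕ} {E : Type*} [AddCommGroup E] [Module ℝ E] [TopologicalSpace E]
    [IsTopologicalAddGroup E] [ContinuousSMul ℝ E] [LocallyConvexSpace ℝ E] [T2Space E]
    (k : ℕ) (U A : Set (EuclideanSpace ℝ (Fin n)))
    [CkExt.IsLocallyConvexDenseInterior U] [CkExt.IsLocallyConvexDenseInterior A]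
    (hAU : A ⊆ U) (hclosed : IsClosed {x : U | (x : EuclideanSpace ℝ (Fin n)) ∈ A})
    (hcompact : LocallyCompactSpace A) :
    ∃ Φ : CkExt.Ck k A E →L[ℝ] CkExt.Ck k U E,
      ∀ f : CkExt.Ck k A E, CkExt.Ck.restrict hAU (Φ f) = f := by
  rcases A.eq_empty_or_nonempty with hA | hA
  -- For empty `A` there are no nodes to expand at, and any operator, such as `0`, will do.
  · exact ⟨0, fun f => Subtype.ext <| funext fun a =>
      absurd (hA.le a.2) (Set.notMem_empty _)⟩
  · have hD : (interior A).Nonempty := closure_nonempty_iff.1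
      (hA.mono CkExt.IsLocallyConvexDenseInterior.subset_closure_interior)
    obtain ⟨P⟩ := CkExt.exists_whitneyPartition hD
    exact ⟨⟨CkExt.extLinearMap P k E hAU hclosed, CkExt.continuous_extLinearMap P hAU hclosed⟩,
      fun f => CkExt.restrict_extLinearMap P hAU hclosed f⟩
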